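/- All graphs are finite, simple and connected. For a graph $G=(V,E)$ with $N=|V|$ vertices let $A$ be its adjacency matrix, $D$ the diagonal matrix of degrees, $L=D-A$ its Laplacian, $|v\rangle$ ($v\in V$) the standard basis of $\mathbb C^V$ and, for non-empty $S\subseteq V$, $|s_S\rangle=|S|^{-1/2}\sum_{v\in S}|v\rangle$; write $|s\rangle=|s_V\rangle$. An alternating quantum walk with Hamiltonian $H\in\{L,A\}$ is a finite product $$U=\prod_{j=1}^{p}e^{-iHt_j}e^{-i\theta_j|x_j\rangle\langle x_j|},\qquad t_j,\theta_j\in[0,2\pi),\ x_j\in V.$$ It has $p$ layers and time $T=\sum_{j=1}^p(t_j+\theta_j)$. An algorithm is said below to have time $O(\sqrt N)$ if both its total number of layers and its total time are at most $C\sqrt N$. Theorem. Consider the following families of graphs. 1. Johnson graphs $J(n,k)$, $1\le k\le n$, for any fixed $k$ (the $k$-subsets of an $n$-set, adjacent when they meet in $k-1$ elements); 2. Hamming graphs $H(d,q)$, $d,q\ge1$, for any fixed $d$ (the $d$-tuples over a $q$-set, adjacent when they differ in exactly one coordinate); 3. connected Kneser graphs $K(n,k)$, $k\ge 1$, $n\ge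 2k$, for any fixed $k$ (the $k$-subsets of an $n$-set, adjacent when disjoint); 4. Grassmann graphs $G_q(n,k)$, $1\le k\le n$, $q$ a prime power, for any fixed $k$ (the $k$-dimensional subspaces of $\mathbb F_q^n$, adjacent when they meet in dimension $k-1$); 5. rook graphs $K_m\mathbin{\square}K_n$, $m,n\ge1$; 6. complete-square graphs $K_n\mathbin{\square}C_4$, $n\ge1$; 7. complete bipartite graphs $K(N_1,N_2)$, $N_1,N_2\ge1$. For each family there is a constant $C$, depending only on the parameter that is fixed (on $k$ in 1, 3 and 4, on $d$ in 2, absolute in 5, 6 and 7), such that for every graph $G$ of the family the following algorithms with time $O(\sqrt N)$ exist, with this constant $C$. (a) Deterministic spatial search. For types 1 to 6: there are $p$ and $t_j,\theta_j$, independent of the marked vertex, such that for every marked vertex $m\in V$ $$\Big|\langle m|\prod_{j=1}^{p}e^{-iLt_j}e^{-i\theta_j|m\rangle\langle m|}|s\rangle\Big|^2=1.$$ For type 7, with vertex classes $V_1,V_2$: there are two alternating quantum walks with Hamiltonian $A$, run one after the other and with their layers and times added up, whose parameters are independent of the marked vertex $m$ and whose phase shifts are all at $m$, such that for $i=1,2$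 and every $m\in V_i$ the $i$-th walk, started in $|s_{V_i}\rangle$, ends in $m$ with probability $1$. (b) Perfect state transfer. For any $u,v\in V$ there is an alternating quantum walk $U$ with Hamiltonian $L$ and all $x_j\in\{u,v\}$ such that $|\langle v|U|u\rangle|=1$. (c) Exact uniform sampling. For any $m\in V$ there are an alternating quantum walk $U$ with Hamiltonian $L$ and all $x_j=m$, and a real $\gamma$, such that $|s\rangle=e^{-i\gamma}U|m\rangle$. -/

import Mathlib

noncomputable section

namespace AlternatingWalk

open scoped BigOperators

/-! ## Graphs -/

/-- Johnson graph `J(n,k)`: the `k`-subsets of an `n`-set, adjacent when they share exactly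
`k - 1` elements. -/
def johnsonGraph (n k : ℕ) : SimpleGraph {s : Finset (Fin n) // s.card = k} where
  Adj s t := (s.1 ∩ t.1).card + 1 = k
  symm := ⟨fun s t h => by rw [Finset.inter_comm]; exact h⟩
  loopless := ⟨fun s h => by
    have hs := s.2
    rw [Finset.inter_self] at h
    omega⟩

instance (n k : ℕ) : DecidableRel (johnsonGraph n k).Adj :=
  fun s t => inferInstanceAs (Decidable ((s.1 ∩ t.1).card + 1 = k))

/-- Kneser graph `K(n,k)`: the `k`-subsets of an `n`-set (`k ≥ 1`), adjacent when disjoint.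
(The clause `s ≠ t` is automatic for `k ≥ 1`.) -/
def kneserGraph (n k : ℕ) : SimpleGraph {s : Finset (Fin n) // s.card = k} where
  Adj s t := s ≠ t ∧ Disjoint s.1 t.1
  symm := ⟨fun _ _ h => ⟨h.1.symm, h.2.symm⟩⟩
  loopless := ⟨fun _ h => h.1 rfl⟩

instance (n k : ℕ) : DecidableRel (kneserGraph n k).Adj :=
  fun s t => inferInstanceAs (Decidable (s ≠ t ∧ Disjoint s.1 t.1))

/-- Hamming graph `H(d,q)`: the `d`-tuples over a `q`-set, adjacent when they differ in exactly
one coordinate. -/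
def hammingGraph (d q : ℕ) : SimpleGraph (Fin d → Fin q) where
  Adj x y := hammingDist x y = 1
  symm := ⟨fun x y h => by rw [hammingDist_comm]; exact h⟩
  loopless := ⟨fun x h => by simp at h⟩

instance (d q : ℕ) : DecidableRel (hammingGraph d q).Adj :=
  fun x y => inferInstanceAs (Decidable (hammingDist x y = 1))

/-- The `k`-dimensional subspaces of `F ^ n`. -/
abbrev Subspaces (F : Type) [Field F] (n k : ℕ) : Type :=
  {W : Submodule F (Fin n → F) // Module.finrank F W = k}

instance (F : Type) [Field F] [Fintype F] (n k : ℕ) : Fintype (Subspaces F n k) :=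
  Fintype.ofFinite _

instance (F : Type) [Field F] (n k : ℕ) : DecidableEq (Subspaces F n k) :=
  Classical.decEq _

/-- Grassmann graph `G_q(n,k)` over the finite field `F` with `q` elements: the `k`-subspaces of
`F ^ n`, adjacent when they meet in dimension exactly `k - 1`. -/
def grassmannGraph (F : Type) [Field F] (n k : ℕ) : SimpleGraph (Subspaces F n k) where
  Adj A B := Module.finrank F (A.1 ⊓ B.1 : Submodule F (Fin n → F)) + 1 = k
  symm := ⟨fun A B h => by rw [inf_comm]; exact h⟩
  loopless := ⟨fun A h => by
    have hA := A.2
    rw [inf_idem] at h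
    omega⟩

instance (F : Type) [Field F] (n k : ℕ) : DecidableRel (grassmannGraph F n k).Adj :=
  Classical.decRel _

/-- Rook graph `R(m,n)`: the Cartesian product of the complete graphs `K_m` and `K_n`. -/
def rookGraph (m n : ℕ) : SimpleGraph (Fin m × Fin n) :=
  (⊤ : SimpleGraph (Fin m)).boxProd (⊤ : SimpleGraph (Fin n))

instance (m n : ℕ) : DecidableRel (rookGraph m n).Adj := Classical.decRel _

/-- Complete-square graph: the Cartesian product of `K_n` and the four-cycle. -/
def completeSquareGraph (n : ℕ) : SimpleGraph (Fin n × Fin 4) :=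
  (⊤ : SimpleGraph (Fin n)).boxProd (SimpleGraph.cycleGraph 4)

instance (n : ℕ) : DecidableRel (completeSquareGraph n).Adj := Classical.decRel _

/-- Complete bipartite graph `K(a,b)`. -/
def bipartiteGraph (a b : ℕ) : SimpleGraph (Fin a ⊕ Fin b) :=
  completeBipartiteGraph (Fin a) (Fin b)

instance (a b : ℕ) : DecidableRel (bipartiteGraph a b).Adj := Classical.decRel _

/-- The two sides of the vertex set of `K(a,b)`. -/
def bipartiteSides (a b : ℕ) : Fin 2 → Finset (Fin a ⊕ Fin b) :=
  ![Finset.univ.map Function.Embedding.inl, Finset.univ.map Function.Embedding.inr]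

/-! ## Alternating quantum walks -/

section Walk

variable {V : Type} [Fintype V] [DecidableEq V] {ι : Type}

/-- The evolution operator `e^{-iHt}` of the Hamiltonian `H` for time `t`. -/
def evolve (H : Matrix V V ℂ) (t : ℝ) : Matrix V V ℂ :=
  NormedSpace.exp ((-(Complex.I * (t : ℂ))) • H)

/-- The basis state `|v⟩`. -/
def ket (v : V) : V → ℂ := Pi.single v 1

/-- The projector `|v⟩⟨v|`. -/
def proj (v : V) : Matrix V V ℂ := Matrix.vecMulVec (ket v) (star (ket v))

/-- The uniform superposition of the vertices in `S`. -/
def uniformState (S : Finset V) : V → ℂ :=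
  fun v => if v ∈ S then (((1 / Real.sqrt (S.card : ℝ)) : ℝ) : ℂ) else 0

/-- One layer of an alternating quantum walk: a phase shift by `angle` at the vertex named by the
label `mark`, followed by the walk for time `time`. The vertices that the labels stand for are
supplied only when the walk is run, so a list of layers does not depend on them. -/
structure Layer (ι : Type) where
  mark : ι
  angle : ℝ
  time : ℝ

/-- The operator `e^{-iHt} e^{-iθ|x⟩⟨x|}` of a layer. -/
def Layer.op (H : Matrix V V ℂ) (x : ι → V) (σ : Layer ι) : Matrix V V ℂ :=
  evolve H σ.time * evolve (proj (x σ.mark)) σ.angle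

/-- The operator of a list of layers; the head of the list acts first. -/
def walkOp (H : Matrix V V ℂ) (x : ι → V) : List (Layer ι) → Matrix V V ℂ
  | [] => 1
  | σ :: l => walkOp H x l * σ.op H x

/-- All angles and times lie in `[0, 2π)`. -/
def Admissible (l : List (Layer ι)) : Prop :=
  ∀ σ ∈ l, σ.angle ∈ Set.Ico 0 (2 * Real.pi) ∧ σ.time ∈ Set.Ico 0 (2 * Real.pi)

/-- The total evolution time `∑ (t_j + θ_j)` under the two Hamiltonians. -/
def totalTime (l : List (Layer ι)) : ℝ := (l.map fun σ => σ.time + σ.angle).sum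

/-- Deterministic spatial search with Hamiltonian `H` and start sets `S 0, …, S (r - 1)`, within
budget `B`. There are `r` alternating walks, run one after another; the `i`-th starts in the uniform
superposition of `S i`, its angles and times do not depend on the marked vertex `m`, and whatever
`m` is, a walk whose start set contains `m` ends with probability one in `m`. Both the total number
of layers and the total time are at most `B`. -/
def DeterministicSearch (H : Matrix V V ℂ) {r : ℕ} (S : Fin r → Finset V) (B : ℝ) : Prop :=
  ∃ l : Fin r → List (Layer Unit),
    (∀ i, Admissible (l i)) ∧
    ((∑ i, (l i).length : ℕ) : ℝ) ≤ B ∧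
    ∑ i, totalTime (l i) ≤ B ∧
    ∀ m : V, ∃ i, m ∈ S i ∧
      ‖(walkOp H (fun _ => m) (l i)).mulVec (uniformState (S i)) m‖ ^ 2 = 1

/-- Perfect state transfer between any two vertices `u`, `v` within budget `B`: an alternating walk
built from `e^{-iHt}`, `e^{-iα|u⟩⟨u|}` and `e^{-iβ|v⟩⟨v|}` with operator `U` such that
`|⟨v|U|u⟩| = 1`. -/
def PerfectStateTransfer (H : Matrix V V ℂ) (B : ℝ) : Prop :=
  ∀ u v : V, ∃ l : List (Layer (Fin 2)),
    Admissible l ∧ (l.length : ℝ) ≤ B ∧ totalTime l ≤ B ∧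
    ‖(walkOp H ![u, v] l).mulVec (ket u) v‖ = 1

/-- Exact uniform sampling within budget `B`: from any given vertex `m`, an alternating walk built
from `e^{-iHt}` and `e^{-iθ|m⟩⟨m|}` produces, up to a global phase, exactly the uniform
superposition of all vertices. -/
def ExactUniformSampling (H : Matrix V V ℂ) (B : ℝ) : Prop :=
  ∀ m : V, ∃ l : List (Layer Unit),
    Admissible l ∧ (l.length : ℝ) ≤ B ∧ totalTime l ≤ B ∧
    ∃ γ : ℝ, uniformState Finset.univ =
      Complex.exp (-(Complex.I * (γ : ℂ))) • (walkOp H (fun _ => m) l).mulVec (ket m)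

/-- The budget `C √N`, where `N` is the number of vertices. -/
def sqrtBudget (V : Type) [Fintype V] (C : ℝ) : ℝ := C * Real.sqrt (Fintype.card V : ℝ)

/-- All three tasks are solved on `G` within budget `C √N` by alternating walks with the Laplacian
as Hamiltonian, the search being a single walk that starts in the uniform superposition of all
vertices. -/
def SolvesAll (G : SimpleGraph V) [DecidableRel G.Adj] (C : ℝ) : Prop :=
  DeterministicSearch (G.lapMatrix ℂ) ![Finset.univ] (sqrtBudget V C) ∧
  PerfectStateTransfer (G.lapMatrix ℂ) (sqrtBudget V C) ∧
  ExactUniformSampling (G.lapMatrix ℂ) (sqrtBudget V C)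

end Walk

end AlternatingWalk

end

/-! For a Laplacian, one construction settles all three tasks: a word in walks and phase shifts at m
that carries |m⟩ to |s⟩ up to phase. It is exact sampling; its inverse is search; a word from u to
|s⟩ followed by an inverse word from |s⟩ to v is state transfer. Little is used of the graph.
Connectedness makes |s⟩ span the kernel of L, so the kernel component of |m⟩ has norm 1/√N. The
eigenvalues are integers, so times can be reduced modulo 2π, and their number is bounded on each
family. Vertex-transitivity makes the search parameters independent of m.

The word comes from `exact_transfer`, by induction on the number of nonzero frequencies in a unit
vector u with kernel component x₀. If g is the gcd of the frequencies, the walk for time π/g has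
only the signs ±1 on the components of u, and -1 occurs. Hence u = αw + y, where w is the normalised
+1 part: it keeps x₀ and has fewer frequencies. By induction O(α/‖x₀‖) gates, with phase shifts
about w, carry w to x₀. If O(1/α) gates carry u to w, conjugation turns each phase shift about w
into O(1/α) gates about u, and α cancels in the total O(1/‖x₀‖).

Carrying u to w is exact amplitude amplification for α ≤ 1/2 (`amplify_small`) and a two-phase trick
for α² ≥ 3/4 (`amplify_large`). In between this can fail with the sign walk alone: for α² = 1/2 it
maps u to an orthogonal vector, and the gates only permute these two up to phases. There three phase
shifts simulate a phase shift about w without moving u (`simulate_phase`, `simulate_word`). The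
recursion then carries the w part to x₀ while y stays in the -1 sector, and `amplify_invariant`,
which uses further walk times, removes the rest.

The spectra are algebra. Hamming and rook graphs and K_n □ C_4 have Laplacians that are sums of
commuting simple operators (`IntSpec.add`). Johnson and Grassmann graphs come from inclusion
matrices of modular lattices, through a ladder of commutation relations (`inc_commutation`,
`inc_spectrum`). Kneser matrices are rational polynomials in a Johnson-type matrix, so their
eigenvalues are rational and integral (`IntegerSpectrum.of_mem_adjoin`). Search on K(N₁,N₂) uses A,
whose nonzero eigenvalues become ±1 after rescaling; the amplification lemmas apply directly
(`IsTwoSided.search`). -/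

namespace AlternatingWalk

open Complex

/-! ### Words of gates and their length. -/

/-- `Gen D S n U`: the element `U` is a product of at most `n` gates of the forms `D t` and `S θ`. -/
inductive Gen {M : Type*} [Monoid M] (D S : ℝ → M) : ℕ → M → Prop
  | one : Gen D S 0 1
  | weaken {n : ℕ} {U : M} : Gen D S n U → Gen D S (n + 1) U
  | walk {n : ℕ} {U : M} (t : ℝ) : Gen D S n U → Gen D S (n + 1) (D t * U)
  | phase {n : ℕ} {U : M} (θ : ℝ) : Gen D S n U → Gen D S (n + 1) (S θ * U)

namespace Gen

variable {M : Type*} [Monoid M] {D S S' : ℝ → M} {m n k : ℕ} {U W : M}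

theorem mono (h : Gen D S n U) (hnm : n ≤ m) : Gen D S m U := by
  induction hnm with
  | refl => exact h
  | step _ ih => exact ih.weaken

theorem mul (h : Gen D S m U) (h' : Gen D S n W) : Gen D S (m + n) (U * W) := by
  induction h with
  | one => simpa using h'
  | weaken _ ih => exact (ih.weaken).mono (by omega)
  | walk t _ ih => rw [mul_assoc]; exact (ih.walk t).mono (by omega)
  | phase t _ ih => rw [mul_assoc]; exact (ih.phase t).mono (by omega)

theorem of_walk (t : ℝ) : Gen D S 1 (D t) := by
  simpa using (one (D := D) (S := S)).walk t

theorem of_phase (t : ℝ) : Gen D S 1 (S t) := by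
  simpa using (one (D := D) (S := S)).phase t

theorem pow (h : Gen D S m U) (j : ℕ) : Gen D S (m * j) (U ^ j) := by
  induction j with
  | zero => simpa using one
  | succ j ih => rw [pow_succ]; exact ih.mul h

/-- Walk gates are left alone but are also charged `k`, hence `1 ≤ k`. -/
theorem subst (hk : 1 ≤ k) (hS : ∀ θ, Gen D S k (S' θ)) (h : Gen D S' n U) :
    Gen D S (k * n) U := by
  induction h with
  | one => simpa using one
  | weaken _ ih => exact ih.mono (by nlinarith)
  | walk t _ ih => exact (ih.walk t).mono (by nlinarith)
  | phase t _ ih => exact ((hS t).mul ih).mono (by nlinarith)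

end Gen

/-! ### Phase shifts and unitary walks on an inner product space. -/

section Phase

variable {E : Type*} [NormedAddCommGroup E] [InnerProductSpace ℂ E]

/-- The phase factor `e^{-iθ}`. -/
noncomputable def cis (θ : ℝ) : ℂ := Complex.exp (-(I * (θ : ℂ)))

theorem cis_eq (θ : ℝ) : cis θ = Complex.exp (((-θ : ℝ) : ℂ) * I) := by
  unfold cis; congr 1; push_cast; ring

theorem norm_cis (θ : ℝ) : ‖cis θ‖ = 1 := by
  rw [cis_eq, Complex.norm_exp_ofReal_mul_I]

theorem cis_zero : cis 0 = 1 := by simp [cis]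

theorem cis_pi : cis Real.pi = -1 := by
  rw [cis_eq]; push_cast; rw [neg_mul, Complex.exp_neg, Complex.exp_pi_mul_I]; norm_num

theorem cis_add (a b : ℝ) : cis (a + b) = cis a * cis b := by
  unfold cis; rw [← Complex.exp_add]; congr 1; push_cast; ring

theorem cis_mul_cis_neg (a : ℝ) : cis a * cis (-a) = 1 := by
  rw [← cis_add]; simp [cis_zero]

theorem conj_cis (a : ℝ) : (starRingEnd ℂ) (cis a) = cis (-a) := by
  unfold cis; rw [← Complex.exp_conj]; congr 1; simp

theorem continuous_cis : Continuous cis := by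
  unfold cis; fun_prop

theorem exists_cis {ξ : ℂ} (h : ‖ξ‖ = 1) : ∃ θ : ℝ, cis θ = ξ := by
  refine ⟨-ξ.arg, ?_⟩
  rw [cis_eq, neg_neg]
  have := Complex.norm_mul_exp_arg_mul_I ξ
  rwa [h, Complex.ofReal_one, one_mul] at this

/-- The phase shift `e^{-iθ|u⟩⟨u|}` about a unit vector `u`. -/
noncomputable def phaseGate (u : E) (θ : ℝ) : Module.End ℂ E :=
  1 + (cis θ - 1) • (innerₛₗ ℂ u).smulRight u

theorem phaseGate_apply (u : E) (θ : ℝ) (x : E) :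
    phaseGate u θ x = x + ((cis θ - 1) * inner ℂ u x) • u := by
  simp [phaseGate, mul_smul]

/-- A phase shift depends only on the line of its vector, so preparing a state up to a global phase
is enough. -/
theorem phaseGate_smul {ω : ℂ} (h : ‖ω‖ = 1) (u : E) (θ : ℝ) :
    phaseGate (ω • u) θ = phaseGate u θ := by
  ext x
  rw [phaseGate_apply, phaseGate_apply, inner_smul_left, smul_smul]
  congr 2
  have : (starRingEnd ℂ) ω * ω = 1 := by
    rw [mul_comm, Complex.mul_conj, Complex.normSq_eq_norm_sq, h]; simp
  linear_combination (cis θ - 1) * inner ℂ u x * this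

theorem inner_phaseGate (u : E) (θ : ℝ) (x y : E) :
    inner ℂ (phaseGate u θ x) y = inner ℂ x (phaseGate u (-θ) y) := by
  rw [phaseGate_apply, phaseGate_apply, inner_add_left, inner_add_right, inner_smul_left,
    inner_smul_right, map_mul, map_sub, conj_cis, map_one, inner_conj_symm]
  ring

theorem phaseGate_mul_neg {u : E} (hu : ‖u‖ = 1) (θ : ℝ) :
    phaseGate u θ * phaseGate u (-θ) = 1 := by
  ext x
  have h1 : inner ℂ u u = (1 : ℂ) := by rw [inner_self_eq_norm_sq_to_K, hu]; simp
  rw [Module.End.mul_apply, phaseGate_apply, phaseGate_apply, inner_add_right, inner_smul_right,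
    h1, add_assoc, ← add_smul, Module.End.one_apply]
  have := cis_mul_cis_neg θ
  rw [show (cis (-θ) - 1) * inner ℂ u x +
    (cis θ - 1) * (inner ℂ u x + (cis (-θ) - 1) * inner ℂ u x * 1) = 0 by
      linear_combination (inner ℂ u x) * this]
  simp

/-- A commuting family of unitary operators `D t`, where `D (-t)` is the inverse of `D t`. -/
structure WalkFamily (D : ℝ → Module.End ℂ E) : Prop where
  adjoint : ∀ t x y, inner ℂ (D t x) y = inner ℂ x (D (-t) y)
  mul_neg : ∀ t, D t * D (-t) = 1
  comm : ∀ s t x, D s (D t x) = D t (D s x)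
  cont : ∀ x, Continuous fun t => inner ℂ x (D t x)
  zero : D 0 = 1

theorem WalkFamily.inner_map {D : ℝ → Module.End ℂ E} (hD : WalkFamily D) (t : ℝ) (x y : E) :
    inner ℂ (D t x) (D t y) = inner ℂ x y := by
  have := hD.mul_neg (-t)
  rw [neg_neg] at this
  rw [hD.adjoint, ← Module.End.mul_apply, this, Module.End.one_apply]

variable {D : ℝ → Module.End ℂ E} {u : E} {n : ℕ} {U : Module.End ℂ E}

/-- The reversed word with negated parameters is both inverse and adjoint. It serves to conjugate
phase shifts and to turn sampling into search. -/
theorem Gen.exists_inv (hD : WalkFamily D) (hu : ‖u‖ = 1) (h : Gen D (phaseGate u) n U) :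
    ∃ U', Gen D (phaseGate u) n U' ∧ U * U' = 1 ∧ U' * U = 1 ∧
      ∀ x y, inner ℂ (U x) y = inner ℂ x (U' y) := by
  induction h with
  | one => exact ⟨1, .one, by simp, by simp, by simp⟩
  | weaken _ ih =>
    obtain ⟨U', h1, h2⟩ := ih
    exact ⟨U', h1.weaken, h2⟩
  | @walk n U t _ ih =>
    obtain ⟨U', h1, h2, h3, h4⟩ := ih
    have e := hD.mul_neg (-t)
    rw [neg_neg] at e
    refine ⟨U' * D (-t), h1.mul (.of_walk _), ?_, ?_, fun x y => ?_⟩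
    · rw [mul_assoc, ← mul_assoc U, h2, one_mul, hD.mul_neg]
    · rw [mul_assoc, ← mul_assoc (D (-t)), e, one_mul, h3]
    · simp only [Module.End.mul_apply]; rw [hD.adjoint, h4]
  | @phase n U t _ ih =>
    obtain ⟨U', h1, h2, h3, h4⟩ := ih
    have e := phaseGate_mul_neg hu (-t)
    rw [neg_neg] at e
    refine ⟨U' * phaseGate u (-t), h1.mul (.of_phase _), ?_, ?_, fun x y => ?_⟩
    · rw [mul_assoc, ← mul_assoc U, h2, one_mul, phaseGate_mul_neg hu]
    · rw [mul_assoc, ← mul_assoc (phaseGate u (-t)), e, one_mul, h3]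
    · simp only [Module.End.mul_apply]; rw [inner_phaseGate, h4]

theorem Gen.norm_map (hD : WalkFamily D) (hu : ‖u‖ = 1) (h : Gen D (phaseGate u) n U) (x : E) :
    ‖U x‖ = ‖x‖ := by
  obtain ⟨U', _, _, h3, h4⟩ := h.exists_inv hD hu
  have : inner ℂ (U x) (U x) = inner ℂ x x := by
    rw [h4, ← Module.End.mul_apply, h3, Module.End.one_apply]
  rw [inner_self_eq_norm_sq_to_K, inner_self_eq_norm_sq_to_K] at this
  have h5 : ‖U x‖ ^ 2 = ‖x‖ ^ 2 := by exact_mod_cast this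
  exact (sq_eq_sq₀ (norm_nonneg _) (norm_nonneg _)).1 h5

/-- Phase shifts about a vector that can be prepared from `u` are available at bounded cost. -/
theorem Gen.phaseGate_map (hD : WalkFamily D) (hu : ‖u‖ = 1) (h : Gen D (phaseGate u) n U)
    (θ : ℝ) : Gen D (phaseGate u) (2 * n + 1) (phaseGate (U u) θ) := by
  obtain ⟨U', h1, h2, h3, h4⟩ := h.exists_inv hD hu
  have : phaseGate (U u) θ = U * phaseGate u θ * U' := by
    ext x
    have hx : U (U' x) = x := by rw [← Module.End.mul_apply, h2]; rfl
    simp only [Module.End.mul_apply, phaseGate_apply, h4, map_add, map_smul, hx]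
  rw [this]
  exact ((h.mul (.of_phase θ)).mul h1).mono (by omega)

theorem Gen.phaseGate_of_smul (hD : WalkFamily D) (hu : ‖u‖ = 1) (h : Gen D (phaseGate u) n U)
    {w : E} {ω : ℂ} (hw : ‖w‖ = 1) (hU : U u = ω • w)
    (θ : ℝ) : Gen D (phaseGate u) (2 * n + 1) (phaseGate w θ) := by
  have h1 := h.phaseGate_map hD hu θ
  have h2 := h.norm_map hD hu u
  rw [hU, norm_smul, hw, hu, mul_one] at h2
  rwa [hU, phaseGate_smul h2] at h1

end Phase

end AlternatingWalk

namespace AlternatingWalk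

open Complex

/-! ### Exact amplitude amplification from small overlap. -/

section Amplification

variable {E : Type*} [NormedAddCommGroup E] [InnerProductSpace ℂ E]
  {u w y : E} {a ρ : ℂ} {R : Module.End ℂ E}

theorem inner_comb (hw : ‖w‖ = 1) (hwy : inner ℂ w y = 0) (a b p q : ℂ) :
    inner ℂ (a • w + b • y) (p • w + q • y) =
      (starRingEnd ℂ) a * p + (starRingEnd ℂ) b * q * (‖y‖ ^ 2 : ℝ) := by
  have hyw : inner ℂ y w = (0 : ℂ) := by rw [← inner_conj_symm, hwy, map_zero]
  have h1 : inner ℂ w w = (1 : ℂ) := by rw [inner_self_eq_norm_sq_to_K, hw]; simp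
  have h2 : inner ℂ y y = ((‖y‖ ^ 2 : ℝ) : ℂ) := by rw [inner_self_eq_norm_sq_to_K]; simp
  simp only [inner_add_left, inner_add_right, inner_smul_left, inner_smul_right, hwy, hyw, h1, h2]
  ring

theorem norm_sq_comb (hw : ‖w‖ = 1) (hwy : inner ℂ w y = 0) (a b : ℂ) :
    ‖a • w + b • y‖ ^ 2 = ‖a‖ ^ 2 + ‖b‖ ^ 2 * ‖y‖ ^ 2 := by
  have := inner_comb hw hwy a b a b
  rw [inner_self_eq_norm_sq_to_K, Complex.conj_mul', Complex.conj_mul'] at this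
  apply Complex.ofReal_injective
  push_cast
  simpa using this

theorem phaseGate_comb (hw : ‖w‖ = 1) (hwy : inner ℂ w y = 0) (a b p q : ℂ) (θ : ℝ) :
    phaseGate (a • w + b • y) θ (p • w + q • y) =
      (p + (cis θ - 1) * ((starRingEnd ℂ) a * p + (starRingEnd ℂ) b * q * (‖y‖ ^ 2 : ℝ)) * a) • w +
      (q + (cis θ - 1) * ((starRingEnd ℂ) a * p + (starRingEnd ℂ) b * q * (‖y‖ ^ 2 : ℝ)) * b) • y
      := by
  rw [phaseGate_apply, inner_comb hw hwy]
  simp only [add_smul, smul_add, smul_smul]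
  abel

/-- Up to the phase ρ, `R` reflects the plane of w and y, and the phase shift by π reflects along u;
their product is a rotation by 2δ, starting from angle δ. The quotients by sin δ and cos δ appear
because a is complex and y is not normalised. Allowing any ρ covers the bipartite case, where w
rather than y is negated. -/
theorem grover_iterate (hu : u = a • w + y) (hw : ‖w‖ = 1) (hwy : inner ℂ w y = 0)
    (hR : R w = ρ • w) (hR' : R y = -(ρ • y)) {δ : ℝ} (ha : ‖a‖ = Real.sin δ)
    (hy : ‖y‖ ^ 2 = Real.cos δ ^ 2) (hs : Real.sin δ ≠ 0) (hc : Real.cos δ ≠ 0) (i : ℕ) :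
    ((phaseGate u Real.pi * R) ^ i) u = ρ ^ i •
      (((Real.sin ((2 * i + 1) * δ) / Real.sin δ : ℝ) * a) • w +
        ((Real.cos ((2 * i + 1) * δ) / Real.cos δ : ℝ) : ℂ) • y) := by
  induction i with
  | zero => simp [div_self hs, div_self hc, hu]
  | succ i ih =>
    have haa : (starRingEnd ℂ) a * a = ((Real.sin δ ^ 2 : ℝ) : ℂ) := by
      rw [Complex.conj_mul', ha]; norm_cast
    have e1 : Real.sin ((2 * ((i + 1 : ℕ) : ℝ) + 1) * δ) = Real.sin ((2 * i + 1) * δ)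
        + 2 * Real.sin δ * (Real.cos ((2 * i + 1) * δ) * Real.cos δ -
          Real.sin ((2 * i + 1) * δ) * Real.sin δ) := by
      rw [show (2 * ((i + 1 : ℕ) : ℝ) + 1) * δ = (2 * i + 1) * δ + 2 * δ by push_cast; ring,
        Real.sin_add, Real.sin_two_mul, Real.cos_two_mul']
      linear_combination Real.sin ((2 * i + 1) * δ) * Real.sin_sq_add_cos_sq δ
    have e2 : Real.cos ((2 * ((i + 1 : ℕ) : ℝ) + 1) * δ) = - Real.cos ((2 * i + 1) * δ)
        + 2 * Real.cos δ * (Real.cos ((2 * i + 1) * δ) * Real.cos δ -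
          Real.sin ((2 * i + 1) * δ) * Real.sin δ) := by
      rw [show (2 * ((i + 1 : ℕ) : ℝ) + 1) * δ = (2 * i + 1) * δ + 2 * δ by push_cast; ring,
        Real.cos_add, Real.sin_two_mul, Real.cos_two_mul']
      linear_combination (-Real.cos ((2 * i + 1) * δ)) * Real.sin_sq_add_cos_sq δ
    rw [pow_succ', Module.End.mul_apply, ih, Module.End.mul_apply]
    simp only [map_smul, map_add, hR, hR']
    rw [pow_succ ρ i, mul_smul (ρ ^ i) ρ]
    congr 1
    set s := Real.sin ((2 * i + 1) * δ)
    set c := Real.cos ((2 * i + 1) * δ)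
    have key := phaseGate_comb hw hwy a 1 ((s / Real.sin δ : ℝ) * a * ρ)
      (-((c / Real.cos δ : ℝ) * ρ)) Real.pi
    rw [one_smul, ← hu] at key
    have hin : (((s / Real.sin δ : ℝ) : ℂ) * a) • ρ • w + ((c / Real.cos δ : ℝ) : ℂ) • -(ρ • y)
      = ((s / Real.sin δ : ℝ) * a * ρ) • w + (-((c / Real.cos δ : ℝ) * ρ)) • y := by
      simp only [smul_smul, smul_neg, neg_smul]
    simp only [← map_smul (phaseGate u Real.pi), ← map_add (phaseGate u Real.pi)]
    rw [hin, key, smul_add, smul_smul, smul_smul, e1, e2, hy,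
      cis_pi]
    have hs' : (Real.sin δ : ℂ) ≠ 0 := by exact_mod_cast hs
    have hc' : (Real.cos δ : ℂ) ≠ 0 := by exact_mod_cast hc
    push_cast at hs' hc'
    have hin2 : (starRingEnd ℂ) a * (((s / Real.sin δ : ℝ) : ℂ) * a * ρ) + (starRingEnd ℂ) 1 *
        (-(((c / Real.cos δ : ℝ) : ℂ) * ρ)) * ((Real.cos δ ^ 2 : ℝ) : ℂ) =
        ρ * ((s * Real.sin δ - c * Real.cos δ : ℝ) : ℂ) := by
      rw [show (starRingEnd ℂ) a * (((s / Real.sin δ : ℝ) : ℂ) * a * ρ) =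
        ((s / Real.sin δ : ℝ) : ℂ) * ρ * ((starRingEnd ℂ) a * a) by ring, haa, map_one]
      push_cast
      field_simp
      ring
    rw [hin2]
    congr 2
    · push_cast; field_simp; ring
    · push_cast; field_simp; ring

/-- Amplitude amplification is exact when the initial angle is an odd fraction of a right angle. -/
theorem grover_exact (hu : u = a • w + y) (hw : ‖w‖ = 1) (hwy : inner ℂ w y = 0) (hu1 : ‖u‖ = 1)
    (hR : R w = ρ • w) (hR' : R y = -(ρ • y)) {j : ℕ} (hj : 1 ≤ j)
    (ha : ‖a‖ = Real.sin (Real.pi / (2 * (2 * j + 1)))) :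
    ∃ ω : ℂ, ((phaseGate u Real.pi * R) ^ j) u = ω • w := by
  set δ := Real.pi / (2 * (2 * (j : ℝ) + 1)) with hδ
  have hj' : (1 : ℝ) ≤ j := by exact_mod_cast hj
  have hpos : 0 < δ := by positivity
  have hlt : δ < Real.pi / 2 := by
    rw [hδ, div_lt_div_iff₀ (by positivity) (by positivity)]
    nlinarith [Real.pi_pos]
  have hs : 0 < Real.sin δ := Real.sin_pos_of_pos_of_lt_pi hpos (by linarith [Real.pi_pos])
  have hc : 0 < Real.cos δ := Real.cos_pos_of_mem_Ioo ⟨by linarith, hlt⟩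
  have hy : ‖y‖ ^ 2 = Real.cos δ ^ 2 := by
    have := norm_sq_comb hw hwy a 1
    rw [one_smul, ← hu, hu1, ha] at this
    simp at this
    nlinarith [Real.sin_sq_add_cos_sq δ]
  have := grover_iterate hu hw hwy hR hR' ha hy hs.ne' hc.ne' j
  have e : (2 * (j : ℝ) + 1) * δ = Real.pi / 2 := by rw [hδ]; field_simp
  rw [e, Real.cos_pi_div_two, zero_div, Complex.ofReal_zero, zero_smul, add_zero, smul_smul] at this
  exact ⟨_, this⟩

/-- The odd fractions of a right angle are dense enough for tripling. -/
theorem exists_odd_fraction {δ : ℝ} (h0 : 0 < δ) (h1 : δ ≤ Real.pi / 6) :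
    ∃ j : ℕ, 1 ≤ j ∧ δ ≤ Real.pi / (2 * (2 * j + 1)) ∧ Real.pi / (2 * (2 * j + 1)) ≤ 3 * δ := by
  have hpi := Real.pi_pos
  -- With j = ⌊x⌋, 2j + 1 is the largest odd integer not above π/(2δ), and π/(2δ) < 2j + 3 ≤ 3(2j +
  -- 1).
  set x := (Real.pi / (2 * δ) - 1) / 2 with hx
  have hx1 : 1 ≤ x := by
    rw [hx, le_div_iff₀ (by norm_num), le_sub_iff_add_le, le_div_iff₀ (by positivity)]
    linarith
  refine ⟨⌊x⌋₊, Nat.le_floor (by simpa using hx1), ?_, ?_⟩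
  · have := Nat.floor_le (by linarith : 0 ≤ x)
    rw [le_div_iff₀ (by positivity)]
    have h2 : 2 * (⌊x⌋₊ : ℝ) + 1 ≤ Real.pi / (2 * δ) := by rw [hx] at this ⊢; linarith
    rw [le_div_iff₀ (by positivity)] at h2
    linarith
  · have h3 := Nat.lt_floor_add_one x
    have h4 : (1 : ℝ) ≤ ⌊x⌋₊ := by exact_mod_cast Nat.le_floor (by simpa using hx1)
    have h2 : Real.pi / (2 * δ) < 2 * (⌊x⌋₊ : ℝ) + 3 := by rw [hx] at h3 ⊢; linarith
    rw [div_lt_iff₀ (by positivity)] at h2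
    rw [div_le_iff₀ (by positivity)]
    nlinarith

/-- A phase shift changes the modulus `‖1 + z c‖` continuously. -/
theorem exists_phase_modulus (c : ℂ) {ξ : ℂ} (hξ : ‖ξ‖ = 1) {r : ℝ}
    (h : r ∈ Set.uIcc 1 ‖1 + (ξ - 1) * c‖) : ∃ θ : ℝ, ‖1 + (cis θ - 1) * c‖ = r := by
  obtain ⟨θ₀, rfl⟩ := exists_cis hξ
  have hcont : Continuous fun θ : ℝ => ‖1 + (cis θ - 1) * c‖ := by
    have := continuous_cis
    fun_prop
  have := intermediate_value_uIcc (a := 0) (b := θ₀) hcont.continuousOn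
  simp only [cis_zero, sub_self, zero_mul, add_zero, norm_one] at this
  obtain ⟨θ, _, hθ⟩ := this h
  exact ⟨θ, hθ⟩

variable {D : ℝ → Module.End ℂ E} {t₀ : ℝ}

/-- Exact amplitude amplification from amplitude at most `1/2`. -/
theorem amplify_small (hD : WalkFamily D) (hu : u = a • w + y) (hw : ‖w‖ = 1)
    (hwy : inner ℂ w y = 0) (hu1 : ‖u‖ = 1) (hρ : ‖ρ‖ = 1)
    (hR : D t₀ w = ρ • w) (hR' : D t₀ y = -(ρ • y)) (ha0 : 0 < ‖a‖) (ha : ‖a‖ ≤ 1 / 2) :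
    ∃ n U, Gen D (phaseGate u) n U ∧ (n : ℝ) ≤ 5 / ‖a‖ ∧ ∃ ω : ℂ, U u = ω • w := by
  have hpi := Real.pi_pos
  set δ := Real.arcsin ‖a‖ with hδ
  have hsin : Real.sin δ = ‖a‖ := Real.sin_arcsin (by linarith) (by linarith)
  have hδ0 : 0 < δ := Real.arcsin_pos.2 ha0
  have hδ1 : δ ≤ Real.pi / 6 := by
    rw [hδ, Real.arcsin_le_iff_le_sin' ⟨by linarith, by linarith⟩, Real.sin_pi_div_six]
    exact ha
  obtain ⟨j, hj1, hj2, hj3⟩ := exists_odd_fraction hδ0 hδ1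
  set η := Real.pi / (2 * (2 * (j : ℝ) + 1)) with hη
  have hη0 : 0 < η := by positivity
  have hη1 : η ≤ Real.pi / 2 := by
    rw [hη]; gcongr; nlinarith [(Nat.cast_nonneg j : (0 : ℝ) ≤ j)]
  have hlow : ‖a‖ ≤ Real.sin η := by
    rw [← hsin]; exact Real.sin_le_sin_of_le_of_le_pi_div_two (by linarith) hη1 hj2
  have hup : Real.sin η ≤ 3 * ‖a‖ - 4 * ‖a‖ ^ 3 := by
    rw [← hsin, ← Real.sin_three_mul]
    exact Real.sin_le_sin_of_le_of_le_pi_div_two (by linarith) (by linarith) hj3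
  have hnorm := norm_sq_comb hw hwy a 1
  rw [one_smul, ← hu, hu1, norm_one] at hnorm
  set c : ℝ := 2 * ‖a‖ ^ 2 - 1 with hc
  -- One step with a variable phase θ multiplies the amplitude by this modulus. It runs from 1 at θ
  -- = 0 to 3 - 4‖a‖² = sin 3δ / sin δ at θ = π, so it can be tuned to make the new amplitude
  -- exactly sin η. The j ordinary steps from there end exactly in w.
  obtain ⟨θ, hθ⟩ := exists_phase_modulus (c : ℂ) (ξ := -1) (by simp) (r := Real.sin η / ‖a‖) (by
    have : (1 : ℂ) + (-1 - 1) * c = ((3 - 4 * ‖a‖ ^ 2 : ℝ) : ℂ) := by rw [hc]; push_cast; ring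
    rw [this, Complex.norm_real, Real.norm_eq_abs, abs_of_nonneg (by nlinarith)]
    rw [Set.uIcc_of_le (by nlinarith)]
    constructor
    · rw [le_div_iff₀ ha0]; linarith
    · rw [div_le_iff₀ ha0]; nlinarith)
  have hV : Gen D (phaseGate u) 2 (phaseGate u θ * D t₀) := Gen.mul (.of_phase _) (.of_walk _)
  have hv1 := hV.norm_map hD hu1 u
  rw [hu1] at hv1
  set v := (phaseGate u θ * D t₀) u with hv
  have hv2 : v = (ρ * (1 + (cis θ - 1) * c) * a) • w + (ρ * (-1 + (cis θ - 1) * c)) • y := by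
    rw [hv, Module.End.mul_apply]
    have : D t₀ u = (a * ρ) • w + (-ρ) • y := by
      rw [hu]; simp [hR, hR', smul_smul]
    rw [this]
    have key := phaseGate_comb hw hwy a 1 (a * ρ) (-ρ) θ
    rw [one_smul, ← hu] at key
    rw [key]
    have hin : (starRingEnd ℂ) a * (a * ρ) + (starRingEnd ℂ) 1 * -ρ * ((‖y‖ ^ 2 : ℝ) : ℂ)
        = ρ * c := by
      rw [← mul_assoc, Complex.conj_mul', map_one, hc]
      have : ‖y‖ ^ 2 = 1 - ‖a‖ ^ 2 := by linarith
      rw [this]; push_cast; ring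
    rw [hin]
    congr 2 <;> ring
  have hex := grover_exact (u := v) (R := D t₀) (ρ := ρ) hv2 hw
    (by rw [inner_smul_right, hwy, mul_zero]) hv1 hR (by rw [map_smul, hR', smul_neg, smul_comm])
    hj1 (by
      rw [norm_mul, norm_mul, hρ, hθ, one_mul, div_mul_cancel₀ _ ha0.ne'])
  obtain ⟨ω, hω⟩ := hex
  have hstep : Gen D (phaseGate u) 6 (phaseGate v Real.pi * D t₀) :=
    Gen.mul (hV.phaseGate_map hD hu1 Real.pi) (.of_walk _)
  -- Preparing v takes 2 gates, so a phase shift about v takes 5 and an iteration 6. Since 2j + 1 ≤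
  -- π/(2‖a‖), the total is below 3π/(2‖a‖) < 5/‖a‖.
  refine ⟨6 * j + 2, _, (hstep.pow j).mul hV, ?_, ω, ?_⟩
  · have h1 : 2 * (j : ℝ) + 1 ≤ Real.pi / (2 * ‖a‖) := by
      rw [hη, le_div_iff₀ (by positivity)] at hj2
      rw [le_div_iff₀ (by positivity)]
      have := Real.sin_le hδ0.le
      rw [hsin] at this
      nlinarith [(Nat.cast_nonneg j : (0 : ℝ) ≤ j)]
    rw [le_div_iff₀ (by positivity)] at h1
    rw [le_div_iff₀ ha0]
    push_cast
    nlinarith [Real.pi_lt_d2, mul_nonneg ha0.le (Nat.cast_nonneg j : (0 : ℝ) ≤ j)]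
  · rw [Module.End.mul_apply, ← hv, hω]

end Amplification
end AlternatingWalk

namespace AlternatingWalk

open Complex

/-! ### Exact transfer from large overlap. -/

section Large

theorem norm_eq_one_of_normSq {x : ℂ} (h : Complex.normSq x = 1) : ‖x‖ = 1 := by
  rw [Complex.normSq_eq_norm_sq] at h
  exact (pow_eq_one_iff_of_nonneg (norm_nonneg _) two_ne_zero).1 h

/-- The equation says that the y-coordinate of u vanishes after a phase shift by γ about the walked
vector and one by β about u. Solving it for `cis β` and demanding modulus 1 forces |cis γ - 1|² =
1/(2c²(1+c)) = τ. A phase γ with this property exists because τ ≤ 4. -/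
theorem exists_two_phases {c : ℝ} (h0 : 1 / 2 ≤ c) :
    ∃ β γ : ℝ, 1 - (cis γ - 1) * c + (cis β - 1) * (1 + (cis γ - 1) * c ^ 2) = 0 := by
  set τ := 1 / (2 * c ^ 2 * (1 + c)) with hτ
  have hpos : 0 < 2 * c ^ 2 * (1 + c) := by positivity
  have hτ0 : 0 < τ := by positivity
  have hτe : τ * (2 * c ^ 2 * (1 + c)) = 1 := by rw [hτ]; field_simp
  have hτ1 : τ ≤ 4 := by
    rw [hτ, div_le_iff₀ hpos]; nlinarith [mul_self_nonneg (c - 1 / 2)]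
  set γ := Real.arccos (1 - τ / 2)
  have hcos : Real.cos γ = 1 - τ / 2 := Real.cos_arccos (by linarith) (by linarith)
  have hre : (cis γ - 1).re = -(τ / 2) := by
    rw [cis_eq, Complex.sub_re, Complex.exp_ofReal_mul_I_re, Real.cos_neg, hcos]
    simp
  have him : (cis γ - 1).im = - Real.sin γ := by
    rw [cis_eq, Complex.sub_im, Complex.exp_ofReal_mul_I_im, Real.sin_neg]
    simp
  have hsq : Real.sin γ ^ 2 = τ - τ ^ 2 / 4 := by
    rw [Real.sin_sq, hcos]; ring
  set z := cis γ - 1 with hz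
  have n1 : Complex.normSq (z * c * (1 + c)) = τ * c ^ 2 * (1 + c) ^ 2 := by
    have : z * c * (1 + c) = z * ((c * (1 + c) : ℝ) : ℂ) := by push_cast; ring
    rw [this, Complex.normSq_mul, Complex.normSq_ofReal, Complex.normSq_apply, hre, him]
    linear_combination (c * (1 + c)) ^ 2 * hsq
  have n2 : Complex.normSq (1 + z * c ^ 2) = τ * c ^ 2 * (1 + c) ^ 2 := by
    have e : z * (c : ℂ) ^ 2 = ((c ^ 2 : ℝ) : ℂ) * z := by push_cast; ring
    rw [e, Complex.normSq_apply, Complex.add_re, Complex.add_im, Complex.re_ofReal_mul,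
      Complex.im_ofReal_mul, hre, him, Complex.one_re, Complex.one_im]
    linear_combination c ^ 4 * hsq - hτe
  have hne : (1 + z * (c : ℂ) ^ 2) ≠ 0 := by
    intro h
    rw [h, map_zero] at n2
    have : 0 < τ * c ^ 2 * (1 + c) ^ 2 := by positivity
    linarith
  obtain ⟨β, hβ⟩ := exists_cis (ξ := z * c * (1 + c) / (1 + z * c ^ 2)) (by
    have : Complex.normSq (z * c * (1 + c) / (1 + z * c ^ 2)) = 1 := by
      rw [Complex.normSq_div, n1, n2, div_self]
      have : 0 < τ * c ^ 2 * (1 + c) ^ 2 := by positivity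
      exact this.ne'
    exact norm_eq_one_of_normSq this)
  refine ⟨β, γ, ?_⟩
  rw [hβ, ← hz]
  field_simp
  ring

variable {E : Type*} [NormedAddCommGroup E] [InnerProductSpace ℂ E]
  {u w y : E} {a : ℂ} {D : ℝ → Module.End ℂ E} {t₀ : ℝ}

/-- Exact transfer from overlap at least `3/4`. -/
theorem amplify_large (hD : WalkFamily D) (hu : u = a • w + y) (hw : ‖w‖ = 1)
    (hwy : inner ℂ w y = 0) (hu1 : ‖u‖ = 1) (hR : D t₀ w = w) (hR' : D t₀ y = -y)
    (ha : 3 / 4 ≤ ‖a‖ ^ 2) :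
    ∃ U, Gen D (phaseGate u) 4 U ∧ ∃ ω : ℂ, U u = ω • w := by
  have hnorm := norm_sq_comb hw hwy a 1
  rw [one_smul, ← hu, hu1, norm_one] at hnorm
  set c : ℝ := 2 * ‖a‖ ^ 2 - 1 with hc
  obtain ⟨β, γ, h⟩ := exists_two_phases (c := c) (by rw [hc]; linarith)
  have hu' : D t₀ u = a • w + (-1 : ℂ) • y := by rw [hu]; simp [hR, hR']
  have hA : (starRingEnd ℂ) a * a = ((‖a‖ ^ 2 : ℝ) : ℂ) := by
    rw [Complex.conj_mul']; norm_cast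
  have hB : ‖y‖ ^ 2 = 1 - ‖a‖ ^ 2 := by linarith
  have g1 : phaseGate (D t₀ u) γ u = (a * (1 + (cis γ - 1) * c)) • w +
      (1 - (cis γ - 1) * c) • y := by
    have key := phaseGate_comb hw hwy a (-1) a 1 γ
    rw [one_smul, ← hu, ← hu', hA, hB] at key
    rw [key]
    congr 2 <;> simp [hc] <;> ring
  refine ⟨phaseGate u β * phaseGate (D t₀ u) γ,
    Gen.mul (.of_phase β) (Gen.phaseGate_map hD hu1 (.of_walk t₀) γ), ?_⟩
  rw [Module.End.mul_apply, g1]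
  have key := phaseGate_comb hw hwy a 1 (a * (1 + (cis γ - 1) * c)) (1 - (cis γ - 1) * c) β
  rw [one_smul, ← hu, ← mul_assoc ((starRingEnd ℂ) a), hA, hB] at key
  rw [key]
  have e0 : (1 - (cis γ - 1) * c) + (cis β - 1) * (((‖a‖ ^ 2 : ℝ) : ℂ) * (1 + (cis γ - 1) * c) +
    (starRingEnd ℂ) 1 * (1 - (cis γ - 1) * c) * ((1 - ‖a‖ ^ 2 : ℝ) : ℂ)) * 1 = 0 := by
    rw [← h, hc, map_one]; push_cast; ring
  rw [e0, zero_smul, add_zero]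
  exact ⟨_, rfl⟩

end Large

/-! ### Middle overlap: simulated phase shifts and the invariant component. -/

section Middle

/-- The first equation makes the product of phase shifts β, γ, β (about u, its walked image, u)
diagonal in the basis w, y; the second sets its eigenvalue on w to `cis χ`. Eliminating γ leaves a
quadratic for ξ = `cis β`. The substitution ξ = e^{-iχ/2} Y makes it Y² - 2iκ sin(χ/2) Y - 1 = 0
with κ = c/(1+c), which has a root of modulus 1 because |κ| ≤ 1. -/
theorem exists_three_phases {c : ℝ} (h0 : |c| < 1 / 2) (χ : ℝ) :
    ∃ β γ : ℝ, (cis γ - 1) * (1 - (cis β - 1) ^ 2 * c ^ 2) = (cis β - 1) ^ 2 + 2 * (cis β - 1) ∧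
      1 + (1 + c) / 2 * (2 * (cis β - 1) + (cis β - 1) ^ 2 +
        (cis γ - 1) * (1 + (cis β - 1) * c) ^ 2) = cis χ := by
  obtain ⟨hc1, hc2⟩ := abs_lt.1 h0
  set κ : ℝ := c / (1 + c) with hκ
  set s : ℝ := Real.sin (χ / 2) with hs
  have hcp : 0 < 1 + c := by linarith
  have hκ1 : κ ^ 2 ≤ 1 := by
    rw [hκ, div_pow, div_le_one (by positivity)]; nlinarith
  have hs1 : s ^ 2 ≤ 1 := Real.sin_sq_le_one _
  have hr : 0 ≤ 1 - κ ^ 2 * s ^ 2 := by nlinarith [sq_nonneg κ, sq_nonneg s]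
  set r : ℝ := Real.sqrt (1 - κ ^ 2 * s ^ 2) with hrdef
  have hr2 : r ^ 2 = 1 - κ ^ 2 * s ^ 2 := Real.sq_sqrt hr
  set Y : ℂ := r + κ * s * I with hY
  have hYn : ‖Y‖ = 1 := by
    have : Complex.normSq Y = 1 := by
      rw [hY, Complex.normSq_apply]
      simp
      linear_combination hr2
    exact norm_eq_one_of_normSq this
  have hY2 : Y ^ 2 - 2 * I * κ * s * Y - 1 = 0 := by
    have hr2' : (r : ℂ) ^ 2 = 1 - κ ^ 2 * s ^ 2 := by exact_mod_cast hr2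
    rw [hY]
    linear_combination hr2' - (κ : ℂ) ^ 2 * s ^ 2 * Complex.I_sq
  set h : ℂ := cis (χ / 2) with hh
  have hω : cis χ = h ^ 2 := by rw [hh, sq, ← cis_add]; congr 1; ring
  have hh2 : 1 - h ^ 2 = 2 * I * s * h := by
    have h1 : h * cis (-(χ / 2)) = 1 := cis_mul_cis_neg _
    have h2 : cis (-(χ / 2)) - h = 2 * I * s := by
      rw [hh, cis_eq, cis_eq, neg_neg, Complex.exp_mul_I, Complex.exp_mul_I, ← Complex.ofReal_cos,
        ← Complex.ofReal_cos, ← Complex.ofReal_sin, ← Complex.ofReal_sin, Real.cos_neg,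
        Real.sin_neg, hs]
      push_cast
      ring
    linear_combination h * h2 - h1
  obtain ⟨β, hβ⟩ := exists_cis (ξ := h * Y) (by rw [norm_mul, hYn, hh, norm_cis, one_mul])
  set ξ := cis β with hξ
  have hquad : (1 + c) * ξ ^ 2 - c * (1 - h ^ 2) * ξ - (1 + c) * h ^ 2 = 0 := by
    have hck : (c : ℂ) = (1 + c) * κ := by
      rw [hκ]; push_cast
      have : (1 + (c : ℂ)) ≠ 0 := by exact_mod_cast hcp.ne'
      field_simp
    rw [hβ, hh2]
    linear_combination (1 + c) * h ^ 2 * hY2 - 2 * I * s * h ^ 2 * Y * hck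
  set z := ξ - 1 with hz
  have hzn : ‖z * c‖ < 1 := by
    rw [norm_mul, Complex.norm_real, Real.norm_eq_abs]
    have : ‖z‖ ≤ 2 := by
      calc ‖z‖ ≤ ‖ξ‖ + ‖(1 : ℂ)‖ := norm_sub_le _ _
        _ = 2 := by rw [hξ, norm_cis]; norm_num
    nlinarith [abs_nonneg c, norm_nonneg z]
  have hm : 1 - z * c ≠ 0 := by
    intro h; have : z * c = 1 := by linear_combination -h
    rw [this] at hzn; simp at hzn
  have hp : 1 + z * c ≠ 0 := by
    intro h; have : z * c = -1 := by linear_combination h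
    rw [this] at hzn; simp at hzn
  have hDne : 1 - z ^ 2 * c ^ 2 ≠ 0 := by
    have : 1 - z ^ 2 * c ^ 2 = (1 - z * c) * (1 + z * c) := by ring
    rw [this]; exact mul_ne_zero hm hp
  -- The first equation determines `cis γ`. Its modulus is 1 because conj z = -z/ξ makes the
  -- numerator ξ² times the conjugate of the denominator; |zc| < 1 keeps the denominator nonzero.
  obtain ⟨γ, hγ⟩ := exists_cis (ξ := (ξ ^ 2 - z ^ 2 * c ^ 2) / (1 - z ^ 2 * c ^ 2)) (by
    have h1 : ξ * (starRingEnd ℂ) ξ = 1 := by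
      rw [hξ, conj_cis, cis_mul_cis_neg]
    have : ξ ^ 2 - z ^ 2 * c ^ 2 = ξ ^ 2 * (starRingEnd ℂ) (1 - z ^ 2 * c ^ 2) := by
      rw [hz]
      simp only [map_sub, map_mul, map_pow, map_one, Complex.conj_ofReal]
      linear_combination (c ^ 2 * (ξ * (starRingEnd ℂ) ξ - 2 * ξ + 1)) * h1
    rw [this, norm_div, norm_mul, norm_pow, hξ, norm_cis, Complex.norm_conj, one_pow, one_mul,
      div_self (norm_ne_zero_iff.2 hDne)])
  have hz' : (cis γ - 1) * (1 - z ^ 2 * c ^ 2) = z ^ 2 + 2 * z := by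
    rw [hγ]; field_simp; rw [hz]; ring
  refine ⟨β, γ, hz', ?_⟩
  have hz2 : (cis γ - 1) * (1 + z * c) * (1 - z * c) = z ^ 2 + 2 * z := by
    rw [← hz']; ring
  apply mul_right_cancel₀ hm
  rw [hω]
  linear_combination (1 + c) / 2 * (1 + z * c) * hz2 + hquad + (1 + (c : ℂ)) * (z + 1 + ξ) * hz - h ^ 2 * c * hz

variable {E : Type*} [NormedAddCommGroup E] [InnerProductSpace ℂ E]
  {u w y : E} {a : ℂ} {D : ℝ → Module.End ℂ E} {t₀ : ℝ}

/-- For an overlap strictly between `1/4` and `3/4`, phase shifts about `u` and the walk simulate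
phase shifts about the component `w`, without moving `u` to `w`. -/
theorem simulate_phase (hD : WalkFamily D) (hu : u = a • w + y) (hw : ‖w‖ = 1)
    (hwy : inner ℂ w y = 0) (hu1 : ‖u‖ = 1) (hR : D t₀ w = w) (hR' : D t₀ y = -y)
    (ha : 1 / 4 < ‖a‖ ^ 2) (ha' : ‖a‖ ^ 2 < 3 / 4) (χ : ℝ) :
    ∃ W, Gen D (phaseGate u) 5 W ∧ (∀ f, inner ℂ y f = 0 → W f = phaseGate w χ f) ∧
      ∀ f, inner ℂ w f = 0 → ∃ κ : ℂ, W f = f + κ • y := by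
  have hnorm := norm_sq_comb hw hwy a 1
  rw [one_smul, ← hu, hu1, norm_one] at hnorm
  set c : ℝ := 2 * ‖a‖ ^ 2 - 1 with hc
  obtain ⟨β, γ, h1, h2⟩ := exists_three_phases (c := c)
    (by rw [abs_lt, hc]; constructor <;> linarith) χ
  have hu' : D t₀ u = a • w + (-1 : ℂ) • y := by rw [hu]; simp [hR, hR']
  have hA : (starRingEnd ℂ) a * a = ((‖a‖ ^ 2 : ℝ) : ℂ) := by
    rw [Complex.conj_mul']; norm_cast
  have hB : ‖y‖ ^ 2 = 1 - ‖a‖ ^ 2 := by linarith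
  have hy0 : ((‖y‖ ^ 2 : ℝ) : ℂ) ≠ 0 := by
    have : ‖y‖ ^ 2 ≠ 0 := by rw [hB]; linarith
    exact_mod_cast this
  -- Because the outer angles are equal, the single condition `h1` kills both off-diagonal entries.
  set W := phaseGate u β * (phaseGate (D t₀ u) γ * phaseGate u β) with hW
  have hWpq : ∀ p q : ℂ, W (p • w + q • y) = (p * cis χ) • w +
      (q * (1 + (cis β - 1) * (‖y‖ ^ 2 : ℝ) - (cis γ - 1) * (‖y‖ ^ 2 : ℝ) * ((cis β - 1) * c - 1) +
        (cis β - 1) * (‖y‖ ^ 2 : ℝ) * (cis β + (cis γ - 1) * c * ((cis β - 1) * c - 1)))) • y := by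
    intro p q
    have k1 := fun p q => phaseGate_comb hw hwy a 1 p q β
    have k2 := fun p q => phaseGate_comb hw hwy a (-1) p q γ
    rw [one_smul, ← hu] at k1
    rw [← hu'] at k2
    rw [hW, Module.End.mul_apply, Module.End.mul_apply, k1, k2, k1, ← h2]
    set z := cis β - 1 with hz
    set z' := cis γ - 1
    have hz1 : cis β = z + 1 := by rw [hz]; ring
    rw [hz1]
    have hcA : (c : ℂ) = 2 * ((starRingEnd ℂ) a * a) - 1 := by rw [hA, hc]; push_cast; ring
    have hBA : ((‖y‖ ^ 2 : ℝ) : ℂ) = 1 - (starRingEnd ℂ) a * a := by rw [hA, hB]; push_cast; ring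
    rw [hcA] at h1 ⊢
    rw [hBA]
    simp only [map_one, map_neg]
    set b := (starRingEnd ℂ) a
    congr 2
    · linear_combination (-(q * a * (1 - b * a))) * h1
    · linear_combination (-(p * b)) * h1
  have hW0 : ∀ f, inner ℂ w f = 0 → inner ℂ y f = 0 → W f = f := by
    intro f hf1 hf2
    have i1 : inner ℂ u f = (0 : ℂ) := by
      rw [hu, inner_add_left, inner_smul_left, hf1, hf2]; simp
    have i2 : inner ℂ (D t₀ u) f = (0 : ℂ) := by
      rw [hu', inner_add_left, inner_smul_left, inner_smul_left, hf1, hf2]; simp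
    have g1 : phaseGate u β f = f := by rw [phaseGate_apply, i1]; simp
    have g2 : phaseGate (D t₀ u) γ f = f := by rw [phaseGate_apply, i2]; simp
    rw [hW, Module.End.mul_apply, Module.End.mul_apply, g1, g2, g1]
  have hyw : inner ℂ y w = (0 : ℂ) := by rw [← inner_conj_symm, hwy, map_zero]
  have hww : inner ℂ w w = (1 : ℂ) := by rw [inner_self_eq_norm_sq_to_K, hw]; simp
  have hyy : inner ℂ y y = ((‖y‖ ^ 2 : ℝ) : ℂ) := by rw [inner_self_eq_norm_sq_to_K]; simp
  refine ⟨W, Gen.mul (m := 1) (.of_phase β) (Gen.mul (m := 3)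
    (Gen.phaseGate_map hD hu1 (.of_walk t₀) γ) (.of_phase β)), fun f hf => ?_, fun f hf => ?_⟩
  · have e := hWpq (inner ℂ w f) 0
    have e' := hW0 (f - (inner ℂ w f : ℂ) • w)
      (by rw [inner_sub_right, inner_smul_right, hww, mul_one, sub_self])
      (by rw [inner_sub_right, inner_smul_right, hyw, hf, mul_zero, sub_self])
    rw [zero_smul, add_zero, zero_mul, zero_smul, add_zero] at e
    rw [map_sub, e] at e'
    rw [phaseGate_apply, sub_mul, sub_smul, one_mul, mul_comm (cis χ)]
    rw [sub_eq_iff_eq_add] at e'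
    rw [e']; abel
  · set g : ℂ := inner ℂ y f / (‖y‖ ^ 2 : ℝ) with hg
    have e := hWpq 0 g
    have e' := hW0 (f - g • y)
      (by rw [inner_sub_right, inner_smul_right, hwy, hf, mul_zero, sub_self])
      (by rw [inner_sub_right, inner_smul_right, hyy, hg, div_mul_cancel₀ _ hy0, sub_self])
    rw [zero_smul, zero_add, zero_mul, zero_smul, zero_add] at e
    rw [map_sub, e, sub_eq_iff_eq_add] at e'
    rw [sub_add, ← sub_smul, sub_eq_add_neg, ← neg_smul] at e'
    exact ⟨_, e'⟩

/-- Exact transfer to a walk-invariant component of middle weight. -/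
theorem amplify_invariant (hD : WalkFamily D) (hu : u = a • w + y) (hw : ‖w‖ = 1)
    (hwy : inner ℂ w y = 0) (hu1 : ‖u‖ = 1) (hR : ∀ t, D t w = w) (hR' : D t₀ y = -y)
    (ha : 1 / 4 < ‖a‖ ^ 2) (ha' : ‖a‖ ^ 2 < 3 / 4) :
    ∃ U, Gen D (phaseGate u) 8 U ∧ ∃ ω : ℂ, U u = ω • w := by
  have hnorm := norm_sq_comb hw hwy a 1
  rw [one_smul, ← hu, hu1, norm_one] at hnorm
  have han : 1 / 2 ≤ ‖a‖ := by nlinarith [norm_nonneg a]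
  have hf : Continuous fun t => (inner ℂ u (D t u)).re := Complex.continuous_re.comp (hD.cont u)
  have hf0 : (inner ℂ u (D 0 u)).re = 1 := by
    rw [hD.zero, Module.End.one_apply, inner_self_eq_norm_sq_to_K, hu1]; simp
  have hf1 : (inner ℂ u (D t₀ u)).re = 2 * ‖a‖ ^ 2 - 1 := by
    have h1 : D t₀ u = a • w + (-1 : ℂ) • y := by rw [hu]; simp [hR, hR']
    have h2 := inner_comb hw hwy a 1 a (-1)
    rw [one_smul, ← hu, ← h1, Complex.conj_mul'] at h2
    rw [h2]
    have : ((‖a‖ : ℂ) ^ 2 + (starRingEnd ℂ) 1 * -1 * ((‖y‖ ^ 2 : ℝ) : ℂ)) =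
      ((‖a‖ ^ 2 - ‖y‖ ^ 2 : ℝ) : ℂ) := by push_cast; simp; ring
    rw [this, Complex.ofReal_re]; linarith
  -- Re c = 1/2 means |1 - c| = |c|. Then some phase shift about u cancels the w-amplitude of the
  -- walked vector completely, and by continuity another one lowers it to exactly 1/2 = sin(π/6),
  -- from where a single Grover step suffices.
  obtain ⟨t, _, ht⟩ := intermediate_value_uIcc (a := t₀) (b := 0) hf.continuousOn
    (show (1 / 2 : ℝ) ∈ _ by
      rw [hf0, hf1, Set.uIcc_of_le (by linarith)]
      constructor <;> linarith)
  set c := inner ℂ u (D t u) with hc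
  have hc0 : c ≠ 0 := by
    intro h; have ht' : c.re = 1 / 2 := ht; rw [h] at ht'; norm_num at ht'
  have hcn : ‖1 - c‖ = ‖c‖ := by
    rw [← sq_eq_sq₀ (norm_nonneg _) (norm_nonneg _), ← Complex.normSq_eq_norm_sq,
      ← Complex.normSq_eq_norm_sq, Complex.normSq_apply, Complex.normSq_apply]
    simp only [Complex.sub_re, Complex.sub_im, Complex.one_re, Complex.one_im]
    have : c.re = 1 / 2 := ht
    rw [this]; ring
  obtain ⟨θ, hθ⟩ := exists_phase_modulus c (ξ := -(1 - c) / c)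
    (by rw [norm_div, norm_neg, hcn, div_self (norm_ne_zero_iff.2 hc0)]) (r := 1 / 2 / ‖a‖) (by
      have : 1 + (-(1 - c) / c - 1) * c = 0 := by field_simp; ring
      rw [this, norm_zero, Set.uIcc_of_ge zero_le_one]
      refine ⟨by positivity, ?_⟩
      rw [div_le_one (by linarith)]; exact han)
  have hV : Gen D (phaseGate u) 2 (phaseGate u θ * D t) := Gen.mul (.of_phase _) (.of_walk _)
  have hv1 := hV.norm_map hD hu1 u
  rw [hu1] at hv1
  set v := (phaseGate u θ * D t) u with hv
  have hv2 : v = (a * (1 + (cis θ - 1) * c)) • w + (D t y + ((cis θ - 1) * c) • y) := by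
    rw [hv, Module.End.mul_apply, phaseGate_apply, ← hc]
    have h1 : D t u = a • w + D t y := by rw [hu]; simp [hR]
    rw [h1, hu]
    simp only [smul_add, smul_smul, mul_add, add_smul, mul_one]
    rw [mul_comm a]
    abel
  have hperp : inner ℂ w (D t y + ((cis θ - 1) * c) • y) = 0 := by
    have := hD.inner_map t w y
    rw [hR, hwy] at this
    rw [inner_add_right, inner_smul_right, hwy, this]; simp
  obtain ⟨ω, hω⟩ := grover_exact (u := v) (R := D t₀) (ρ := 1) hv2 hw hperp hv1
    (by rw [hR, one_smul])
    (by rw [map_add, map_smul, hD.comm t₀ t, hR', map_neg, one_smul, smul_neg, neg_add]) (j := 1)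
    le_rfl (by
      rw [norm_mul, hθ, mul_div_cancel₀ _ (by linarith),
        show Real.pi / (2 * (2 * ((1 : ℕ) : ℝ) + 1)) = Real.pi / 6 by norm_num,
        Real.sin_pi_div_six])
  rw [pow_one] at hω
  refine ⟨phaseGate v Real.pi * D t₀ * (phaseGate u θ * D t),
    ((hV.phaseGate_map hD hu1 Real.pi).mul (.of_walk t₀)).mul hV, ω, ?_⟩
  rw [Module.End.mul_apply, ← hv, hω]

end Middle
end AlternatingWalk

namespace AlternatingWalk

open Complex

/-! ### Recursion over the frequencies. -/

section Core

/-- A time at which a finite set of nonzero integer frequencies only shows the phases `±1`, with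
`-1` among them. -/
theorem exists_sign_time {Λ : Finset ℤ} (h0 : 0 ∉ Λ) (hne : Λ.Nonempty) :
    ∃ t : ℝ, (∀ l ∈ Λ, cis (l * t) = 1 ∨ cis (l * t) = -1) ∧ ∃ l ∈ Λ, cis (l * t) = -1 := by
  -- At time π/g the frequency gq has phase (-1)^q. Were every q even, 2g would divide the gcd.
  set g : ℤ := Λ.gcd id with hg
  have hg0 : g ≠ 0 := by
    obtain ⟨l, hl⟩ := hne
    intro h
    rw [hg, Finset.gcd_eq_zero_iff] at h
    exact h0 (by have := h l hl; simp at this; rwa [this] at hl)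
  have hgr : (g : ℝ) ≠ 0 := by exact_mod_cast hg0
  have hdvd : ∀ l ∈ Λ, g ∣ l := fun l hl => Finset.gcd_dvd hl
  have hphase : ∀ q : ℤ, cis (((g * q : ℤ) : ℝ) * (Real.pi / g)) = (-1) ^ q := by
    intro q
    have : ((g * q : ℤ) : ℝ) * (Real.pi / g) = q * Real.pi := by push_cast; field_simp
    rw [this, cis_eq]
    have e : (((-(q * Real.pi) : ℝ) : ℂ) * I) = (-q : ℤ) * (Real.pi * I) := by push_cast; ring
    rw [e, Complex.exp_int_mul, Complex.exp_pi_mul_I, zpow_neg, ← inv_zpow]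
    norm_num
  refine ⟨Real.pi / g, fun l hl => ?_, ?_⟩
  · obtain ⟨q, rfl⟩ := hdvd l hl
    rw [hphase]
    rcases Int.even_or_odd q with h | h
    · exact Or.inl h.neg_one_zpow
    · exact Or.inr h.neg_one_zpow
  · by_contra! hcon
    have h2 : g * 2 ∣ g := by
      conv_rhs => rw [hg]
      refine Finset.dvd_gcd fun l hl => ?_
      have hl' := hcon l hl
      obtain ⟨q, rfl⟩ := hdvd l hl
      rw [hphase] at hl'
      have : Even q := by
        by_contra ho
        exact hl' (Int.not_even_iff_odd.1 ho).neg_one_zpow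
      simp only [id]
      exact mul_dvd_mul_left g this.two_dvd
    have h3 : (2 : ℤ) ∣ 1 := by
      rw [← mul_dvd_mul_iff_left hg0, mul_one]; exact h2
    norm_num at h3

variable {E : Type*} [NormedAddCommGroup E] [InnerProductSpace ℂ E]
  {u w y : E} {a : ℂ} {D : ℝ → Module.End ℂ E} {t₀ : ℝ}

theorem inner_eq_zero_of_sign (hD : WalkFamily D) {f g : E} (hf : D t₀ f = f)
    (hg : D t₀ g = -g) : inner ℂ f g = 0 := by
  have := hD.inner_map t₀ f g
  rw [hf, hg, inner_neg_right] at this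
  linear_combination (-1 / 2 : ℂ) * this

theorem inner_eq_zero_of_freq (hD : WalkFamily D) {f g : E} {l : ℤ} (hl : l ≠ 0)
    (hf : ∀ t, D t f = f) (hg : ∀ t, D t g = cis (l * t) • g) : inner ℂ f g = 0 := by
  refine inner_eq_zero_of_sign (t₀ := Real.pi / l) hD (hf _) ?_
  have : (l : ℝ) ≠ 0 := by exact_mod_cast hl
  rw [hg, mul_div_cancel₀ _ this, cis_pi, neg_one_smul]

/-- A word in phase shifts about `w` is simulated on the positive sector by phase shifts about
`u`. -/
theorem simulate_word (hD : WalkFamily D) (hu : u = a • w + y) (hw : ‖w‖ = 1)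
    (hwy : inner ℂ w y = 0) (hu1 : ‖u‖ = 1) (hR : D t₀ w = w) (hR' : D t₀ y = -y)
    (ha : 1 / 4 < ‖a‖ ^ 2) (ha' : ‖a‖ ^ 2 < 3 / 4) {n : ℕ} {U : Module.End ℂ E}
    (hU : Gen D (phaseGate w) n U) :
    ∃ U', Gen D (phaseGate u) (5 * n) U' ∧ (∀ f, D t₀ f = f → U' f = U f ∧ D t₀ (U f) = U f) ∧
      ∀ f, D t₀ f = -f → D t₀ (U' f) = -U' f := by
  induction hU with
  | one => exact ⟨1, .one, fun f hf => ⟨rfl, hf⟩, fun f hf => hf⟩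
  | weaken _ ih =>
    obtain ⟨U', h1, h2⟩ := ih
    exact ⟨U', h1.mono (by omega), h2⟩
  | @walk n U t _ ih =>
    obtain ⟨U', h1, h2, h3⟩ := ih
    refine ⟨D t * U', (h1.walk t).mono (by omega), fun f hf => ?_, fun f hf => ?_⟩
    · simp only [Module.End.mul_apply]
      rw [(h2 f hf).1, hD.comm, (h2 f hf).2]
      exact ⟨rfl, rfl⟩
    · simp only [Module.End.mul_apply]
      rw [hD.comm, h3 f hf, map_neg]
  | @phase n U θ _ ih =>
    obtain ⟨U', h1, h2, h3⟩ := ih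
    obtain ⟨W, w1, w2, w3⟩ := simulate_phase hD hu hw hwy hu1 hR hR' ha ha' θ
    refine ⟨W * U', (w1.mul h1).mono (by omega), fun f hf => ?_, fun f hf => ?_⟩
    · simp only [Module.End.mul_apply]
      have hyf : inner ℂ y (U f) = (0 : ℂ) := by
        rw [← inner_conj_symm, inner_eq_zero_of_sign hD (h2 f hf).2 hR', map_zero]
      rw [(h2 f hf).1, w2 _ hyf]
      refine ⟨rfl, ?_⟩
      rw [phaseGate_apply, map_add, map_smul, hR, (h2 f hf).2]
    · simp only [Module.End.mul_apply]
      -- A vector of the -1 sector is orthogonal to w, so it is changed only by a multiple of y and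
      -- remains in that sector.
      obtain ⟨κ, hκ⟩ := w3 (U' f) (inner_eq_zero_of_sign hD hR (h3 f hf))
      rw [hκ, map_add, map_smul, hR', h3 f hf, smul_neg, neg_add]

/-- The constant in the cost of the exact transfer with `d` nonzero frequencies. -/
noncomputable def coreConst : ℕ → ℝ
  | 0 => 0
  | d + 1 => 100 * coreConst d + 8

theorem coreConst_nonneg (d : ℕ) : 0 ≤ coreConst d := by
  induction d with
  | zero => exact le_rfl
  | succ d ih => simp only [coreConst]; linarith

theorem coreConst_mono : Monotone coreConst :=
  monotone_nat_of_le_succ fun d => by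
    have := coreConst_nonneg d
    simp only [coreConst]; linarith

/-- **Exact transfer to the invariant component.** If `u` has an invariant component `x₀` and
components at `d` nonzero integer frequencies, then phase shifts about `u` and the walk move `u`
exactly to the direction of `x₀` with `O(1 / ‖x₀‖)` gates. -/
theorem exact_transfer (hD : WalkFamily D) (d : ℕ) :
    ∀ (Λ : Finset ℤ) (x : ℤ → E) (x₀ u : E), 0 ∉ Λ → Λ.card ≤ d → (∀ t, D t x₀ = x₀) →
      (∀ l ∈ Λ, ∀ t, D t (x l) = cis (l * t) • x l) → u = x₀ + ∑ l ∈ Λ, x l → ‖u‖ = 1 →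
      x₀ ≠ 0 →
      ∃ n U, Gen D (phaseGate u) n U ∧ (n : ℝ) ≤ coreConst d / ‖x₀‖ ∧ ∃ ω : ℂ, U u = ω • x₀ := by
  induction d with
  | zero =>
    intro Λ x x₀ u h0 hcard hx₀ hx hu hu1 hne
    have : Λ = ∅ := Finset.card_eq_zero.1 (Nat.le_zero.1 hcard)
    subst this
    exact ⟨0, 1, .one, by simp [coreConst], 1, by simp [hu]⟩
  | succ d ih =>
    intro Λ x x₀ u h0 hcard hx₀ hx hu hu1 hne
    rcases Λ.eq_empty_or_nonempty with rfl | hΛ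
    · refine ⟨0, 1, .one, ?_, 1, by simp [hu]⟩
      have := coreConst_nonneg (d + 1)
      rw [Nat.cast_zero]
      exact div_nonneg this (norm_nonneg _)
    obtain ⟨t₀, ht, l₁, hl₁, hl₁'⟩ := exists_sign_time h0 hΛ
    set Λ' := Λ.filter fun l : ℤ => cis (l * t₀) = 1 with hΛ'
    have hcard' : Λ'.card ≤ d := by
      have : Λ' ⊂ Λ := by
        rw [hΛ', Finset.filter_ssubset]
        refine ⟨l₁, hl₁, ?_⟩
        rw [hl₁']; norm_num
      have := Finset.card_lt_card this
      omega
    set e := x₀ + ∑ l ∈ Λ', x l with he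
    set y := ∑ l ∈ Λ.filter (fun l : ℤ => ¬ cis (l * t₀) = 1), x l with hy
    have huey : u = e + y := by
      rw [hu, he, hy, add_assoc, Finset.sum_filter_add_sum_filter_not]
    have hRe : D t₀ e = e := by
      rw [he, map_add, hx₀, map_sum]
      congr 1
      refine Finset.sum_congr rfl fun l hl => ?_
      rw [hΛ', Finset.mem_filter] at hl
      rw [hx l hl.1, hl.2, one_smul]
    have hRy : D t₀ y = -y := by
      rw [hy, map_sum, ← Finset.sum_neg_distrib]
      refine Finset.sum_congr rfl fun l hl => ?_
      rw [Finset.mem_filter] at hl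
      rw [hx l hl.1, (ht l hl.1).resolve_left hl.2, neg_one_smul]
    have hx₀e : ‖x₀‖ ≤ ‖e‖ := by
      have hperp : inner ℂ x₀ (∑ l ∈ Λ', x l) = (0 : ℂ) := by
        rw [inner_sum]
        refine Finset.sum_eq_zero fun l hl => ?_
        have hl' := (Finset.mem_filter.1 hl).1
        exact inner_eq_zero_of_freq hD (fun h => h0 (h ▸ hl')) hx₀ (hx l hl')
      have := norm_add_sq (𝕜 := ℂ) x₀ (∑ l ∈ Λ', x l)
      rw [hperp, ← he] at this
      simp at this
      exact (sq_le_sq₀ (norm_nonneg _) (norm_nonneg _)).1 (by nlinarith [sq_nonneg ‖∑ l ∈ Λ', x l‖])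
    have hpos : 0 < ‖x₀‖ := norm_pos_iff.2 hne
    set α := ‖e‖ with hα
    have hα0 : 0 < α := lt_of_lt_of_le hpos hx₀e
    have hαc : (α : ℂ) ≠ 0 := by exact_mod_cast hα0.ne'
    set w := (α : ℂ)⁻¹ • e with hw
    have hew : e = (α : ℂ) • w := by rw [hw, smul_smul, mul_inv_cancel₀ hαc, one_smul]
    have hw1 : ‖w‖ = 1 := by
      rw [hw, norm_smul, norm_inv, Complex.norm_real, norm_norm, ← hα, inv_mul_cancel₀ hα0.ne']
    have hRw : D t₀ w = w := by rw [hw, map_smul, hRe]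
    have hwy : inner ℂ w y = (0 : ℂ) := inner_eq_zero_of_sign hD hRw hRy
    have huwy : u = (α : ℂ) • w + y := by rw [huey, ← hew]
    have hαn : ‖(α : ℂ)‖ = α := by rw [Complex.norm_real, hα, norm_norm]
    have hα1 : α ≤ 1 := by
      have := norm_sq_comb hw1 hwy (α : ℂ) 1
      rw [one_smul, ← huwy, hu1, hαn, norm_one] at this
      nlinarith [sq_nonneg ‖y‖]
    -- The unit vector w has kernel component of norm ‖x₀‖/α; this gains the factor α that pays for
    -- replacing phase shifts about w.
    obtain ⟨n₂, U₂, hU₂, hn₂, ω₂, hω₂⟩ := ih Λ' (fun l => (α : ℂ)⁻¹ • x l) ((α : ℂ)⁻¹ • x₀) w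
      (fun h => h0 (Finset.mem_filter.1 h).1) hcard' (fun t => by rw [map_smul, hx₀])
      (fun l hl t => by rw [map_smul, hx l (Finset.mem_filter.1 hl).1, smul_comm])
      (by rw [hw, he, smul_add, Finset.smul_sum]) hw1 (smul_ne_zero (inv_ne_zero hαc) hne)
    rw [norm_smul, norm_inv, hαn] at hn₂
    have hC := coreConst_nonneg d
    set C := coreConst d
    have hn₂' : (n₂ : ℝ) * ‖x₀‖ ≤ C * α := by
      rw [le_div_iff₀ (by positivity)] at hn₂
      calc (n₂ : ℝ) * ‖x₀‖ = n₂ * (α⁻¹ * ‖x₀‖) * α := by field_simp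
        _ ≤ C * α := by gcongr
    -- The two cases below cost at most (11C + 5)/‖x₀‖ and (85C + 8)/‖x₀‖.
    have hsucc : coreConst (d + 1) = 100 * C + 8 := rfl
    rw [hsucc]
    have hcases : (∃ n₁ U₁, Gen D (phaseGate u) n₁ U₁ ∧ (n₁ : ℝ) ≤ 5 / α ∧
        ∃ ω : ℂ, U₁ u = ω • w) ∨ (1 / 4 < α ^ 2 ∧ α ^ 2 < 3 / 4) := by
      by_cases h1 : α ≤ 1 / 2
      · left
        have := amplify_small (ρ := 1) hD huwy hw1 hwy hu1 (by simp) (by rw [hRw, one_smul])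
          (by rw [hRy, one_smul]) (by rw [hαn]; exact hα0) (by rw [hαn]; exact h1)
        rwa [hαn] at this
      by_cases h2 : 3 / 4 ≤ α ^ 2
      · left
        obtain ⟨U, hU, hU'⟩ := amplify_large hD huwy hw1 hwy hu1 hRw hRy (by rw [hαn]; exact h2)
        refine ⟨4, U, hU, ?_, hU'⟩
        rw [le_div_iff₀ hα0]; push_cast; linarith
      · right
        constructor <;> nlinarith
    rcases hcases with ⟨n₁, U₁, hU₁, hn₁, ω₁, hω₁⟩ | ⟨h1, h2⟩
    · refine ⟨(2 * n₁ + 1) * n₂ + n₁, U₂ * U₁, (Gen.subst (by omega)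
        (hU₁.phaseGate_of_smul hD hu1 hw1 hω₁) hU₂).mul hU₁, ?_, ω₁ * ω₂ * (α : ℂ)⁻¹, ?_⟩
      · rw [le_div_iff₀ hα0] at hn₁
        rw [le_div_iff₀ hpos]
        push_cast
        have hn0 : (0 : ℝ) ≤ n₁ := Nat.cast_nonneg _
        have i1 : (2 * (n₁ : ℝ) + 1) * (n₂ * ‖x₀‖) ≤ (2 * n₁ + 1) * (C * α) := by gcongr
        have i2 : C * (n₁ * α) ≤ C * 5 := by gcongr
        have i3 : (n₁ : ℝ) * ‖x₀‖ ≤ n₁ * α := by gcongr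
        have i4 : C * α ≤ C * 1 := by gcongr
        nlinarith
      · rw [Module.End.mul_apply, hω₁, map_smul, hω₂, smul_smul, smul_smul, mul_assoc]
    · obtain ⟨U', hU', hU'1, hU'2⟩ := simulate_word hD huwy hw1 hwy hu1 hRw hRy
        (by rw [hαn]; exact h1) (by rw [hαn]; exact h2) hU₂
      have hr : (‖x₀‖ : ℂ) ≠ 0 := by exact_mod_cast hpos.ne'
      set s := (‖x₀‖ : ℂ)⁻¹ • x₀ with hs
      have hs1 : ‖s‖ = 1 := by
        rw [hs, norm_smul, norm_inv, Complex.norm_real, norm_norm, inv_mul_cancel₀ hpos.ne']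
      have hsx : x₀ = (‖x₀‖ : ℂ) • s := by rw [hs, smul_smul, mul_inv_cancel₀ hr, one_smul]
      set p : ℂ := ω₂ * (α : ℂ)⁻¹ * ‖x₀‖ with hp
      have hUw : U₂ w = p • s := by
        rw [hω₂, hp, mul_smul, ← hsx, mul_smul]
      have hp1 : ‖p‖ = 1 := by
        have := hU₂.norm_map hD hw1 w
        rwa [hUw, norm_smul, hs1, hw1, mul_one] at this
      have hv1 := hU'.norm_map hD hu1 u
      rw [hu1] at hv1
      -- On the w part the simulation agrees with `U₂`. Nothing is known about the image of y except
      -- that it lies in the -1 sector, which is all that `amplify_invariant` needs; the weight α²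
      -- of the invariant part is unchanged.
      have hv : U' u = ((α : ℂ) * p) • s + U' y := by
        conv_lhs => rw [huwy]
        rw [map_add, map_smul, (hU'1 w hRw).1, hUw, smul_smul]
      have hsR : ∀ t, D t s = s := fun t => by rw [hs, map_smul, hx₀]
      have hyR := hU'2 y hRy
      obtain ⟨U₃, hU₃, ω₃, hω₃⟩ := amplify_invariant hD hv hs1
        (inner_eq_zero_of_sign hD (hsR t₀) hyR) hv1 hsR hyR
        (by rw [norm_mul, hp1, mul_one, hαn]; exact h1)
        (by rw [norm_mul, hp1, mul_one, hαn]; exact h2)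
      refine ⟨(2 * (5 * n₂) + 1) * 8 + 5 * n₂, U₃ * U', (Gen.subst (by omega)
        (hU'.phaseGate_map hD hu1) hU₃).mul hU', ?_, ω₃ * (‖x₀‖ : ℂ)⁻¹, ?_⟩
      · rw [le_div_iff₀ hpos]
        push_cast
        have i4 : C * α ≤ C * 1 := by gcongr
        nlinarith
      · rw [Module.End.mul_apply, hω₃, hs, smul_smul]

end Core
end AlternatingWalk

namespace AlternatingWalk

open Complex Matrix

/-! ### Matrix exponentials as a unitary family. -/

section Exponential

variable {V : Type} [Fintype V] [DecidableEq V]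

theorem exp_mulVec_of_eigen {A : Matrix V V ℂ} {f : V → ℂ} {μ : ℂ} (h : A *ᵥ f = μ • f) :
    NormedSpace.exp A *ᵥ f = Complex.exp μ • f := by
  have hpow : ∀ n : ℕ, (A ^ n) *ᵥ f = μ ^ n • f := by
    intro n
    induction n with
    | zero => simp
    | succ n ih =>
      rw [pow_succ, ← Matrix.mulVec_mulVec, h, Matrix.mulVec_smul, ih, smul_smul, pow_succ']
  have h1 : HasSum (fun n => ((n.factorial : ℂ)⁻¹) • A ^ n) (NormedSpace.exp A) := by
    open scoped Matrix.Norms.Operator in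
    exact NormedSpace.exp_series_hasSum_exp' A
  have hc : Continuous fun B : Matrix V V ℂ => B *ᵥ f := by fun_prop
  have h2 := h1.map (⟨⟨fun B => B *ᵥ f, by simp⟩, fun B C => Matrix.add_mulVec B C f⟩ :
    Matrix V V ℂ →+ (V → ℂ)) hc
  have h3 : HasSum (fun n => ((n.factorial : ℂ)⁻¹) • μ ^ n) (NormedSpace.exp μ) :=
    NormedSpace.exp_series_hasSum_exp' μ
  have h4 := h3.smul_const f
  rw [← Complex.exp_eq_exp_ℂ] at h4
  refine h2.unique ?_
  convert h4 using 2 with n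
  simp [Matrix.smul_mulVec, hpow, smul_smul]

theorem continuous_exp_matrix : Continuous (NormedSpace.exp : Matrix V V ℂ → Matrix V V ℂ) := by
  open scoped Matrix.Norms.Operator in
    exact NormedSpace.exp_continuous

theorem exp_submatrix (A : Matrix V V ℂ) (σ : Equiv.Perm V) :
    (NormedSpace.exp A).submatrix σ σ = NormedSpace.exp (A.submatrix σ σ) := by
  have hc : Continuous fun B : Matrix V V ℂ => B.submatrix σ σ := by fun_prop
  open scoped Matrix.Norms.Operator in
    exact NormedSpace.map_exp (Matrix.reindexAlgEquiv ℂ ℂ σ.symm) hc A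

variable (H : Matrix V V ℂ)

theorem evolve_zero : evolve H 0 = 1 := by simp [evolve]

theorem evolve_add (s t : ℝ) : evolve H (s + t) = evolve H s * evolve H t := by
  unfold evolve
  rw [← Matrix.exp_add_of_commute, ← add_smul]
  · congr 2; push_cast; ring
  · exact ((Commute.refl H).smul_left _).smul_right _

theorem evolve_mul_neg (t : ℝ) : evolve H t * evolve H (-t) = 1 := by
  rw [← evolve_add, add_neg_cancel, evolve_zero]

theorem evolve_conjTranspose {H : Matrix V V ℂ} (hH : H.IsHermitian) (t : ℝ) :
    (evolve H t)ᴴ = evolve H (-t) := by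
  unfold evolve
  rw [← Matrix.exp_conjTranspose, Matrix.conjTranspose_smul, hH.eq]
  congr 2
  simp

theorem continuous_evolve : Continuous (evolve H) := by
  unfold evolve
  exact continuous_exp_matrix.comp (by fun_prop)

theorem evolve_submatrix (σ : Equiv.Perm V) (t : ℝ) :
    (evolve H t).submatrix σ σ = evolve (H.submatrix σ σ) t := by
  unfold evolve
  rw [exp_submatrix]
  rfl

theorem evolve_smul (c t : ℝ) : evolve ((c : ℂ) • H) t = evolve H (c * t) := by
  unfold evolve
  rw [smul_smul]; congr 2; push_cast; ring

variable {H}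

theorem evolve_mulVec {f : V → ℂ} {l : ℝ} (h : H *ᵥ f = (l : ℂ) • f) (t : ℝ) :
    evolve H t *ᵥ f = cis (l * t) • f := by
  unfold evolve cis
  have : ((-(I * (t : ℂ))) • H) *ᵥ f = (-(I * ((l * t : ℝ) : ℂ))) • f := by
    rw [Matrix.smul_mulVec, h, smul_smul]; congr 1; push_cast; ring
  exact exp_mulVec_of_eigen this

theorem proj_mulVec (v : V) (f : V → ℂ) : proj v *ᵥ f = f v • ket v := by
  ext i
  simp [proj, Matrix.vecMulVec, Matrix.mulVec, dotProduct, ket, Pi.single_apply, mul_comm]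

theorem evolve_proj_mulVec (v : V) (θ : ℝ) (f : V → ℂ) :
    evolve (proj v) θ *ᵥ f = f + ((cis θ - 1) * f v) • ket v := by
  have h1 : proj v *ᵥ ket v = ((1 : ℝ) : ℂ) • ket v := by rw [proj_mulVec]; simp [ket]
  have h2 : proj v *ᵥ (f - f v • ket v) = ((0 : ℝ) : ℂ) • (f - f v • ket v) := by
    rw [proj_mulVec]; simp [ket]
  have e1 := evolve_mulVec h1 θ
  have e2 := evolve_mulVec h2 θ
  rw [one_mul] at e1
  rw [zero_mul, cis_zero, one_smul, Matrix.mulVec_sub, Matrix.mulVec_smul, e1] at e2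
  rw [sub_mul, sub_smul, one_mul, mul_comm, mul_smul]
  rw [sub_eq_iff_eq_add] at e2
  rw [e2]; abel

/-- A matrix as an operator on Euclidean space. -/
noncomputable def euclideanOp : Matrix V V ℂ ≃ₐ[ℂ] Module.End ℂ (EuclideanSpace ℂ V) := Matrix.toLpLinAlgEquiv 2

theorem euclideanOp_apply (A : Matrix V V ℂ) (x : EuclideanSpace ℂ V) :
    euclideanOp A x = WithLp.toLp 2 (A *ᵥ x.ofLp) := rfl

/-- The basis state `|v⟩` as a vector of Euclidean space. -/
noncomputable def eket (v : V) : EuclideanSpace ℂ V := WithLp.toLp 2 (ket v)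

omit [DecidableEq V] in
theorem inner_eq_sum (x y : EuclideanSpace ℂ V) :
    inner ℂ x y = ∑ i, (starRingEnd ℂ) (x i) * y i := by
  rw [PiLp.inner_apply]
  refine Finset.sum_congr rfl fun i _ => ?_
  rw [RCLike.inner_apply, mul_comm]

theorem inner_eket (v : V) (x : EuclideanSpace ℂ V) : inner ℂ (eket v) x = x v := by
  rw [inner_eq_sum]
  simp [eket, ket]

theorem norm_eket (v : V) : ‖eket v‖ = 1 := by
  have : inner ℂ (eket v) (eket v) = (1 : ℂ) := by rw [inner_eket]; simp [eket, ket]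
  rw [inner_self_eq_norm_sq_to_K] at this
  have h : ‖eket v‖ ^ 2 = 1 := Complex.ofReal_injective (by push_cast; simpa using this)
  exact (pow_eq_one_iff_of_nonneg (norm_nonneg _) two_ne_zero).1 h

theorem euclideanOp_evolve_proj (v : V) (θ : ℝ) :
    euclideanOp (evolve (proj v) θ) = phaseGate (eket v) θ := by
  ext x i
  rw [phaseGate_apply, inner_eket, euclideanOp_apply, evolve_proj_mulVec]
  rfl

theorem inner_euclideanOp (A : Matrix V V ℂ) (x y : EuclideanSpace ℂ V) :
    inner ℂ (euclideanOp A x) y = inner ℂ x (euclideanOp Aᴴ y) := by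
  rw [inner_eq_sum, inner_eq_sum]
  simp only [euclideanOp_apply, Matrix.mulVec, dotProduct, map_sum, map_mul,
    Matrix.conjTranspose_apply, Finset.sum_mul, Finset.mul_sum]
  rw [Finset.sum_comm]
  refine Finset.sum_congr rfl fun i _ => Finset.sum_congr rfl fun j _ => ?_
  simp only [Complex.star_def]
  ring

theorem walkFamily_evolve (hH : H.IsHermitian) :
    WalkFamily fun t => euclideanOp (evolve H t) where
  adjoint t x y := by rw [inner_euclideanOp, evolve_conjTranspose hH]
  mul_neg t := by rw [← map_mul, evolve_mul_neg, map_one]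
  comm s t x := by
    rw [← Module.End.mul_apply, ← Module.End.mul_apply, ← map_mul, ← map_mul, ← evolve_add,
      ← evolve_add, add_comm]
  cont x := by
    have := continuous_evolve H
    simp only [inner_eq_sum, euclideanOp_apply, Matrix.mulVec, dotProduct]
    fun_prop
  zero := by rw [evolve_zero, map_one]

end Exponential

/-! ### From words of gates to lists of layers. -/

section Lists

variable {V : Type} [Fintype V] [DecidableEq V] {ι : Type} {H : Matrix V V ℂ}

theorem walkOp_append (x : ι → V) (l l' : List (Layer ι)) :
    walkOp H x (l ++ l') = walkOp H x l' * walkOp H x l := by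
  induction l with
  | nil => simp [walkOp]
  | cons σ l ih => rw [List.cons_append, walkOp, walkOp, ih, mul_assoc]

theorem Admissible.append {l l' : List (Layer ι)} (h : Admissible l) (h' : Admissible l') :
    Admissible (l ++ l') := by
  intro σ hσ
  rcases List.mem_append.1 hσ with h1 | h1
  exacts [h σ h1, h' σ h1]

theorem totalTime_le {l : List (Layer ι)} (h : Admissible l) :
    totalTime l ≤ 4 * Real.pi * l.length := by
  induction l with
  | nil => simp [totalTime]
  | cons σ l ih =>
    have h1 := h σ (by simp)
    have h2 := ih fun τ hτ => h τ (by simp [hτ])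
    simp only [totalTime, List.map_cons, List.sum_cons, List.length_cons] at h2 ⊢
    push_cast
    have := h1.1.2
    have := h1.2.2
    linarith

theorem exists_int_shift_mem (θ : ℝ) : ∃ θ' ∈ Set.Ico 0 (2 * Real.pi), ∃ k : ℤ, θ' = θ - k * (2 * Real.pi) := by
  have hp : 0 < 2 * Real.pi := by positivity
  refine ⟨toIcoMod hp 0 θ, ?_, toIcoDiv hp 0 θ, ?_⟩
  · simpa using toIcoMod_mem_Ico hp 0 θ
  · rw [toIcoMod, zsmul_eq_mul]

theorem cis_int_mul_two_pi (k : ℤ) : cis (k * (2 * Real.pi)) = 1 := by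
  rw [cis_eq, Complex.exp_eq_one_iff]
  exact ⟨-k, by push_cast; ring⟩

theorem exists_angle_mem (θ : ℝ) : ∃ θ' ∈ Set.Ico 0 (2 * Real.pi), cis θ' = cis θ := by
  obtain ⟨θ', h, k, hk⟩ := exists_int_shift_mem θ
  refine ⟨θ', h, ?_⟩
  have : θ = θ' + k * (2 * Real.pi) := by rw [hk]; ring
  rw [this, cis_add, cis_int_mul_two_pi, mul_one]

/-- Words of gates are realized by admissible lists of layers. -/
theorem Gen.exists_list {D : ℝ → Matrix V V ℂ}
    (hper : ∀ t, ∃ t' ∈ Set.Ico 0 (2 * Real.pi), evolve H t' = D t) (x : ι → V) (i : ι) {n : ℕ}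
    {U : Module.End ℂ (EuclideanSpace ℂ V)}
    (h : Gen (fun t => euclideanOp (D t)) (phaseGate (eket (x i))) n U) :
    ∃ l : List (Layer ι), Admissible l ∧ l.length ≤ n ∧ euclideanOp (walkOp H x l) = U := by
  have hpos : (0 : ℝ) ∈ Set.Ico 0 (2 * Real.pi) := ⟨le_rfl, by positivity⟩
  induction h with
  | one => exact ⟨[], by simp [Admissible], by simp, by simp [walkOp]⟩
  | weaken _ ih =>
    obtain ⟨l, h1, h2, h3⟩ := ih
    exact ⟨l, h1, by omega, h3⟩
  | walk t _ ih =>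
    obtain ⟨l, h1, h2, h3⟩ := ih
    obtain ⟨t', ht', ht⟩ := hper t
    -- A gate becomes a layer whose other parameter is 0. It goes to the end of the list because the
    -- head acts first.
    refine ⟨l ++ [⟨i, 0, t'⟩], h1.append (fun τ hτ => by
      rw [List.mem_singleton] at hτ; subst hτ; exact ⟨hpos, ht'⟩),
      by simpa using h2, ?_⟩
    rw [walkOp_append, map_mul, h3]
    simp [walkOp, Layer.op, evolve_zero, ht]
  | phase θ _ ih =>
    obtain ⟨l, h1, h2, h3⟩ := ih
    obtain ⟨θ', hθ', hθ⟩ := exists_angle_mem θ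
    refine ⟨l ++ [⟨i, θ', 0⟩], h1.append (fun τ hτ => by
      rw [List.mem_singleton] at hτ; subst hτ; exact ⟨hθ', hpos⟩),
      by simpa using h2, ?_⟩
    rw [walkOp_append, map_mul, h3]
    simp [walkOp, Layer.op, evolve_zero, euclideanOp_evolve_proj, phaseGate, hθ]

/-- Conjugation by an automorphism of `H` only moves the marked vertices. This is why one list of
parameters serves every vertex of an orbit. -/
theorem walkOp_submatrix (σ : Equiv.Perm V) (hσ : H.submatrix σ σ = H) (x : ι → V)
    (l : List (Layer ι)) :
    (walkOp H (fun i => σ (x i)) l).submatrix σ σ = walkOp H x l := by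
  induction l with
  | nil => simp [walkOp]
  | cons τ l ih =>
    have hp : (proj (σ (x τ.mark))).submatrix σ σ = proj (x τ.mark) := by
      ext i j
      simp [proj, Matrix.vecMulVec, ket, Pi.single_apply]
    rw [walkOp, walkOp, Layer.op, Layer.op, ← ih, ← Matrix.submatrix_mul_equiv _ _ _ σ,
      ← Matrix.submatrix_mul_equiv _ _ _ σ, evolve_submatrix, evolve_submatrix, hσ, hp]

end Lists
end AlternatingWalk

namespace AlternatingWalk

open Complex Matrix

/-! ### Integer spectra: periodicity and projection to the kernel. -/

section Spectrum

variable {V : Type} [Fintype V]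

/-- All eigenvalues of `H` are integers from `Λ`. -/
def IntegerSpectrum (H : Matrix V V ℂ) (Λ : Finset ℤ) : Prop :=
  ∀ (μ : ℂ) (f : V → ℂ), f ≠ 0 → H *ᵥ f = μ • f → ∃ l ∈ Λ, μ = (l : ℂ)

variable [DecidableEq V] {H : Matrix V V ℂ} {Λ : Finset ℤ}

theorem IntegerSpectrum.eigenvalues (hH : H.IsHermitian) (hΛ : IntegerSpectrum H Λ) (i : V) :
    ∃ l ∈ Λ, hH.eigenvalues i = (l : ℝ) := by
  have hne : (hH.eigenvectorBasis i).ofLp ≠ 0 := by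
    intro h
    have h1 := hH.eigenvectorBasis.orthonormal.1 i
    have : hH.eigenvectorBasis i = 0 := by ext j; simp [h]
    rw [this, norm_zero] at h1
    exact zero_ne_one h1
  obtain ⟨l, hl, h⟩ := hΛ (hH.eigenvalues i) _ hne (by
    rw [hH.mulVec_eigenvectorBasis]; rfl)
  exact ⟨l, hl, by exact_mod_cast h⟩

/-- On an eigenbasis, shifting the time by a multiple of 2π changes nothing. Every walk gate can
therefore use a time in [0, 2π). -/
theorem IntegerSpectrum.periodic (hH : H.IsHermitian) (hΛ : IntegerSpectrum H Λ) (t : ℝ) :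
    ∃ t' ∈ Set.Ico 0 (2 * Real.pi), evolve H t' = evolve H t := by
  obtain ⟨t', ht', k, hk⟩ := exists_int_shift_mem t
  refine ⟨t', ht', ?_⟩
  apply euclideanOp.injective
  apply hH.eigenvectorBasis.toBasis.ext
  intro i
  obtain ⟨l, _, hl⟩ := hΛ.eigenvalues hH i
  have h1 : H *ᵥ (hH.eigenvectorBasis i).ofLp = ((l : ℝ) : ℂ) • (hH.eigenvectorBasis i).ofLp := by
    rw [hH.mulVec_eigenvectorBasis, hl]; rfl
  rw [OrthonormalBasis.coe_toBasis, euclideanOp_apply, euclideanOp_apply, evolve_mulVec h1,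
    evolve_mulVec h1]
  have : (l : ℝ) * t = l * t' + ((l * k : ℤ) : ℝ) * (2 * Real.pi) := by
    rw [hk]; push_cast; ring
  rw [this, cis_add, cis_int_mul_two_pi, mul_one]

/-- From a vertex `m`, an alternating walk reaches exactly the direction of the projection of `m`
to the kernel of the Hamiltonian. -/
theorem reach_kernel (hH : H.IsHermitian) (hΛ : IntegerSpectrum H Λ) (m : V) :
    ∃ x₀ : EuclideanSpace ℂ V, H *ᵥ x₀.ofLp = 0 ∧
      (∀ g : EuclideanSpace ℂ V, H *ᵥ g.ofLp = 0 → inner ℂ g x₀ = inner ℂ g (eket m)) ∧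
      (x₀ ≠ 0 → ∃ n U, Gen (fun t => euclideanOp (evolve H t)) (phaseGate (eket m)) n U ∧
        (n : ℝ) ≤ coreConst Λ.card / ‖x₀‖ ∧ ∃ ω : ℂ, U (eket m) = ω • x₀) := by
  classical
  choose L hL hLe using hΛ.eigenvalues hH
  set b := hH.eigenvectorBasis with hb
  set x : ℤ → EuclideanSpace ℂ V :=
    fun l => ∑ i ∈ Finset.univ.filter (fun i => L i = l), inner ℂ (b i) (eket m) • b i with hx
  have hHx : ∀ l, H *ᵥ (x l).ofLp = ((l : ℝ) : ℂ) • (x l).ofLp := by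
    intro l
    simp only [hx, WithLp.ofLp_sum, WithLp.ofLp_smul, Matrix.mulVec_sum, Finset.smul_sum,
      Matrix.mulVec_smul]
    refine Finset.sum_congr rfl fun i hi => ?_
    rw [hb, hH.mulVec_eigenvectorBasis, hLe, (Finset.mem_filter.1 hi).2, smul_comm]
    rfl
  have hsum : eket m = ∑ l ∈ insert 0 Λ, x l := by
    rw [← b.sum_repr' (eket m)]
    simp only [hx]
    rw [Finset.sum_fiberwise_of_maps_to]
    exact fun i _ => Finset.mem_insert_of_mem (hL i)
  have hD := walkFamily_evolve hH
  have hDx : ∀ l t, euclideanOp (evolve H t) (x l) = cis (l * t) • x l := by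
    intro l t
    rw [euclideanOp_apply, evolve_mulVec (hHx l)]
    rfl
  have hDx0 : ∀ t, euclideanOp (evolve H t) (x 0) = x 0 := by
    intro t; rw [hDx]; simp [cis_zero]
  have hsum' : eket m = x 0 + ∑ l ∈ Λ.erase 0, x l := by
    rw [hsum, ← Finset.insert_erase (Finset.mem_insert_self 0 Λ), Finset.sum_insert (by simp)]
    simp
  refine ⟨x 0, by rw [hHx]; simp, fun g hg => ?_, fun hne => ?_⟩
  · have hz : inner ℂ g (∑ l ∈ Λ.erase 0, x l) = 0 := by
      rw [inner_sum]
      refine Finset.sum_eq_zero fun l hl => ?_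
      refine inner_eq_zero_of_freq hD (Finset.ne_of_mem_erase hl) (fun t => ?_) (hDx l)
      have : H *ᵥ g.ofLp = ((0 : ℝ) : ℂ) • g.ofLp := by rw [hg]; simp
      rw [euclideanOp_apply, evolve_mulVec this]
      simp [cis_zero]
    rw [hsum', inner_add_right, hz, add_zero]
  · obtain ⟨n, U, h1, h2, h3⟩ := exact_transfer hD _ (Λ.erase 0) x (x 0) (eket m) (by simp)
      (Finset.card_le_card (Finset.erase_subset _ _)) hDx0 (fun l _ t => hDx l t) hsum'
      (norm_eket m) hne
    exact ⟨n, U, h1, h2, h3⟩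

end Spectrum

/-! ### The three tasks for a Hamiltonian with integer spectrum and constant kernel. -/

section Tasks

variable {V : Type} [Fintype V] [DecidableEq V]

theorem norm_uniformState {S : Finset V} (hS : S.Nonempty) :
    ‖(WithLp.toLp 2 (uniformState S) : EuclideanSpace ℂ V)‖ = 1 := by
  have hc : (0 : ℝ) < S.card := by exact_mod_cast hS.card_pos
  have h : ‖(WithLp.toLp 2 (uniformState S) : EuclideanSpace ℂ V)‖ ^ 2 = 1 := by
    rw [EuclideanSpace.norm_sq_eq]
    have : ∀ i, ‖(WithLp.toLp 2 (uniformState S) : EuclideanSpace ℂ V) i‖ ^ 2 =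
        if i ∈ S then 1 / (S.card : ℝ) else 0 := by
      intro i
      simp only [uniformState]
      split_ifs
      · rw [Complex.norm_real, Real.norm_eq_abs, sq_abs, div_pow, Real.sq_sqrt hc.le, one_pow]
      · simp
    simp only [this, Finset.sum_ite_mem, Finset.univ_inter, Finset.sum_const, nsmul_eq_mul]
    field_simp
  exact (pow_eq_one_iff_of_nonneg (norm_nonneg _) two_ne_zero).1 h

variable {H : Matrix V V ℂ} {Λ : Finset ℤ}

theorem unit_smul_of_gen {D : ℝ → Module.End ℂ (EuclideanSpace ℂ V)} (hD : WalkFamily D) {m : V}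
    {n : ℕ} {U : Module.End ℂ (EuclideanSpace ℂ V)} (hU : Gen D (phaseGate (eket m)) n U)
    {s : EuclideanSpace ℂ V} (hs : ‖s‖ = 1) {ω : ℂ} (h : U (eket m) = ω • s) : ‖ω‖ = 1 := by
  have := hU.norm_map hD (norm_eket m) (eket m)
  rwa [h, norm_smul, hs, norm_eket, mul_one] at this

/-- The kernel of `H` is spanned by the constant functions. -/
def ConstantKernel (H : Matrix V V ℂ) : Prop :=
  ∀ f : V → ℂ, H *ᵥ f = 0 ↔ ∃ c : ℂ, f = fun _ => c

/-- The kernel component of |m⟩ is ⟨s|m⟩|s⟩, of norm 1/√N; its inverse is the cost. -/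
theorem reach_uniform (hH : H.IsHermitian) (hΛ : IntegerSpectrum H Λ) (hker : ConstantKernel H)
    (m : V) :
    ∃ n U, Gen (fun t => euclideanOp (evolve H t)) (phaseGate (eket m)) n U ∧
      (n : ℝ) ≤ coreConst Λ.card * Real.sqrt (Fintype.card V) ∧
      ∃ ω : ℂ, ‖ω‖ = 1 ∧ U (eket m) = ω • WithLp.toLp 2 (uniformState Finset.univ) := by
  obtain ⟨x₀, hx₀, hproj, hreach⟩ := reach_kernel hH hΛ m
  have : Nonempty V := ⟨m⟩
  have hs1 := norm_uniformState (V := V) Finset.univ_nonempty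
  have hsi : ∀ i, (WithLp.toLp 2 (uniformState Finset.univ) : EuclideanSpace ℂ V) i =
      ((1 / Real.sqrt (Fintype.card V) : ℝ) : ℂ) := fun i => by
    simp [uniformState]
  generalize (WithLp.toLp 2 (uniformState Finset.univ) : EuclideanSpace ℂ V) = s at *
  have hN0 : 0 < Real.sqrt (Fintype.card V) := Real.sqrt_pos.2 (by exact_mod_cast Fintype.card_pos)
  generalize Real.sqrt (Fintype.card V) = N at *
  have hNc : (N : ℂ) ≠ 0 := by exact_mod_cast hN0.ne'
  obtain ⟨c, hc⟩ := (hker x₀.ofLp).1 hx₀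
  have hxs : x₀ = (c * N) • s := by
    ext i
    have : x₀ i = c := congrFun hc i
    rw [PiLp.smul_apply, this, hsi, smul_eq_mul]
    push_cast; field_simp
  have h1 := hproj s ((hker s.ofLp).2 ⟨((1 / N : ℝ) : ℂ), funext hsi⟩)
  rw [← inner_conj_symm s (eket m), inner_eket, hsi, Complex.conj_ofReal, hxs, inner_smul_right,
    inner_self_eq_norm_sq_to_K, hs1] at h1
  have hcN : c * N = ((1 / N : ℝ) : ℂ) := by simpa using h1
  have hx₀n : ‖x₀‖ = 1 / N := by
    rw [hxs, norm_smul, hs1, hcN, Complex.norm_real, mul_one, Real.norm_of_nonneg (by positivity)]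
  obtain ⟨n, U, hU, hn, ω, hω⟩ := hreach (by
    rw [← norm_pos_iff, hx₀n]; positivity)
  refine ⟨n, U, hU, ?_, ω * (c * N), ?_, ?_⟩
  · rw [hx₀n] at hn; simpa using hn
  · exact unit_smul_of_gen (walkFamily_evolve hH) hU hs1 (by rw [hω, hxs, smul_smul])
  · rw [hω, hxs, smul_smul]

theorem reach_from_uniform (hH : H.IsHermitian) (hΛ : IntegerSpectrum H Λ)
    (hker : ConstantKernel H) (m : V) :
    ∃ n U, Gen (fun t => euclideanOp (evolve H t)) (phaseGate (eket m)) n U ∧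
      (n : ℝ) ≤ coreConst Λ.card * Real.sqrt (Fintype.card V) ∧
      ∃ ω : ℂ, ‖ω‖ = 1 ∧ U (WithLp.toLp 2 (uniformState Finset.univ)) = ω • eket m := by
  obtain ⟨n, U, hU, hn, ω, hω1, hω⟩ := reach_uniform hH hΛ hker m
  obtain ⟨U', hU', _, h2, _⟩ := hU.exists_inv (walkFamily_evolve hH) (norm_eket m)
  have hω0 : ω ≠ 0 := by rw [← norm_pos_iff, hω1]; norm_num
  refine ⟨n, U', hU', hn, ω⁻¹, by rw [norm_inv, hω1, inv_one], ?_⟩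
  have := congrArg U' hω
  rw [← Module.End.mul_apply, h2, Module.End.one_apply, map_smul] at this
  rw [this, smul_smul, inv_mul_cancel₀ hω0, one_smul]

theorem totalTime_le_budget {ι : Type} {l : List (Layer ι)} (hl : Admissible l) {B : ℝ}
    (h : (l.length : ℝ) ≤ B) : totalTime l ≤ 4 * Real.pi * B :=
  (totalTime_le hl).trans (by gcongr)

theorem le_four_pi_mul {B : ℝ} (hB : 0 ≤ B) : B ≤ 4 * Real.pi * B := by
  nlinarith [Real.pi_gt_three]

theorem ExactUniformSampling.mono {B B' : ℝ} (h : ExactUniformSampling H B) (hB : B ≤ B') :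
    ExactUniformSampling H B' := fun m => by
  obtain ⟨l, h1, h2, h3, h4⟩ := h m
  exact ⟨l, h1, h2.trans hB, h3.trans hB, h4⟩

theorem PerfectStateTransfer.mono {B B' : ℝ} (h : PerfectStateTransfer H B) (hB : B ≤ B') :
    PerfectStateTransfer H B' := fun u v => by
  obtain ⟨l, h1, h2, h3, h4⟩ := h u v
  exact ⟨l, h1, h2.trans hB, h3.trans hB, h4⟩

theorem DeterministicSearch.mono {r : ℕ} {S : Fin r → Finset V} {B B' : ℝ}
    (h : DeterministicSearch H S B) (hB : B ≤ B') : DeterministicSearch H S B' := by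
  obtain ⟨l, h1, h2, h3, h4⟩ := h
  exact ⟨l, h1, h2.trans hB, h3.trans hB, h4⟩

theorem exactUniformSampling_of_spectrum (hH : H.IsHermitian) (hΛ : IntegerSpectrum H Λ)
    (hker : ConstantKernel H) :
    ExactUniformSampling H (4 * Real.pi * (coreConst Λ.card * Real.sqrt (Fintype.card V))) := by
  intro m
  obtain ⟨n, U, hU, hn, ω, hω1, hω⟩ := reach_uniform hH hΛ hker m
  obtain ⟨l, hl, hlen, hlU⟩ := hU.exists_list (hΛ.periodic hH) (fun _ : Unit => m) ()
  have hB : (l.length : ℝ) ≤ coreConst Λ.card * Real.sqrt (Fintype.card V) :=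
    le_trans (by exact_mod_cast hlen) hn
  refine ⟨l, hl, hB.trans (le_four_pi_mul ((Nat.cast_nonneg _).trans hB)),
    totalTime_le_budget hl hB, ?_⟩
  have hω0 : ω ≠ 0 := by rw [← norm_pos_iff, hω1]; norm_num
  obtain ⟨γ, hγ⟩ := exists_cis (ξ := ω⁻¹) (by rw [norm_inv, hω1, inv_one])
  refine ⟨γ, ?_⟩
  change _ = cis γ • _
  rw [← hlU, euclideanOp_apply] at hω
  have h1 : walkOp H (fun _ => m) l *ᵥ ket m = ω • uniformState Finset.univ :=
    congrArg WithLp.ofLp hω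
  rw [h1, hγ, smul_smul, inv_mul_cancel₀ hω0, one_smul]

theorem perfectStateTransfer_of_spectrum (hH : H.IsHermitian) (hΛ : IntegerSpectrum H Λ)
    (hker : ConstantKernel H) :
    PerfectStateTransfer H
      (4 * Real.pi * (2 * (coreConst Λ.card * Real.sqrt (Fintype.card V)))) := by
  intro u v
  obtain ⟨n, U, hU, hn, ω, hω1, hω⟩ := reach_uniform hH hΛ hker u
  obtain ⟨n', U', hU', hn', ω', hω1', hω'⟩ := reach_from_uniform hH hΛ hker v
  obtain ⟨l, hl, hlen, hlU⟩ := Gen.exists_list (hΛ.periodic hH) ![u, v] 0 hU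
  obtain ⟨l', hl', hlen', hlU'⟩ := Gen.exists_list (hΛ.periodic hH) ![u, v] 1 hU'
  have hB : ((l ++ l').length : ℝ) ≤ 2 * (coreConst Λ.card * Real.sqrt (Fintype.card V)) := by
    rw [List.length_append]
    push_cast
    have h1 : (l.length : ℝ) ≤ n := by exact_mod_cast hlen
    have h2 : (l'.length : ℝ) ≤ n' := by exact_mod_cast hlen'
    linarith
  refine ⟨l ++ l', hl.append hl', hB.trans (le_four_pi_mul ((Nat.cast_nonneg _).trans hB)),
    totalTime_le_budget (hl.append hl') hB, ?_⟩
  have h : euclideanOp (walkOp H ![u, v] (l ++ l')) (eket u) = (ω * ω') • eket v := by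
    rw [walkOp_append, map_mul, hlU, hlU', Module.End.mul_apply, hω, map_smul, hω', smul_smul]
  have h1 : walkOp H ![u, v] (l ++ l') *ᵥ ket u = (ω * ω') • ket v := congrArg WithLp.ofLp h
  rw [h1]
  simp [ket, hω1, hω1']

/-- A search list that works for one marked vertex works for its images under automorphisms. -/
theorem search_transport {σ : Equiv.Perm V} (hσ : H.submatrix σ σ = H) {S : Finset V}
    (hS : ∀ v, σ v ∈ S ↔ v ∈ S) (m : V) (l : List (Layer Unit)) :
    (walkOp H (fun _ => σ m) l *ᵥ uniformState S) (σ m) =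
      (walkOp H (fun _ => m) l *ᵥ uniformState S) m := by
  rw [← walkOp_submatrix σ hσ (fun _ => m) l]
  simp only [Matrix.mulVec, dotProduct, Matrix.submatrix_apply]
  rw [← Equiv.sum_comp σ]
  simp [uniformState, hS]

/-- The list is constructed for one vertex only; automorphisms carry its success to all others. -/
theorem deterministicSearch_of_spectrum (hH : H.IsHermitian) (hΛ : IntegerSpectrum H Λ)
    (hker : ConstantKernel H) [Nonempty V]
    (htrans : ∀ m m' : V, ∃ σ : Equiv.Perm V, σ m = m' ∧ H.submatrix σ σ = H) :
    DeterministicSearch H ![Finset.univ]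
      (4 * Real.pi * (coreConst Λ.card * Real.sqrt (Fintype.card V))) := by
  obtain ⟨m⟩ := ‹Nonempty V›
  obtain ⟨n, U, hU, hn, ω, hω1, hω⟩ := reach_from_uniform hH hΛ hker m
  obtain ⟨l, hl, hlen, hlU⟩ := hU.exists_list (hΛ.periodic hH) (fun _ : Unit => m) ()
  have hB : (l.length : ℝ) ≤ coreConst Λ.card * Real.sqrt (Fintype.card V) :=
    le_trans (by exact_mod_cast hlen) hn
  refine ⟨fun _ => l, fun _ => hl, ?_, ?_, fun m' => ⟨0, by simp, ?_⟩⟩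
  · simpa using hB.trans (le_four_pi_mul ((Nat.cast_nonneg _).trans hB))
  · simpa using totalTime_le_budget hl hB
  · obtain ⟨σ, rfl, hσ⟩ := htrans m m'
    rw [← hlU, euclideanOp_apply] at hω
    have h1 : walkOp H (fun _ => m) l *ᵥ uniformState Finset.univ = ω • ket m :=
      congrArg WithLp.ofLp hω
    simp only [Matrix.cons_val_zero]
    rw [search_transport hσ (by simp), h1]
    simp [ket, hω1]

/-- `G` is vertex transitive. -/
def VertexTransitive (G : SimpleGraph V) : Prop :=
  ∀ m m' : V, ∃ σ : Equiv.Perm V, σ m = m' ∧ ∀ u v, G.Adj (σ u) (σ v) ↔ G.Adj u v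

end Tasks
end AlternatingWalk

namespace AlternatingWalk

open Matrix

/-! ### Spectra of sums of commuting operators. -/

section IntSpec

variable {F : Type*} [AddCommGroup F] [Module ℂ F] {M N : Module.End ℂ F} {Λ : Finset ℤ}

/-- All eigenvalues of the operator `T` are integers from `Λ`. -/
def IntSpec (T : Module.End ℂ F) (Λ : Finset ℤ) : Prop :=
  ∀ (μ : ℂ) (f : F), f ≠ 0 → T f = μ • f → ∃ l ∈ Λ, μ = (l : ℂ)

theorem intSpec_zero : IntSpec (0 : Module.End ℂ F) {0} := by
  intro μ f hf h
  refine ⟨0, by simp, ?_⟩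
  have h' : μ • f = 0 := by rw [← h]; rfl
  simpa [hf] using h'

/-- Let f be an eigenvector of M + N for μ. If Nf = 0, it is one of M for μ. Otherwise Nf is an
eigenvector of M for μ - q, since N² = qN and N commutes with M. Each such summand at most doubles
the number of eigenvalues. -/
theorem IntSpec.add (hM : IntSpec M Λ) {q : ℤ} (hN : N * N = (q : ℂ) • N) (hMN : M * N = N * M) :
    IntSpec (M + N) (Λ ∪ Λ.image fun l => l + q) := by
  intro μ f hf h
  rw [LinearMap.add_apply] at h
  by_cases hg : N f = 0
  · rw [hg, add_zero] at h
    obtain ⟨l, hl, h1⟩ := hM μ f hf h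
    exact ⟨l, Finset.mem_union_left _ hl, h1⟩
  · have e1 : N (N f) = (q : ℂ) • N f := LinearMap.congr_fun hN f
    have e2 : M (N f) = N (M f) := LinearMap.congr_fun hMN f
    have e3 : M (N f) = (μ - q) • N f := by
      rw [e2, eq_sub_of_add_eq h, map_sub, map_smul, e1, sub_smul]
    obtain ⟨l, hl, h1⟩ := hM _ _ hg e3
    exact ⟨l + q, Finset.mem_union_right _ (Finset.mem_image_of_mem _ hl), by
      push_cast; linear_combination h1⟩

theorem IntSpec.card_add (Λ : Finset ℤ) (q : ℤ) :
    (Λ ∪ Λ.image fun l => l + q).card ≤ 2 * Λ.card :=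
  (Finset.card_union_le _ _).trans (by
    have := Finset.card_image_le (s := Λ) (f := fun l => l + q)
    omega)

theorem sub_mul_self_of_mul_self {J : Module.End ℂ F} {q : ℂ} (hJ : J * J = q • J) :
    (q • 1 - J) * (q • 1 - J) = q • (q • 1 - J) := by
  rw [sub_mul, mul_sub, mul_sub, hJ]
  simp only [smul_mul_assoc, mul_smul_comm, one_mul, mul_one, smul_sub]
  abel

end IntSpec

/-! ### From graph Laplacians to the three tasks. -/

section Graph

variable {V : Type} [Fintype V] [DecidableEq V] {G : SimpleGraph V} [DecidableRel G.Adj]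

theorem lap_apply (f : V → ℂ) (x : V) :
    (G.lapMatrix ℂ *ᵥ f) x = ∑ y, if G.Adj x y then f x - f y else 0 := by
  rw [SimpleGraph.lapMatrix_mulVec_apply, ← Finset.sum_filter, Finset.sum_sub_distrib,
    Finset.sum_const, nsmul_eq_mul, ← SimpleGraph.neighborFinset_eq_filter,
    SimpleGraph.card_neighborFinset_eq_degree]

omit [DecidableEq V] in
theorem integerSpectrum_of_intSpec {H : Matrix V V ℂ} {T : Module.End ℂ (V → ℂ)} {Λ : Finset ℤ}
    (hT : ∀ f, H *ᵥ f = T f) (h : IntSpec T Λ) : IntegerSpectrum H Λ :=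
  fun μ f hf hμ => h μ f hf (by rw [← hT, hμ])

/-- Real and imaginary parts are treated separately: a real function in the kernel of L is constant
on reachability classes. -/
theorem constantKernel_lapMatrix (hG : G.Connected) : ConstantKernel (G.lapMatrix ℂ) := by
  intro f
  constructor
  · intro h
    have hre : G.lapMatrix ℝ *ᵥ (fun v => (f v).re) = 0 := by
      ext v
      have := congrArg Complex.re (congrFun h v)
      rw [SimpleGraph.lapMatrix_mulVec_apply] at this ⊢
      simpa using this
    have him : G.lapMatrix ℝ *ᵥ (fun v => (f v).im) = 0 := by
      ext v
      have := congrArg Complex.im (congrFun h v)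
      rw [SimpleGraph.lapMatrix_mulVec_apply] at this ⊢
      simpa using this
    rw [SimpleGraph.lapMatrix_mulVec_eq_zero_iff_forall_reachable] at hre him
    obtain ⟨v₀⟩ := hG.nonempty
    exact ⟨f v₀, funext fun v => Complex.ext (hre v v₀ (hG.preconnected v v₀))
      (him v v₀ (hG.preconnected v v₀))⟩
  · rintro ⟨c, rfl⟩
    ext v
    simp [lap_apply]

theorem lapMatrix_submatrix {σ : Equiv.Perm V} (hσ : ∀ u v, G.Adj (σ u) (σ v) ↔ G.Adj u v) :
    (G.lapMatrix ℂ).submatrix σ σ = G.lapMatrix ℂ := by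
  have hdeg : ∀ v, G.degree (σ v) = G.degree v := by
    intro v
    have e := SimpleGraph.Iso.degree_eq (⟨σ, hσ _ _⟩ : G ≃g G) v
    exact e
  ext u v
  simp only [Matrix.submatrix_apply, SimpleGraph.lapMatrix, Matrix.sub_apply,
    SimpleGraph.degMatrix, Matrix.diagonal_apply, SimpleGraph.adjMatrix_apply, hσ, hdeg,
    EmbeddingLike.apply_eq_iff_eq]

/-- In 8π, the factor 4π bounds the time of one layer, and 2 accounts for the passage through |s⟩ in
state transfer. -/
theorem sampling_and_transfer (hG : G.Connected) {Λ : Finset ℤ} {K : ℕ} (hK : Λ.card ≤ K)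
    (hΛ : IntegerSpectrum (G.lapMatrix ℂ) Λ) :
    PerfectStateTransfer (G.lapMatrix ℂ) (sqrtBudget V (8 * Real.pi * coreConst K)) ∧
      ExactUniformSampling (G.lapMatrix ℂ) (sqrtBudget V (8 * Real.pi * coreConst K)) := by
  have hH : (G.lapMatrix ℂ).IsHermitian := SimpleGraph.isHermitian_lapMatrix ℂ G
  have hc := coreConst_mono hK
  have hc0 := coreConst_nonneg K
  have hs := Real.sqrt_nonneg (Fintype.card V)
  have hpi := Real.pi_pos
  refine ⟨(perfectStateTransfer_of_spectrum hH hΛ (constantKernel_lapMatrix hG)).mono ?_,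
    (exactUniformSampling_of_spectrum hH hΛ (constantKernel_lapMatrix hG)).mono ?_⟩
  · calc 4 * Real.pi * (2 * (coreConst Λ.card * Real.sqrt (Fintype.card V)))
        ≤ 4 * Real.pi * (2 * (coreConst K * Real.sqrt (Fintype.card V))) := by gcongr
      _ = sqrtBudget V (8 * Real.pi * coreConst K) := by unfold sqrtBudget; ring
  · calc 4 * Real.pi * (coreConst Λ.card * Real.sqrt (Fintype.card V))
        ≤ 8 * Real.pi * (coreConst K * Real.sqrt (Fintype.card V)) := by
          gcongr
          · exact mul_nonneg (coreConst_nonneg _) (Real.sqrt_nonneg _)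
          · norm_num
      _ = sqrtBudget V (8 * Real.pi * coreConst K) := by unfold sqrtBudget; ring

/-- All three tasks are solved on connected vertex-transitive graphs whose Laplacian has a bounded
number of eigenvalues, all of them integers. -/
theorem solvesAll_of_spectrum (hG : G.Connected) (htrans : VertexTransitive G) {Λ : Finset ℤ}
    {K : ℕ} (hK : Λ.card ≤ K) (hΛ : IntegerSpectrum (G.lapMatrix ℂ) Λ) :
    SolvesAll G (8 * Real.pi * coreConst K) := by
  have := hG.nonempty
  refine ⟨(deterministicSearch_of_spectrum (SimpleGraph.isHermitian_lapMatrix ℂ G) hΛ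
    (constantKernel_lapMatrix hG) fun m m' => ?_).mono ?_, sampling_and_transfer hG hK hΛ⟩
  · obtain ⟨σ, h1, h2⟩ := htrans m m'
    exact ⟨σ, h1, lapMatrix_submatrix h2⟩
  · have hc := coreConst_mono hK
    have hc0 := coreConst_nonneg K
    have hpi := Real.pi_pos
    calc 4 * Real.pi * (coreConst Λ.card * Real.sqrt (Fintype.card V))
        ≤ 8 * Real.pi * (coreConst K * Real.sqrt (Fintype.card V)) := by
          gcongr
          · exact mul_nonneg (coreConst_nonneg _) (Real.sqrt_nonneg _)
          · norm_num
      _ = sqrtBudget V (8 * Real.pi * coreConst K) := by unfold sqrtBudget; ring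

end Graph

/-! ### Hamming graphs. -/

section Hamming

variable {d q : ℕ}

theorem hamming_connected (hq : 1 ≤ q) : (hammingGraph d q).Connected := by
  have : Nonempty (Fin q) := ⟨⟨0, hq⟩⟩
  have hstep : ∀ (x : Fin d → Fin q) (i : Fin d) (a : Fin q),
      (hammingGraph d q).Reachable x (Function.update x i a) := by
    intro x i a
    by_cases h : x i = a
    · rw [← h, Function.update_eq_self]
    · refine SimpleGraph.Adj.reachable ?_
      change hammingDist x (Function.update x i a) = 1
      rw [hammingDist, Finset.card_eq_one]
      refine ⟨i, ?_⟩
      ext j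
      rcases eq_or_ne j i with rfl | hj
      · simpa using h
      · simp [hj]
  have hmain : ∀ (x y : Fin d → Fin q) (s : Finset (Fin d)),
      (hammingGraph d q).Reachable x (s.piecewise y x) := by
    intro x y s
    induction s using Finset.induction_on with
    | empty => simp
    | insert i s _ ih =>
      rw [Finset.piecewise_insert]
      exact ih.trans (hstep _ _ _)
  exact ⟨fun x y => by simpa using hmain x y Finset.univ⟩

theorem hamming_vertexTransitive : VertexTransitive (hammingGraph d q) := by
  intro m m'
  refine ⟨Equiv.piCongrRight fun i => Equiv.swap (m i) (m' i), ?_, fun u v => ?_⟩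
  · ext i; simp
  · change hammingDist _ _ = 1 ↔ hammingDist _ _ = 1
    have := hammingDist_comp (x := u) (y := v) (fun i => Equiv.swap (m i) (m' i))
      fun i => (Equiv.swap (m i) (m' i)).injective
    rw [← this]
    rfl

/-- Summation over one coordinate. -/
noncomputable def coordSum (q : ℕ) (i : Fin d) : Module.End ℂ ((Fin d → Fin q) → ℂ) :=
  ∑ a : Fin q, LinearMap.funLeft ℂ ℂ fun x => Function.update x i a

theorem coordSum_apply (i : Fin d) (f : (Fin d → Fin q) → ℂ) (x : Fin d → Fin q) :
    coordSum q i f x = ∑ a, f (Function.update x i a) := by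
  simp [coordSum, LinearMap.funLeft]

theorem coordSum_mul_self (i : Fin d) :
    coordSum q i * coordSum q i = (q : ℂ) • coordSum q i := by
  ext f x
  simp [coordSum_apply, Module.End.mul_apply]

theorem coordSum_comm (i j : Fin d) : coordSum q i * coordSum q j = coordSum q j * coordSum q i := by
  rcases eq_or_ne i j with rfl | h
  · rfl
  apply LinearMap.ext
  intro f
  funext x
  simp only [coordSum_apply, Module.End.mul_apply]
  rw [Finset.sum_comm]
  refine Finset.sum_congr rfl fun a _ => Finset.sum_congr rfl fun b _ => ?_
  rw [Function.update_comm h]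

/-- The operator q - `coordSum q i` is the Laplacian of a complete graph in direction i, and each
neighbour of x is reached in exactly one direction. The trivial updates y = x contribute f x - f x =
0. -/
theorem hamming_lap_apply (f : (Fin d → Fin q) → ℂ) :
    (hammingGraph d q).lapMatrix ℂ *ᵥ f = (∑ i, ((q : ℂ) • 1 - coordSum q i)) f := by
  funext x
  rw [lap_apply]
  have key : ∀ y, (if (hammingGraph d q).Adj x y then f x - f y else 0) =
      ∑ i, ∑ a, if y = Function.update x i a then f x - f y else 0 := by
    intro y
    rcases eq_or_ne y x with rfl | hne
    · simp
    have h1 : ∀ i a, y = Function.update x i a ↔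
        (a = y i ∧ ((hammingGraph d q).Adj x y ∧ x i ≠ y i)) := by
      intro i a
      constructor
      · rintro rfl
        have hxa : x i ≠ a := by
          rintro rfl; exact hne (Function.update_eq_self _ _)
        refine ⟨by simp, ?_, by simpa using hxa⟩
        change hammingDist _ _ = 1
        rw [hammingDist, Finset.card_eq_one]
        refine ⟨i, ?_⟩
        ext j
        rcases eq_or_ne j i with rfl | hj
        · simpa using hxa
        · simp [hj]
      · rintro ⟨rfl, h2, h3⟩
        change hammingDist _ _ = 1 at h2
        rw [hammingDist, Finset.card_eq_one] at h2
        obtain ⟨k, hk⟩ := h2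
        have hik : i = k := by
          have : i ∈ Finset.univ.filter fun i => x i ≠ y i := by simpa using h3
          rw [hk] at this; simpa using this
        subst hik
        funext j
        rcases eq_or_ne j i with rfl | hj
        · simp
        · rw [Function.update_of_ne hj]
          by_contra hc
          have : j ∈ Finset.univ.filter fun i => x i ≠ y i := by
            simpa using fun h => hc h.symm
          rw [hk] at this
          exact hj (by simpa using this)
    simp only [h1, ite_and, Finset.sum_ite_eq', Finset.mem_univ, if_true]
    by_cases ha : (hammingGraph d q).Adj x y
    · simp only [ha, if_true]
      change hammingDist _ _ = 1 at ha
      rw [← Finset.sum_filter, Finset.sum_const]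
      change _ = hammingDist x y • _
      rw [ha, one_smul]
    · simp [ha]
  simp only [key]
  rw [Finset.sum_comm]
  have : (∑ i, ((q : ℂ) • 1 - coordSum q i)) f x =
      ∑ i, ((q : ℂ) * f x - ∑ a, f (Function.update x i a)) := by
    rw [LinearMap.sum_apply, Finset.sum_apply]
    refine Finset.sum_congr rfl fun i _ => ?_
    simp [coordSum_apply]
  rw [this]
  refine Finset.sum_congr rfl fun i _ => ?_
  rw [Finset.sum_comm]
  simp

theorem hamming_spectrum (d q : ℕ) :
    ∃ Λ : Finset ℤ, Λ.card ≤ 2 ^ d ∧ IntegerSpectrum ((hammingGraph d q).lapMatrix ℂ) Λ := by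
  have key : ∀ s : Finset (Fin d), ∃ Λ : Finset ℤ, Λ.card ≤ 2 ^ s.card ∧
      IntSpec (∑ i ∈ s, ((q : ℂ) • 1 - coordSum q i)) Λ := by
    intro s
    induction s using Finset.induction_on with
    | empty => exact ⟨{0}, by simp, by simpa using intSpec_zero⟩
    | insert i s hi ih =>
      obtain ⟨Λ, h1, h2⟩ := ih
      refine ⟨_, (IntSpec.card_add Λ q).trans ?_, ?_⟩
      · rw [Finset.card_insert_of_notMem hi, pow_succ']; omega
      · rw [Finset.sum_insert hi, add_comm]
        refine h2.add ?_ ?_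
        · rw [Int.cast_natCast]; exact sub_mul_self_of_mul_self (coordSum_mul_self i)
        · rw [Finset.sum_mul, Finset.mul_sum]
          refine Finset.sum_congr rfl fun j _ => ?_
          have := coordSum_comm (q := q) j i
          simp only [sub_mul, mul_sub, smul_mul_assoc, mul_smul_comm, one_mul, mul_one, this,
            smul_sub]
          abel
  obtain ⟨Λ, h1, h2⟩ := key Finset.univ
  exact ⟨Λ, by simpa using h1, integerSpectrum_of_intSpec hamming_lap_apply h2⟩

end Hamming

/-! ### Rook graphs and complete-square graphs. -/

section BoxProduct

variable {α β : Type} [Fintype α] [Fintype β] [DecidableEq α] [DecidableEq β]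
  {G : SimpleGraph α} {H : SimpleGraph β}

omit [Fintype α] [Fintype β] [DecidableEq α] [DecidableEq β] in
theorem VertexTransitive.boxProd (hG : VertexTransitive G) (hH : VertexTransitive H) :
    VertexTransitive (G.boxProd H) := by
  rintro ⟨a, b⟩ ⟨a', b'⟩
  obtain ⟨σ, h1, h2⟩ := hG a a'
  obtain ⟨τ, h3, h4⟩ := hH b b'
  refine ⟨σ.prodCongr τ, by simp [h1, h3], ?_⟩
  rintro ⟨u, u'⟩ ⟨v, v'⟩
  simp [SimpleGraph.boxProd_adj, h2, h4]

omit [Fintype α] in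
theorem vertexTransitive_top : VertexTransitive (⊤ : SimpleGraph α) := fun m m' =>
  ⟨Equiv.swap m m', by simp, by simp⟩

theorem boxProd_lap_apply [DecidableRel G.Adj] [DecidableRel H.Adj]
    [hGH : DecidableRel (G.boxProd H).Adj] (f : α × β → ℂ) (p : α × β) :
    ((G.boxProd H).lapMatrix ℂ *ᵥ f) p =
      (∑ a, if G.Adj p.1 a then f p - f (a, p.2) else 0) +
        ∑ b, if H.Adj p.2 b then f p - f (p.1, b) else 0 := by
  obtain ⟨x, y⟩ := p
  rw [lap_apply, Fintype.sum_prod_type]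
  have : ∀ a b, (if (G.boxProd H).Adj (x, y) (a, b) then f (x, y) - f (a, b) else 0) =
      (if y = b then (if G.Adj x a then f (x, y) - f (a, b) else 0) else 0) +
      (if x = a then (if H.Adj y b then f (x, y) - f (a, b) else 0) else 0) := by
    intro a b
    by_cases h1 : y = b <;> by_cases h2 : x = a <;> simp [SimpleGraph.boxProd_adj, h1, h2]
  simp only [this, Finset.sum_add_distrib]
  congr 1
  · simp
  · rw [Finset.sum_comm]; simp

/-- Summation over the first coordinate. -/
noncomputable def fstSum (α β : Type) [Fintype α] : Module.End ℂ (α × β → ℂ) :=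
  ∑ a : α, LinearMap.funLeft ℂ ℂ fun p => (a, p.2)

/-- Summation over the second coordinate. -/
noncomputable def sndSum (α β : Type) [Fintype β] : Module.End ℂ (α × β → ℂ) :=
  ∑ b : β, LinearMap.funLeft ℂ ℂ fun p => (p.1, b)

omit [Fintype β] [DecidableEq α] [DecidableEq β] in
theorem fstSum_apply (f : α × β → ℂ) (p : α × β) : fstSum α β f p = ∑ a, f (a, p.2) := by
  simp [fstSum, LinearMap.funLeft]

omit [Fintype α] [DecidableEq α] [DecidableEq β] in
theorem sndSum_apply (f : α × β → ℂ) (p : α × β) : sndSum α β f p = ∑ b, f (p.1, b) := by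
  simp [sndSum, LinearMap.funLeft]

omit [Fintype β] [DecidableEq α] [DecidableEq β] in
theorem fstSum_mul_self :
    fstSum α β * fstSum α β = (Fintype.card α : ℂ) • fstSum α β := by
  apply LinearMap.ext
  intro f
  funext x
  simp [fstSum_apply, Module.End.mul_apply]

omit [Fintype α] [DecidableEq α] [DecidableEq β] in
theorem sndSum_mul_self :
    sndSum α β * sndSum α β = (Fintype.card β : ℂ) • sndSum α β := by
  apply LinearMap.ext
  intro f
  funext x
  simp [sndSum_apply, Module.End.mul_apply]

theorem sum_top_adj (f : α → ℂ) (c : ℂ) (x : α) (h : c = f x) :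
    (∑ a, if (⊤ : SimpleGraph α).Adj x a then c - f a else 0) =
      (Fintype.card α : ℂ) * c - ∑ a, f a := by
  have : ∀ a, (if (⊤ : SimpleGraph α).Adj x a then c - f a else 0) = c - f a := by
    intro a
    by_cases hx : x = a
    · subst hx; simp [h]
    · simp [hx]
  simp only [this, Finset.sum_sub_distrib]
  simp

theorem rook_spectrum (m n : ℕ) :
    ∃ Λ : Finset ℤ, Λ.card ≤ 4 ∧ IntegerSpectrum ((rookGraph m n).lapMatrix ℂ) Λ := by
  have h0 := intSpec_zero (F := Fin m × Fin n → ℂ)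
  have h1 := h0.add (N := (m : ℂ) • 1 - fstSum (Fin m) (Fin n)) (q := m)
    (by
      have := sub_mul_self_of_mul_self (fstSum_mul_self (α := Fin m) (β := Fin n))
      rw [Fintype.card_fin] at this
      rwa [Int.cast_natCast]) (by simp)
  have h2 := h1.add (N := (n : ℂ) • 1 - sndSum (Fin m) (Fin n)) (q := n)
    (by
      have := sub_mul_self_of_mul_self (sndSum_mul_self (α := Fin m) (β := Fin n))
      rw [Fintype.card_fin] at this
      rwa [Int.cast_natCast]) (by
      apply LinearMap.ext
      intro f
      funext x
      simp [fstSum_apply, sndSum_apply, Module.End.mul_apply]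
      rw [Finset.sum_comm]
      ring)
  refine ⟨_, ?_, integerSpectrum_of_intSpec (fun f => ?_) h2⟩
  · refine (IntSpec.card_add _ _).trans ?_
    have := IntSpec.card_add {0} (m : ℤ)
    rw [Finset.card_singleton] at this
    omega
  · funext p
    refine (boxProd_lap_apply (G := (⊤ : SimpleGraph (Fin m))) (H := (⊤ : SimpleGraph (Fin n)))
      (hGH := _) f p).trans ?_
    rw [sum_top_adj (fun a => f (a, p.2)) _ _ rfl, sum_top_adj (fun b => f (p.1, b)) _ _ rfl]
    simp [fstSum_apply, sndSum_apply]

theorem cycle_four_adj (y b : Fin 4) :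
    (SimpleGraph.cycleGraph 4).Adj y b ↔ b = y + 1 ∨ b = y - 1 := by
  revert y b; decide

theorem cycle_four_sum (c : ℂ) (f : Fin 4 → ℂ) (y : Fin 4)
    [DecidableRel (SimpleGraph.cycleGraph 4).Adj] :
    (∑ b, if (SimpleGraph.cycleGraph 4).Adj y b then c - f b else 0) =
      2 * c - f (y + 1) - f (y - 1) := by
  have : ∀ b, (if (SimpleGraph.cycleGraph 4).Adj y b then c - f b else 0) =
      (if b = y + 1 then c - f b else 0) + if b = y - 1 then c - f b else 0 := by
    intro b
    have hne : y + 1 ≠ y - 1 := by revert y; decide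
    by_cases h1 : b = y + 1
    · simp [cycle_four_adj, h1, hne]
    · simp [cycle_four_adj, h1]
  simp only [this, Finset.sum_add_distrib, Finset.sum_ite_eq', Finset.mem_univ, if_true]
  ring

/-- The Laplacian of the four-cycle acting on the second coordinate. -/
noncomputable def cycleFourLap (α : Type) : Module.End ℂ (α × Fin 4 → ℂ) :=
  (2 : ℂ) • 1 - LinearMap.funLeft ℂ ℂ (fun p => (p.1, p.2 + 1)) -
    LinearMap.funLeft ℂ ℂ (fun p => (p.1, p.2 - 1))

omit [Fintype α] [DecidableEq α] in
theorem cycleFourLap_apply (f : α × Fin 4 → ℂ) (p : α × Fin 4) :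
    cycleFourLap α f p = 2 * f p - f (p.1, p.2 + 1) - f (p.1, p.2 - 1) := by
  simp [cycleFourLap, LinearMap.funLeft]

-- Combining the eigenvalue equations at opposite points of the square gives (μ - 2)(f(y) - f(y+2))
-- = 0, and all four give μ(μ - 4)(f(y) + f(y+2)) = 0. For any other μ both combinations vanish,
-- hence f does.
omit [Fintype α] [DecidableEq α] in
theorem cycleFourLap_intSpec : IntSpec (cycleFourLap α) {0, 2, 4} := by
  intro μ f hf h
  by_contra hcon
  have h0 : μ ≠ 0 := fun e => hcon ⟨0, by simp, by simp [e]⟩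
  have h2 : μ - 2 ≠ 0 := fun e => hcon ⟨2, by simp, by push_cast; linear_combination e⟩
  have h4 : μ - 4 ≠ 0 := fun e => hcon ⟨4, by simp, by push_cast; linear_combination e⟩
  apply hf
  funext ⟨a, y⟩
  have key : ∀ y : Fin 4, 2 * f (a, y) - f (a, y + 1) - f (a, y - 1) = μ * f (a, y) := by
    intro y
    rw [← cycleFourLap_apply f (a, y), h]; rfl
  have e1 : y + 1 - 1 = y := by revert y; decide
  have e2 : y + 1 + 1 = y - 1 - 1 := by revert y; decide
  have e3 : y - 1 + 1 = y := by revert y; decide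
  have e4 : y - 1 - 1 + 1 = y - 1 := by revert y; decide
  have e5 : y - 1 - 1 - 1 = y + 1 := by revert y; decide
  have k0 := key y
  have k1 := key (y + 1)
  have k2 := key (y - 1 - 1)
  have k3 := key (y - 1)
  rw [e1, e2] at k1
  rw [e4, e5] at k2
  rw [e3] at k3
  have hd : (μ - 2) * (f (a, y) - f (a, y - 1 - 1)) = 0 := by linear_combination k2 - k0
  have hs : (μ * (μ - 4)) * (f (a, y) + f (a, y - 1 - 1)) = 0 := by
    linear_combination (2 - μ) * (k0 + k2) + 2 * (k1 + k3)
  have hd' := (mul_eq_zero.1 hd).resolve_left h2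
  have hs' := (mul_eq_zero.1 hs).resolve_left (mul_ne_zero h0 h4)
  change f (a, y) = 0
  linear_combination (hd' + hs') / 2

theorem completeSquare_spectrum (n : ℕ) :
    ∃ Λ : Finset ℤ, Λ.card ≤ 6 ∧ IntegerSpectrum ((completeSquareGraph n).lapMatrix ℂ) Λ := by
  have h2 := (cycleFourLap_intSpec (α := Fin n)).add
    (N := (n : ℂ) • 1 - fstSum (Fin n) (Fin 4)) (q := n)
    (by
      have := sub_mul_self_of_mul_self (fstSum_mul_self (α := Fin n) (β := Fin 4))
      rw [Fintype.card_fin] at this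
      rwa [Int.cast_natCast]) (by
      apply LinearMap.ext
      intro f
      funext x
      simp [fstSum_apply, cycleFourLap_apply, Module.End.mul_apply, Finset.sum_sub_distrib,
        ← Finset.mul_sum]
      ring)
  refine ⟨_, (IntSpec.card_add _ _).trans (by decide), integerSpectrum_of_intSpec (fun f => ?_) h2⟩
  funext p
  refine (boxProd_lap_apply (G := (⊤ : SimpleGraph (Fin n))) (H := SimpleGraph.cycleGraph 4)
    (hGH := _) f p).trans ?_
  rw [sum_top_adj (fun a => f (a, p.2)) _ _ rfl, cycle_four_sum _ (fun b => f (p.1, b))]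
  simp [fstSum_apply, cycleFourLap_apply]
  ring

theorem completeSquare_connected {n : ℕ} (hn : 1 ≤ n) : (completeSquareGraph n).Connected := by
  have : Nonempty (Fin n) := ⟨⟨0, hn⟩⟩
  exact SimpleGraph.connected_top.boxProd SimpleGraph.cycleGraph_connected

theorem completeSquare_vertexTransitive {n : ℕ} : VertexTransitive (completeSquareGraph n) := by
  refine vertexTransitive_top.boxProd fun m m' => ⟨Equiv.addRight (m' - m), by simp, fun u v => ?_⟩
  simp only [cycle_four_adj, Equiv.coe_addRight]
  revert u v m m'; decide

theorem rook_vertexTransitive {m n : ℕ} : VertexTransitive (rookGraph m n) :=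
  vertexTransitive_top.boxProd vertexTransitive_top

theorem rook_connected {m n : ℕ} (hm : 1 ≤ m) (hn : 1 ≤ n) : (rookGraph m n).Connected := by
  have : Nonempty (Fin m) := ⟨⟨0, hm⟩⟩
  have : Nonempty (Fin n) := ⟨⟨0, hn⟩⟩
  exact SimpleGraph.connected_top.boxProd SimpleGraph.connected_top

end BoxProduct
end AlternatingWalk

namespace AlternatingWalk

open Matrix

/-! ### Inclusion matrices of homogeneous modular lattices. -/

section Ranked

variable {P : Type} [Lattice P]

/-- A modular rank function on a homogeneous lattice. -/
structure IsHomogeneousRank (r : P → ℕ) : Prop where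
  strict : StrictMono r
  modular : ∀ a b, r (a ⊔ b) + r (a ⊓ b) = r a + r b
  cover : ∀ a b, a < b → ∃ c, a < c ∧ c ≤ b ∧ r c = r a + 1
  homog : ∀ a b, r a = r b → ∃ φ : P ≃o P, (∀ x, r (φ x) = r x) ∧ φ a = b

/-- The elements of rank `j`. -/
abbrev Level (r : P → ℕ) (j : ℕ) : Type := {a : P // r a = j}

variable {r : P → ℕ}

theorem IsHomogeneousRank.inf_lt (hr : IsHomogeneousRank r) {j : ℕ} {a b : Level r j}
    (h : a ≠ b) : r (a.1 ⊓ b.1) < j := by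
  have hle : a.1 ⊓ b.1 ≤ a.1 := inf_le_left
  rcases hle.lt_or_eq with h1 | h1
  · simpa [a.2] using hr.strict h1
  · have hab : a.1 ≤ b.1 := inf_eq_left.1 h1
    rcases hab.lt_or_eq with h2 | h2
    · have := hr.strict h2
      rw [a.2, b.2] at this
      exact absurd this (lt_irrefl _)
    · exact absurd (Subtype.ext h2) h

theorem IsHomogeneousRank.eq_of_le (hr : IsHomogeneousRank r) {a b : P} (h : a ≤ b)
    (h' : r b ≤ r a) : a = b := by
  rcases h.lt_or_eq with h1 | h1
  · exact absurd (hr.strict h1) (by omega)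
  · exact h1

theorem IsHomogeneousRank.exists_between (hr : IsHomogeneousRank r) {a b : P} (h : a ≤ b) {i : ℕ}
    (h1 : r a ≤ i) (h2 : i ≤ r b) : ∃ c, a ≤ c ∧ c ≤ b ∧ r c = i := by
  induction i, h1 using Nat.le_induction with
  | base => exact ⟨a, le_rfl, h, rfl⟩
  | succ i _ ih =>
    obtain ⟨c, hc1, hc2, hc3⟩ := ih (by omega)
    have hlt : c < b := lt_of_le_of_ne hc2 (by rintro rfl; omega)
    obtain ⟨e, he1, he2, he3⟩ := hr.cover c b hlt
    exact ⟨e, hc1.trans he1.le, he2, by omega⟩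

theorem IsHomogeneousRank.perm (hr : IsHomogeneousRank r) {j : ℕ} (a b : Level r j) :
    ∃ φ : P ≃o P, ∃ σ : ∀ i, Equiv.Perm (Level r i), (∀ i x, (σ i x).1 = φ x.1) ∧ σ j a = b := by
  obtain ⟨φ, h1, h2⟩ := hr.homog a.1 b.1 (by rw [a.2, b.2])
  refine ⟨φ, fun i => φ.toEquiv.subtypeEquiv fun x => ?_, fun i x => rfl, Subtype.ext h2⟩
  change _ ↔ r (φ x) = i
  rw [h1]

variable [∀ j, Fintype (Level r j)] [∀ j, DecidableEq (Level r j)]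

open Classical in
/-- The inclusion matrix of the elements of rank `i` and those of rank `j`. -/
noncomputable def inc (r : P → ℕ) (i j : ℕ) : Matrix (Level r i) (Level r j) ℂ :=
  Matrix.of fun a b => if a.1 ≤ b.1 then 1 else 0

omit [∀ j, Fintype (Level r j)] [∀ j, DecidableEq (Level r j)] in
open Classical in
theorem inc_apply (i j : ℕ) (a : Level r i) (b : Level r j) :
    inc r i j a b = if a.1 ≤ b.1 then 1 else 0 := by
  simp [inc]

omit [∀ j, DecidableEq (Level r j)] in
open Classical in
theorem inc_mul_transpose_apply (i j : ℕ) (a b : Level r i) :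
    (inc r i j * (inc r i j)ᵀ) a b = ∑ c : Level r j, if a.1 ⊔ b.1 ≤ c.1 then 1 else 0 := by
  rw [Matrix.mul_apply]
  refine Finset.sum_congr rfl fun c _ => ?_
  rw [Matrix.transpose_apply, inc_apply, inc_apply]
  by_cases h1 : a.1 ≤ c.1 <;> by_cases h2 : b.1 ≤ c.1 <;> simp [h1, h2]

omit [∀ j, DecidableEq (Level r j)] in
open Classical in
theorem transpose_mul_inc_apply (i j : ℕ) (a b : Level r j) :
    ((inc r i j)ᵀ * inc r i j) a b = ∑ c : Level r i, if c.1 ≤ a.1 ⊓ b.1 then 1 else 0 := by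
  rw [Matrix.mul_apply]
  refine Finset.sum_congr rfl fun c _ => ?_
  rw [Matrix.transpose_apply, inc_apply, inc_apply]
  by_cases h1 : c.1 ≤ a.1 <;> by_cases h2 : c.1 ≤ b.1 <;> simp [h1, h2]

omit [∀ j, DecidableEq (Level r j)] in
open Classical in
theorem sum_level_above (hr : IsHomogeneousRank r) (i : ℕ) (s : P) (h : i ≤ r s) :
    (∑ c : Level r i, if s ≤ c.1 then (1 : ℂ) else 0) = if r s = i then 1 else 0 := by
  split_ifs with h1
  · have : ∀ c : Level r i, (s ≤ c.1) ↔ c = ⟨s, h1⟩ := fun c =>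
      ⟨fun hc => Subtype.ext (hr.eq_of_le hc (by rw [c.2, h1])).symm, fun hc => by rw [hc]⟩
    simp [this]
  · refine Finset.sum_eq_zero fun c _ => if_neg fun hc => ?_
    have := hr.strict.monotone hc
    rw [c.2] at this
    omega

omit [∀ j, DecidableEq (Level r j)] in
open Classical in
theorem sum_level_below (hr : IsHomogeneousRank r) (i : ℕ) (s : P) (h : r s ≤ i) :
    (∑ c : Level r i, if c.1 ≤ s then (1 : ℂ) else 0) = if r s = i then 1 else 0 := by
  split_ifs with h1
  · have : ∀ c : Level r i, (c.1 ≤ s) ↔ c = ⟨s, h1⟩ := fun c =>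
      ⟨fun hc => Subtype.ext (hr.eq_of_le hc (by rw [c.2, h1])), fun hc => by rw [hc]⟩
    simp [this]
  · refine Finset.sum_eq_zero fun c _ => if_neg fun hc => ?_
    have := hr.strict.monotone hc
    rw [c.2] at this
    omega

-- Rank-preserving automorphisms act transitively on each level, so the number of elements of rank j
-- above an element of rank i is the same for all of them.
omit [∀ j, DecidableEq (Level r j)] in
open Classical in
theorem inc_mul_transpose_diag (hr : IsHomogeneousRank r) (i j : ℕ) :
    ∃ u : ℕ, ∀ a : Level r i, (inc r i j * (inc r i j)ᵀ) a a = u := by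
  rcases isEmpty_or_nonempty (Level r i) with h | ⟨⟨a₀⟩⟩
  · exact ⟨0, fun a => h.elim a⟩
  refine ⟨∑ c : Level r j, if a₀.1 ≤ c.1 then 1 else 0, fun a => ?_⟩
  obtain ⟨φ, σ, hσ, hσa⟩ := hr.perm a₀ a
  rw [inc_mul_transpose_apply, sup_idem]
  push_cast
  rw [← Equiv.sum_comp (σ j)]
  refine Finset.sum_congr rfl fun c _ => ?_
  rw [hσ, ← hσa, hσ, φ.le_iff_le]

omit [∀ j, DecidableEq (Level r j)] in
open Classical in
theorem transpose_mul_inc_diag (hr : IsHomogeneousRank r) (i j : ℕ) :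
    ∃ u : ℕ, ∀ a : Level r j, ((inc r i j)ᵀ * inc r i j) a a = u := by
  rcases isEmpty_or_nonempty (Level r j) with h | ⟨⟨a₀⟩⟩
  · exact ⟨0, fun a => h.elim a⟩
  refine ⟨∑ c : Level r i, if c.1 ≤ a₀.1 then 1 else 0, fun a => ?_⟩
  obtain ⟨φ, σ, hσ, hσa⟩ := hr.perm a₀ a
  rw [transpose_mul_inc_apply, inf_idem]
  push_cast
  rw [← Equiv.sum_comp (σ i)]
  refine Finset.sum_congr rfl fun c _ => ?_
  rw [hσ, ← hσa, hσ, φ.le_iff_le]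

omit [∀ j, DecidableEq (Level r j)] in
theorem transpose_mul_inc_off_diag (hr : IsHomogeneousRank r) (j : ℕ) {a b : Level r (j + 1)}
    (h : a ≠ b) : ((inc r j (j + 1))ᵀ * inc r j (j + 1)) a b =
      if r (a.1 ⊓ b.1) = j then 1 else 0 := by
  rw [transpose_mul_inc_apply, sum_level_below hr]
  have := hr.inf_lt h
  omega

-- By modularity the join has rank j + 2 exactly when the meet has rank j, and then the join is the
-- only common upper bound of rank j + 2. Counting above and counting below thus give the same
-- off-diagonal entries.
omit [∀ j, DecidableEq (Level r j)] in
theorem inc_mul_transpose_off_diag (hr : IsHomogeneousRank r) (j : ℕ) {a b : Level r (j + 1)}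
    (h : a ≠ b) : (inc r (j + 1) (j + 2) * (inc r (j + 1) (j + 2))ᵀ) a b =
      if r (a.1 ⊓ b.1) = j then 1 else 0 := by
  have h1 := hr.inf_lt h
  have h2 := hr.modular a.1 b.1
  rw [a.2, b.2] at h2
  rw [inc_mul_transpose_apply, sum_level_above hr _ _ (by omega)]
  congr 1
  apply propext
  omega

/-- The commutation relation of the inclusion matrices between consecutive ranks. -/
theorem inc_commutation (hr : IsHomogeneousRank r) (j : ℕ) :
    ∃ c : ℤ, inc r (j + 1) (j + 2) * (inc r (j + 1) (j + 2))ᵀ =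
      (inc r j (j + 1))ᵀ * inc r j (j + 1) + (c : ℂ) • (1 : Matrix _ _ ℂ) := by
  obtain ⟨u, hu⟩ := inc_mul_transpose_diag hr (j + 1) (j + 2)
  obtain ⟨v, hv⟩ := transpose_mul_inc_diag hr j (j + 1)
  refine ⟨u - v, ?_⟩
  ext a b
  rw [Matrix.add_apply, Matrix.smul_apply]
  rcases eq_or_ne a b with rfl | h
  · rw [hu, hv]; simp
  · rw [inc_mul_transpose_off_diag hr j h, transpose_mul_inc_off_diag hr j h,
      Matrix.one_apply_ne h]
    simp

/-- There is at most one element of rank 0: the meet of two distinct ones would have negative rank.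
-/
theorem inc_zero (hr : IsHomogeneousRank r) :
    ∃ c : ℤ, inc r 0 1 * (inc r 0 1)ᵀ = (c : ℂ) • (1 : Matrix _ _ ℂ) := by
  obtain ⟨u, hu⟩ := inc_mul_transpose_diag hr 0 1
  refine ⟨u, ?_⟩
  ext a b
  have hab : a = b := by
    by_contra h
    exact absurd (hr.inf_lt h) (by omega)
  subst hab
  rw [hu]; simp

-- W maps eigenvectors of WᵀW with nonzero eigenvalue to eigenvectors of WWᵀ with the same
-- eigenvalue.
omit [∀ j, DecidableEq (Level r j)] in
theorem IntegerSpectrum.swap_mul {α β : Type} [Fintype α] [Fintype β] {W : Matrix α β ℂ}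
    {Λ : Finset ℤ} (h : IntegerSpectrum (W * Wᵀ) Λ) : IntegerSpectrum (Wᵀ * W) (insert 0 Λ) := by
  intro μ f hf hμ
  by_cases h0 : μ = 0
  · exact ⟨0, by simp, by simp [h0]⟩
  have hWf : W *ᵥ f ≠ 0 := by
    intro hz
    rw [← Matrix.mulVec_mulVec, hz, Matrix.mulVec_zero] at hμ
    exact (smul_ne_zero h0 hf) hμ.symm
  obtain ⟨l, hl, e⟩ := h μ _ hWf (by
    rw [Matrix.mulVec_mulVec, Matrix.mul_assoc, ← Matrix.mulVec_mulVec, hμ, Matrix.mulVec_smul])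
  exact ⟨l, Finset.mem_insert_of_mem hl, e⟩

theorem IntegerSpectrum.add_smul_one {α : Type} [Fintype α] [DecidableEq α] {M : Matrix α α ℂ}
    {Λ : Finset ℤ} (h : IntegerSpectrum M Λ) (c : ℤ) :
    IntegerSpectrum (M + (c : ℂ) • 1) (Λ.image fun l => l + c) := by
  intro μ f hf hμ
  rw [Matrix.add_mulVec, Matrix.smul_mulVec, Matrix.one_mulVec] at hμ
  obtain ⟨l, hl, e⟩ := h (μ - c) f hf (by rw [sub_smul, ← hμ, add_sub_cancel_right])
  exact ⟨l + c, Finset.mem_image_of_mem _ hl, by push_cast; linear_combination e⟩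

theorem IntegerSpectrum.smul_one_sub {α : Type} [Fintype α] [DecidableEq α] {M : Matrix α α ℂ}
    {Λ : Finset ℤ} (h : IntegerSpectrum M Λ) (c : ℤ) :
    IntegerSpectrum ((c : ℂ) • 1 - M) (Λ.image fun l => c - l) := by
  intro μ f hf hμ
  rw [Matrix.sub_mulVec, Matrix.smul_mulVec, Matrix.one_mulVec] at hμ
  obtain ⟨l, hl, e⟩ := h (c - μ) f hf (by rw [sub_smul, ← hμ, sub_sub_cancel])
  exact ⟨c - l, Finset.mem_image_of_mem _ hl, by push_cast; linear_combination -e⟩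

theorem integerSpectrum_smul_one {α : Type} [Fintype α] [DecidableEq α] (c : ℤ) :
    IntegerSpectrum ((c : ℂ) • (1 : Matrix α α ℂ)) {c} := by
  intro μ f hf hμ
  rw [Matrix.smul_mulVec, Matrix.one_mulVec] at hμ
  have : ((c : ℂ) - μ) • f = 0 := by rw [sub_smul, hμ, sub_self]
  refine ⟨c, by simp, ?_⟩
  rcases smul_eq_zero.1 this with h | h
  · linear_combination -h
  · exact absurd h hf

/-- One rung of the ladder passes from WᵀW at level j to WWᵀ at level j + 1 by an integer shift,
then swaps the factors, which adds at most the eigenvalue 0. -/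
theorem inc_spectrum (hr : IsHomogeneousRank r) (j : ℕ) :
    ∃ Λ : Finset ℤ, Λ.card ≤ j + 2 ∧ IntegerSpectrum ((inc r j (j + 1))ᵀ * inc r j (j + 1)) Λ := by
  induction j with
  | zero =>
    obtain ⟨c, hc⟩ := inc_zero hr
    refine ⟨insert 0 {c}, Finset.card_insert_le _ _, IntegerSpectrum.swap_mul ?_⟩
    rw [hc]
    exact integerSpectrum_smul_one c
  | succ j ih =>
    obtain ⟨Λ, h1, h2⟩ := ih
    obtain ⟨c, hc⟩ := inc_commutation hr j
    refine ⟨insert 0 (Λ.image fun l => l + c), ?_, IntegerSpectrum.swap_mul ?_⟩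
    · have := Finset.card_insert_le 0 (Λ.image fun l => l + c)
      have := Finset.card_image_le (s := Λ) (f := fun l => l + c)
      omega
    · rw [hc]
      exact h2.add_smul_one c

/-- Laplacian spectra of vertex-transitive graphs come from those of the adjacency matrices. -/
theorem lap_spectrum_of_adj {V : Type} [Fintype V] [DecidableEq V] {G : SimpleGraph V}
    [DecidableRel G.Adj] (htrans : VertexTransitive G) {Λ : Finset ℤ} {K : ℕ} (hK : Λ.card ≤ K)
    (h : IntegerSpectrum (G.adjMatrix ℂ) Λ) :
    ∃ Λ' : Finset ℤ, Λ'.card ≤ K ∧ IntegerSpectrum (G.lapMatrix ℂ) Λ' := by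
  rcases isEmpty_or_nonempty V with hV | ⟨⟨v₀⟩⟩
  · exact ⟨∅, by simp, fun μ f hf => absurd (Subsingleton.elim f 0) hf⟩
  have hL : G.lapMatrix ℂ = (((G.degree v₀ : ℕ) : ℤ) : ℂ) • 1 - G.adjMatrix ℂ := by
    rw [SimpleGraph.lapMatrix]
    congr 1
    ext u v
    obtain ⟨σ, h1, h2⟩ := htrans v₀ u
    have e : G.degree u = G.degree v₀ := by
      rw [← h1]
      exact SimpleGraph.Iso.degree_eq (⟨σ, h2 _ _⟩ : G ≃g G) v₀
    rw [SimpleGraph.degMatrix, Matrix.diagonal_apply, Matrix.smul_apply, Matrix.one_apply, e]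
    simp
  rw [hL]
  exact ⟨_, Finset.card_image_le.trans hK, h.smul_one_sub _⟩

section Graph

variable {j : ℕ} {G : SimpleGraph (Level r (j + 1))} [DecidableRel G.Adj]

omit [∀ j, Fintype (Level r j)] [∀ j, DecidableEq (Level r j)] [DecidableRel G.Adj] in
theorem ranked_vertexTransitive (hr : IsHomogeneousRank r)
    (hG : ∀ a b, G.Adj a b ↔ r (a.1 ⊓ b.1) + 1 = j + 1) : VertexTransitive G := by
  intro a b
  obtain ⟨φ, h1, h2⟩ := hr.homog a.1 b.1 (by rw [a.2, b.2])
  refine ⟨φ.toEquiv.subtypeEquiv fun x => ?_, Subtype.ext h2, fun u v => ?_⟩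
  · change _ ↔ r (φ x) = _
    rw [h1]
  · rw [hG, hG]
    change r (φ u.1 ⊓ φ v.1) + 1 = j + 1 ↔ _
    rw [← φ.map_inf, h1]

-- From a one steps towards b: take e of rank j between a ⊓ b and a, and g covering a ⊓ b below b.
-- Then e ⊓ g = a ⊓ b, so by modularity e ⊔ g has rank j + 1. It is adjacent to a, and its meet with
-- b contains g, so has larger rank than a ⊓ b.
omit [∀ j, Fintype (Level r j)] [∀ j, DecidableEq (Level r j)] [DecidableRel G.Adj] in
theorem ranked_connected (hr : IsHomogeneousRank r) [Nonempty (Level r (j + 1))]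
    (hG : ∀ a b, G.Adj a b ↔ r (a.1 ⊓ b.1) + 1 = j + 1) : G.Connected := by
  have key : ∀ m : ℕ, ∀ a b : Level r (j + 1), j + 1 - r (a.1 ⊓ b.1) ≤ m → G.Reachable a b := by
    intro m
    induction m with
    | zero =>
      intro a b h
      by_cases hab : a = b
      · rw [hab]
      · have := hr.inf_lt hab
        omega
    | succ m ih =>
      intro a b h
      by_cases hab : a = b
      · rw [hab]
      have hlt := hr.inf_lt hab
      obtain ⟨e, he1, he2, he3⟩ := hr.exists_between (a := a.1 ⊓ b.1) (b := a.1) inf_le_left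
        (i := j) (by omega) (by rw [a.2]; omega)
      have hltb : a.1 ⊓ b.1 < b.1 := lt_of_le_of_ne inf_le_right (by
        intro h'; rw [h', b.2] at hlt; omega)
      obtain ⟨g, hg1, hg2, hg3⟩ := hr.cover _ _ hltb
      have hinf : e ⊓ g = a.1 ⊓ b.1 :=
        le_antisymm (inf_le_inf he2 hg2) (le_inf he1 hg1.le)
      have hc := hr.modular e g
      rw [hinf] at hc
      let c : Level r (j + 1) := ⟨e ⊔ g, by omega⟩
      have hac : a ≠ c := by
        intro h'
        have : g ≤ a.1 := by rw [h']; exact le_sup_right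
        exact absurd (le_inf this hg2) (not_le_of_gt hg1)
      have h1 := hr.inf_lt hac
      have h2 : j ≤ r (a.1 ⊓ c.1) := by
        exact he3.symm.le.trans (hr.strict.monotone (le_inf he2 le_sup_left))
      have h3 : r g ≤ r (c.1 ⊓ b.1) := hr.strict.monotone (le_inf le_sup_right hg2)
      have hadj : G.Adj a c := by rw [hG]; omega
      exact hadj.reachable.trans (ih c b (by omega))
  exact ⟨fun a b => key _ a b le_rfl⟩

theorem ranked_solvesAll (hr : IsHomogeneousRank r) [Nonempty (Level r (j + 1))]
    (hG : ∀ a b, G.Adj a b ↔ r (a.1 ⊓ b.1) + 1 = j + 1) :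
    SolvesAll G (8 * Real.pi * coreConst (j + 2)) := by
  have htrans := ranked_vertexTransitive hr hG
  obtain ⟨Λ, h1, h2⟩ := inc_spectrum hr j
  obtain ⟨v, hv⟩ := transpose_mul_inc_diag hr j (j + 1)
  have hA : G.adjMatrix ℂ = (inc r j (j + 1))ᵀ * inc r j (j + 1) + ((-v : ℤ) : ℂ) • 1 := by
    ext a b
    rw [Matrix.add_apply, Matrix.smul_apply, SimpleGraph.adjMatrix_apply]
    rcases eq_or_ne a b with rfl | h
    · rw [hv]; simp
    · rw [transpose_mul_inc_off_diag hr j h, Matrix.one_apply_ne h]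
      simp [hG]
  have h3 := h2.add_smul_one (-v)
  rw [← hA] at h3
  obtain ⟨Λ', h4, h5⟩ := lap_spectrum_of_adj htrans (Finset.card_image_le.trans h1) h3
  exact solvesAll_of_spectrum (ranked_connected hr hG) htrans h4 h5

end Graph

end Ranked

/-! ### Johnson and Grassmann graphs. -/

section Instances

theorem exists_perm_map_finset {n : ℕ} (a b : Finset (Fin n)) (h : a.card = b.card) :
    ∃ σ : Equiv.Perm (Fin n), a.map σ.toEmbedding = b := by
  obtain ⟨e⟩ : Nonempty ({x // x ∈ a} ≃ {x // x ∈ b}) :=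
    ⟨Fintype.equivOfCardEq (by simpa using h)⟩
  refine ⟨e.extendSubtype, ?_⟩
  apply Finset.eq_of_subset_of_card_le
  · intro y hy
    obtain ⟨x, hx, rfl⟩ := Finset.mem_map.1 hy
    exact e.extendSubtype_mem x hx
  · simp [h]

theorem isHomogeneousRank_card (n : ℕ) :
    IsHomogeneousRank (Finset.card : Finset (Fin n) → ℕ) where
  strict _ _ h := Finset.card_lt_card h
  modular a b := Finset.card_union_add_card_inter a b
  cover a b h := by
    obtain ⟨x, hx, hxa⟩ := Finset.exists_of_ssubset h
    exact ⟨insert x a, Finset.ssubset_insert hxa, Finset.insert_subset hx h.subset,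
      Finset.card_insert_of_notMem hxa⟩
  homog a b h := by
    obtain ⟨σ, hσ⟩ := exists_perm_map_finset a b h
    refine ⟨⟨σ.finsetCongr, ?_⟩, fun x => ?_, ?_⟩
    · intro x y
      simp
    · change (x.map _).card = _
      simp
    · exact hσ

theorem exists_equiv_map_submodule {F : Type} [Field F] {n : ℕ} (A B : Submodule F (Fin n → F))
    (h : Module.finrank F A = Module.finrank F B) :
    ∃ e : (Fin n → F) ≃ₗ[F] (Fin n → F), A.map (e : (Fin n → F) →ₗ[F] (Fin n → F)) = B := by
  obtain ⟨A', hA⟩ := A.exists_isCompl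
  obtain ⟨B', hB⟩ := B.exists_isCompl
  have h' : Module.finrank F A' = Module.finrank F B' := by
    have h1 := Submodule.finrank_add_eq_of_isCompl hA
    have h2 := Submodule.finrank_add_eq_of_isCompl hB
    omega
  let e1 := LinearEquiv.ofFinrankEq A B h
  let e2 := LinearEquiv.ofFinrankEq A' B' h'
  let e := (Submodule.prodEquivOfIsCompl A A' hA).symm ≪≫ₗ (e1.prodCongr e2) ≪≫ₗ
    Submodule.prodEquivOfIsCompl B B' hB
  refine ⟨e, ?_⟩
  have hle : A.map (e : (Fin n → F) →ₗ[F] (Fin n → F)) ≤ B := by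
    rintro _ ⟨x, hx, rfl⟩
    have : e x = e1 (⟨x, hx⟩ : A) := by
      have hs : (Submodule.prodEquivOfIsCompl A A' hA).symm x = ((⟨x, hx⟩ : A), 0) :=
        Submodule.prodEquivOfIsCompl_symm_apply_left A A' hA (⟨x, hx⟩ : A)
      simp [e, hs]
    change e x ∈ B
    rw [this]
    exact (e1 ⟨x, hx⟩).2
  apply Submodule.eq_of_le_of_finrank_eq hle
  rw [LinearEquiv.finrank_map_eq, h]

theorem isHomogeneousRank_finrank (F : Type) [Field F] (n : ℕ) :
    IsHomogeneousRank fun W : Submodule F (Fin n → F) => Module.finrank F W where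
  strict _ _ h := Submodule.finrank_lt_finrank_of_lt h
  modular a b := Submodule.finrank_sup_add_finrank_inf_eq a b
  cover a b h := by
    obtain ⟨x, hx, hxa⟩ := SetLike.exists_of_lt h
    have hx0 : x ≠ 0 := fun h' => hxa (h' ▸ a.zero_mem)
    have hlt : a < a ⊔ Submodule.span F {x} := by
      refine lt_of_le_of_ne le_sup_left fun h' => hxa ?_
      rw [h']
      exact Submodule.mem_sup_right (Submodule.mem_span_singleton_self x)
    refine ⟨a ⊔ Submodule.span F {x}, hlt, sup_le h.le ?_, ?_⟩
    · rw [Submodule.span_le, Set.singleton_subset_iff]; exact hx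
    · have h1 := Submodule.finrank_lt_finrank_of_lt hlt
      have h2 := Submodule.finrank_add_le_finrank_add_finrank a (Submodule.span F {x})
      have h3 := finrank_span_singleton (K := F) hx0
      omega
  homog a b h := by
    obtain ⟨e, he⟩ := exists_equiv_map_submodule a b h
    exact ⟨Submodule.orderIsoMapComap e, fun x => LinearEquiv.finrank_map_eq e x, he⟩

theorem johnson_solvesAll {n k : ℕ} (hk : 1 ≤ k) (hkn : k ≤ n) :
    SolvesAll (johnsonGraph n k) (8 * Real.pi * coreConst (k + 1)) := by
  obtain ⟨j, rfl⟩ : ∃ j, k = j + 1 := ⟨k - 1, by omega⟩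
  obtain ⟨s, _, hs⟩ := Finset.exists_subset_card_eq (s := (Finset.univ : Finset (Fin n)))
    (n := j + 1) (by simpa using hkn)
  have : Nonempty (Level (Finset.card : Finset (Fin n) → ℕ) (j + 1)) := ⟨⟨s, hs⟩⟩
  exact ranked_solvesAll (isHomogeneousRank_card n) fun a b => Iff.rfl

theorem grassmann_solvesAll (F : Type) [Field F] [Fintype F] {n k : ℕ} (hk : 1 ≤ k)
    (hkn : k ≤ n) : SolvesAll (grassmannGraph F n k) (8 * Real.pi * coreConst (k + 1)) := by
  obtain ⟨j, rfl⟩ : ∃ j, k = j + 1 := ⟨k - 1, by omega⟩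
  have hr := isHomogeneousRank_finrank F n
  obtain ⟨W, _, _, hW⟩ := hr.exists_between (a := ⊥) (b := ⊤) bot_le (i := j + 1) (by simp)
    (by simpa using hkn)
  have : Nonempty (Level (fun W : Submodule F (Fin n → F) => Module.finrank F W) (j + 1)) :=
    ⟨⟨W, hW⟩⟩
  exact ranked_solvesAll hr fun a b => Iff.rfl

end Instances
end AlternatingWalk

namespace AlternatingWalk

open Matrix Polynomial

/-! ### Kneser graphs, through rational polynomials in an inclusion matrix. -/

theorem exists_eigenvector_of_mem_spectrum {V : Type} [Fintype V] [DecidableEq V]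
    {M : Matrix V V ℂ} {μ : ℂ} : μ ∈ spectrum ℂ M ↔ ∃ f : V → ℂ, f ≠ 0 ∧ M *ᵥ f = μ • f := by
  rw [← Matrix.spectrum_toLin', ← Module.End.hasEigenvalue_iff_mem_spectrum]
  constructor
  · intro h
    obtain ⟨f, hf⟩ := h.exists_hasEigenvector
    exact ⟨f, hf.2, by simpa using hf.apply_eq_smul⟩
  · rintro ⟨f, hf, h⟩
    exact Module.End.hasEigenvalue_of_hasEigenvector (x := f)
      ⟨Module.End.mem_eigenspace_iff.2 (by simpa using h), hf⟩

theorem isIntegral_of_mem_spectrum {V : Type} [Fintype V] [DecidableEq V] (M : Matrix V V ℤ)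
    {μ : ℂ} (h : μ ∈ spectrum ℂ (M.map (Int.cast : ℤ → ℂ))) : IsIntegral ℤ μ := by
  obtain ⟨q, hq, hq'⟩ := M.isIntegral.map (Int.castRingHom ℂ).mapMatrix.toIntAlgHom
  refine ⟨q, hq, ?_⟩
  obtain ⟨f, hf, hμ⟩ := exists_eigenvector_of_mem_spectrum.1 h
  set N : Matrix V V ℂ := M.map (Int.cast : ℤ → ℂ)
  have hev : Module.End.HasEigenvector (Matrix.toLin' N) μ f :=
    ⟨Module.End.mem_eigenspace_iff.2 (by simpa using hμ), hf⟩
  have h1 := Module.End.aeval_apply_of_hasEigenvector (p := q.map (Int.castRingHom ℂ)) hev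
  have h2 : aeval (Matrix.toLin' N) (q.map (Int.castRingHom ℂ)) = 0 := by
    have h3 : aeval N q = 0 := hq'
    have h4 : aeval (Matrix.toLinAlgEquiv' N) (q.map (Int.castRingHom ℂ)) = 0 := by
      rw [← algebraMap_int_eq, aeval_map_algebraMap]
      have := aeval_algHom_apply
        ((Matrix.toLinAlgEquiv' : Matrix V V ℂ ≃ₐ[ℂ] _).toRingEquiv.toRingHom.toIntAlgHom) N q
      rw [h3, map_zero] at this
      exact this
    exact h4
  rw [h2, LinearMap.zero_apply] at h1
  rcases smul_eq_zero.1 h1.symm with h3 | h3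
  · rwa [eval_map] at h3
  · exact absurd h3 hf

/-- An integer matrix which is a rational polynomial in a matrix with integer spectrum has integer
spectrum. -/
theorem IntegerSpectrum.of_mem_adjoin {V : Type} [Fintype V] [DecidableEq V] {T : Matrix V V ℂ}
    {Λ : Finset ℤ} (hT : IntegerSpectrum T Λ) (M : Matrix V V ℤ)
    (hM : M.map (Int.cast : ℤ → ℂ) ∈ Algebra.adjoin ℚ {T}) :
    ∃ Λ' : Finset ℤ, Λ'.card ≤ Λ.card ∧ IntegerSpectrum (M.map (Int.cast : ℤ → ℂ)) Λ' := by
  rw [Algebra.adjoin_singleton_eq_range_aeval] at hM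
  obtain ⟨p, hp⟩ := hM
  change aeval T p = _ at hp
  -- By spectral mapping each eigenvalue is a rational p(l), and it is an algebraic integer because
  -- `M` is integral. So p(l) is an integer and the floor merely names it; for values l that are not
  -- eigenvalues of `T` the floor is a harmless extra element.
  refine ⟨Λ.image fun l : ℤ => ⌊p.eval (l : ℚ)⌋, Finset.card_image_le, fun μ f hf hμ => ?_⟩
  have hs : μ ∈ spectrum ℂ (M.map (Int.cast : ℤ → ℂ)) :=
    exists_eigenvector_of_mem_spectrum.2 ⟨f, hf, hμ⟩
  have hint := isIntegral_of_mem_spectrum M hs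
  have : Nonempty V := by
    by_contra h
    rw [not_nonempty_iff] at h
    exact hf (Subsingleton.elim _ _)
  rw [← hp, ← aeval_map_algebraMap ℂ, spectrum.map_polynomial_aeval_of_nonempty _ _
    (spectrum.nonempty_of_isAlgClosed_of_finiteDimensional ℂ T)] at hs
  obtain ⟨z, hz, rfl⟩ := hs
  obtain ⟨g, hg, hgz⟩ := exists_eigenvector_of_mem_spectrum.1 hz
  obtain ⟨l, hl, rfl⟩ := hT z g hg hgz
  have he : (p.map (algebraMap ℚ ℂ)).eval (l : ℂ) = algebraMap ℚ ℂ (p.eval (l : ℚ)) := by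
    rw [← Polynomial.eval_map_apply]
    simp
  simp only [he] at hint ⊢
  rw [isIntegral_algebraMap_iff (algebraMap ℚ ℂ).injective] at hint
  obtain ⟨y, hy⟩ := IsIntegrallyClosed.isIntegral_iff.1 hint
  refine ⟨⌊p.eval (l : ℚ)⌋, Finset.mem_image_of_mem _ hl, ?_⟩
  rw [← hy]
  simp

section Inclusion

variable {P : Type} [Lattice P] {r : P → ℕ} [∀ j, Fintype (Level r j)]
  [∀ j, DecidableEq (Level r j)]

/-- Write Wᵢ for the inclusion matrix between levels i and i + 1. In (k-i)·WᵢWᵢᵀ·`inc r i k`,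
`hstep` factors the last matrix through level i + 1, and the commutation relation replaces WᵢᵀWᵢ by
Wᵢ₊₁Wᵢ₊₁ᵀ minus a scalar. The case of i + 1 then applies. -/
theorem inc_intertwine (hr : IsHomogeneousRank r)
    (hstep : ∀ i k, i < k → inc r i (i + 1) * inc r (i + 1) k = ((k - i : ℕ) : ℂ) • inc r i k)
    (m i k : ℕ) (h : i + m + 1 = k) :
    ∃ c : ℤ, inc r i (i + 1) * (inc r i (i + 1))ᵀ * inc r i k =
      inc r i k * ((inc r (k - 1) k)ᵀ * inc r (k - 1) k + (c : ℂ) • (1 : Matrix _ _ ℂ)) := by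
  induction m generalizing i with
  | zero =>
    subst h
    refine ⟨0, ?_⟩
    rw [Int.cast_zero, zero_smul, add_zero, Matrix.mul_assoc]
    simp only [add_zero]
    rfl
  | succ m ih =>
    obtain ⟨c, hc⟩ := ih (i + 1) (by omega)
    obtain ⟨c', hc'⟩ := inc_commutation hr i
    have hs := hstep i k (by omega)
    have hne : ((k - i : ℕ) : ℂ) ≠ 0 := by
      rw [Nat.cast_ne_zero]; omega
    refine ⟨c - c', smul_right_injective _ hne ?_⟩
    change ((k - i : ℕ) : ℂ) • _ = ((k - i : ℕ) : ℂ) • _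
    rw [hc'] at hc
    rw [← Matrix.mul_smul, ← hs, ← Matrix.smul_mul, ← hs, Matrix.mul_assoc _ _ (_ * _),
      ← Matrix.mul_assoc _ _ (inc r (i + 1) k), Matrix.mul_assoc _ (inc r (i + 1) k)]
    congr 1
    rw [Matrix.add_mul, Matrix.smul_mul, Matrix.one_mul] at hc
    rw [eq_sub_of_add_eq hc, Int.cast_sub, sub_smul, Matrix.mul_add, Matrix.mul_add,
      Matrix.mul_sub, Matrix.mul_smul, Matrix.mul_smul, Matrix.mul_one, add_sub_assoc]

/-- By `hstep` and the intertwining relation at i + 1, (k-i)² times the matrix for i equals the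
matrix for i + 1 times (T + integer). Descending from i = k - 1, where the matrix is T itself,
yields polynomials in T; the division is why the coefficients are rational. -/
theorem transpose_mul_inc_mem_adjoin (hr : IsHomogeneousRank r)
    (hstep : ∀ i k, i < k → inc r i (i + 1) * inc r (i + 1) k = ((k - i : ℕ) : ℂ) • inc r i k)
    (m i k : ℕ) (h : i + m + 1 = k) :
    (inc r i k)ᵀ * inc r i k ∈ Algebra.adjoin ℚ {(inc r (k - 1) k)ᵀ * inc r (k - 1) k} := by
  induction m generalizing i with
  | zero =>
    subst h
    exact Algebra.self_mem_adjoin_singleton ℚ _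
  | succ m ih =>
    set T := (inc r (k - 1) k)ᵀ * inc r (k - 1) k
    obtain ⟨c, hc⟩ := inc_intertwine hr hstep m (i + 1) k (by omega)
    obtain ⟨c', hc'⟩ := inc_commutation hr i
    have hs := hstep i k (by omega)
    have hne : ((k - i : ℕ) : ℂ) ≠ 0 := by
      rw [Nat.cast_ne_zero]; omega
    rw [hc', Matrix.add_mul, Matrix.smul_mul, Matrix.one_mul] at hc
    have hc := eq_sub_of_add_eq hc
    have key : (inc r i k)ᵀ * inc r i k = (((k - i : ℕ) : ℚ) ^ 2)⁻¹ •
        ((inc r (i + 1) k)ᵀ * inc r (i + 1) k * (T + algebraMap ℚ _ ((c - c' : ℤ) : ℚ))) := by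
      rw [eq_inv_smul_iff₀ (by exact pow_ne_zero 2 (by exact_mod_cast hne))]
      have e : (((k - i : ℕ) : ℚ) ^ 2) • ((inc r i k)ᵀ * inc r i k) =
          (((k - i : ℕ) : ℂ) • inc r i k)ᵀ * (((k - i : ℕ) : ℂ) • inc r i k) := by
        rw [Matrix.transpose_smul, Matrix.smul_mul, Matrix.mul_smul, smul_smul, ← pow_two,
          ← Nat.cast_pow, ← Nat.cast_pow, Nat.cast_smul_eq_nsmul, Nat.cast_smul_eq_nsmul]
      rw [e, ← hs, Matrix.transpose_mul, Matrix.mul_assoc, ← Matrix.mul_assoc _ _ (inc r (i + 1) k),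
        hc, Matrix.mul_assoc]
      congr 1
      have hcc : algebraMap ℚ (Matrix (Level r k) (Level r k) ℂ) ((c - c' : ℤ) : ℚ) =
          (c : ℂ) • 1 - (c' : ℂ) • 1 := by
        rw [map_intCast, ← sub_smul, ← Int.cast_sub, Int.cast_smul_eq_zsmul, zsmul_one]
      rw [hcc, Matrix.mul_add, Matrix.mul_add, Matrix.mul_sub, Matrix.mul_smul, Matrix.mul_smul,
        Matrix.mul_one, add_sub_assoc]
    rw [key]
    exact Subalgebra.smul_mem _ (mul_mem (ih (i + 1) (by omega)) (add_mem
      (Algebra.self_mem_adjoin_singleton ℚ _) (Subalgebra.algebraMap_mem _ _))) _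

end Inclusion

/-- The cardinality of subsets of an `n`-set, as a rank function. -/
abbrev rankCard (n : ℕ) : Finset (Fin n) → ℕ := Finset.card

theorem sum_ite_eq_card {α β : Type} [Fintype α] {p : α → Prop} {hp : ∀ x, Decidable (p x)}
    {s : Finset β} (f : ∀ b ∈ s, α) (h : ∀ b hb, p (f b hb))
    (hinj : ∀ b hb c hc, f b hb = f c hc → b = c) (hsurj : ∀ a, p a → ∃ b hb, f b hb = a) :
    (∑ x, if p x then (1 : ℂ) else 0) = s.card := by
  refine (Finset.sum_boole _ _).trans (congrArg Nat.cast ?_)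
  symm
  exact Finset.card_bij f (fun b hb => Finset.mem_filter.2 ⟨Finset.mem_univ _, h b hb⟩) hinj
    fun a ha => hsurj a (Finset.mem_filter.1 ha).2

theorem inc_card_mul (n i k : ℕ) :
    inc (rankCard n) i (i + 1) * inc (rankCard n) (i + 1) k =
      ((k - i : ℕ) : ℂ) • inc (rankCard n) i k := by
  ext a b
  have ha : a.1.card = i := a.2
  have hb : b.1.card = k := b.2
  rw [Matrix.mul_apply, Matrix.smul_apply, inc_apply]
  simp only [inc_apply, ← ite_and, mul_ite, mul_one, mul_zero]
  by_cases hab : a.1 ≤ b.1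
  · rw [if_pos hab, smul_eq_mul, mul_one]
    have hcard : (b.1 \ a.1).card = k - i := by
      rw [Finset.card_sdiff_of_subset hab, ha, hb]
    rw [← hcard]
    refine sum_ite_eq_card (fun x hx => ⟨insert x a.1,
      (Finset.card_insert_of_notMem (Finset.mem_sdiff.1 hx).2).trans (by rw [ha])⟩) ?_ ?_ ?_
    · intro x hx
      exact ⟨Finset.insert_subset (Finset.mem_sdiff.1 hx).1 hab, Finset.subset_insert _ _⟩
    · intro x hx y hy hxy
      have h1 := congrArg Subtype.val hxy
      have h2 : x ∈ insert y a.1 := by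
        rw [← show insert x a.1 = insert y a.1 from h1]
        exact Finset.mem_insert_self _ _
      exact (Finset.mem_insert.1 h2).resolve_right (Finset.mem_sdiff.1 hx).2
    · rintro c ⟨hcb, hac⟩
      have hc : c.1.card = i + 1 := c.2
      obtain ⟨x, hx, hxc⟩ := Finset.exists_eq_insert_iff.2
        (⟨hac, by rw [ha, hc]⟩ : a.1 ⊆ c.1 ∧ a.1.card + 1 = c.1.card)
      exact ⟨x, Finset.mem_sdiff.2 ⟨hcb (hxc ▸ Finset.mem_insert_self _ _), hx⟩, Subtype.ext hxc⟩
  · rw [if_neg hab, smul_zero]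
    exact Finset.sum_eq_zero fun c _ => if_neg fun hc => hab (hc.2.trans hc.1)

theorem transpose_mul_inc_card (n i k : ℕ) (a b : Level (rankCard n) k) :
    ((inc (rankCard n) i k)ᵀ * inc (rankCard n) i k) a b =
      ((a.1 ∩ b.1).card.choose i : ℕ) := by
  rw [transpose_mul_inc_apply, ← Finset.card_powersetCard]
  refine sum_ite_eq_card (fun c hc => ⟨c, (Finset.mem_powersetCard.1 hc).2⟩) ?_ ?_ ?_
  · intro c hc
    exact (Finset.mem_powersetCard.1 hc).1
  · intro c _ c' _ h
    exact congrArg Subtype.val h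
  · intro c hc
    exact ⟨c.1, Finset.mem_powersetCard.2 ⟨hc, c.2⟩, rfl⟩

/-- The (a,b) entry of the i-th matrix is the binomial coefficient of |a ∩ b| over i, and the
alternating sum of these detects |a ∩ b| = 0. -/
theorem kneser_adjMatrix {n k : ℕ} (hk : 1 ≤ k) :
    (kneserGraph n k).adjMatrix ℂ = ∑ i ∈ Finset.range (k + 1),
      (-1 : ℚ) ^ i • ((inc (rankCard n) i k)ᵀ * inc (rankCard n) i k) := by
  ext a b
  rw [Matrix.sum_apply]
  simp only [Matrix.smul_apply]
  have hle : (a.1 ∩ b.1).card ≤ k := (Finset.card_le_card Finset.inter_subset_left).trans a.2.le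
  have h1 : ∀ i, ((-1 : ℚ) ^ i • ((inc (rankCard n) i k)ᵀ *
      inc (rankCard n) i k) a b) = (((-1 : ℤ) ^ i * ((a.1 ∩ b.1).card.choose i : ℕ) : ℤ) : ℂ) := by
    intro i
    rw [transpose_mul_inc_card, Rat.smul_def]
    push_cast
    ring
  rw [Finset.sum_congr rfl fun i _ => h1 i, ← Int.cast_sum]
  have h2 : (∑ i ∈ Finset.range (k + 1), (-1 : ℤ) ^ i * ((a.1 ∩ b.1).card.choose i : ℕ)) =
      if (a.1 ∩ b.1).card = 0 then 1 else 0 := by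
    rw [← Int.alternating_sum_range_choose]
    symm
    refine Finset.sum_subset (Finset.range_mono (by omega)) fun i _ hi => ?_
    rw [Nat.choose_eq_zero_of_lt (by simpa using hi)]
    simp
  rw [h2, SimpleGraph.adjMatrix_apply]
  have h3 : (kneserGraph n k).Adj a b ↔ (a.1 ∩ b.1).card = 0 := by
    rw [Finset.card_eq_zero, ← Finset.disjoint_iff_inter_eq_empty]
    refine ⟨fun h => h.2, fun h => ⟨?_, h⟩⟩
    rintro rfl
    rw [Finset.disjoint_self_iff_empty, ← Finset.card_eq_zero, a.2] at h
    omega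
  simp only [h3]
  split_ifs <;> simp

theorem kneser_vertexTransitive (n k : ℕ) : VertexTransitive (kneserGraph n k) := by
  intro a b
  obtain ⟨φ, h1, h2⟩ := (isHomogeneousRank_card n).homog a.1 b.1 (by rw [a.2, b.2])
  refine ⟨φ.toEquiv.subtypeEquiv fun x => ?_, Subtype.ext h2, fun u v => ?_⟩
  · change _ ↔ (φ x).card = _
    rw [h1]
  · change (_ ≠ _ ∧ Disjoint (φ u.1) (φ v.1)) ↔ _
    rw [disjoint_map_orderIso_iff, Equiv.injective _ |>.ne_iff]
    exact Iff.rfl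

theorem kneser_solvesAll {n k : ℕ} (hk : 1 ≤ k) (hG : (kneserGraph n k).Connected) :
    SolvesAll (kneserGraph n k) (8 * Real.pi * coreConst (k + 1)) := by
  have hr := isHomogeneousRank_card n
  obtain ⟨j, rfl⟩ : ∃ j, k = j + 1 := ⟨k - 1, by omega⟩
  obtain ⟨Λ, h1, h2⟩ := inc_spectrum hr j
  have hadj : (kneserGraph n (j + 1)).adjMatrix ℂ =
      ((kneserGraph n (j + 1)).adjMatrix ℤ).map (Int.cast : ℤ → ℂ) := by
    ext a b
    simp [SimpleGraph.adjMatrix_apply]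
  obtain ⟨Λ₁, h3, h4⟩ := h2.of_mem_adjoin ((kneserGraph n (j + 1)).adjMatrix ℤ) (by
    rw [← hadj, kneser_adjMatrix hk]
    refine Subalgebra.sum_mem _ fun i hi => Subalgebra.smul_mem _ ?_ _
    rcases (Nat.lt_succ_iff.1 (Finset.mem_range.1 hi)).lt_or_eq with h | rfl
    · exact transpose_mul_inc_mem_adjoin hr (fun i k _ => inc_card_mul n i k) (j - i) i (j + 1) (by omega)
    · have : inc (rankCard n) (j + 1) (j + 1) = 1 := by
        ext a b
        rw [inc_apply]
        rcases eq_or_ne a b with rfl | h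
        · rw [Matrix.one_apply_eq, if_pos le_rfl]
        · rw [Matrix.one_apply_ne h, if_neg fun h' => h (Subtype.ext (hr.eq_of_le h' ?_))]
          exact (b.2.trans a.2.symm).le
      rw [this, Matrix.transpose_one, mul_one]
      exact one_mem _)
  rw [← hadj] at h4
  have htrans := kneser_vertexTransitive n (j + 1)
  obtain ⟨Λ₂, h5, h6⟩ := lap_spectrum_of_adj htrans (h3.trans h1) h4
  exact solvesAll_of_spectrum hG htrans h5 h6

end AlternatingWalk

namespace AlternatingWalk

open Matrix

/-! ### Amplification of a component that the walk moves. -/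

section Invariant

variable {E : Type*} [NormedAddCommGroup E] [InnerProductSpace ℂ E] {D : ℝ → Module.End ℂ E}
  {u w y : E} {a : ℂ} {t₀ : ℝ}

theorem exists_norm_cis_sub_one_mul {c : ℂ} {r : ℝ} (h0 : 0 ≤ r) (h : r ≤ 2 * ‖c‖) :
    ∃ θ : ℝ, ‖(cis θ - 1) * c‖ = r := by
  have hcont : Continuous fun θ : ℝ => ‖(cis θ - 1) * c‖ := by
    have := continuous_cis
    fun_prop
  refine mem_range_of_exists_le_of_exists_ge hcont ⟨0, ?_⟩ ⟨Real.pi, ?_⟩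
  · simpa [cis_zero] using h0
  · rw [norm_mul, cis_pi]
    norm_num
    exact h

/-- Amplification of the component that changes sign when the other one is invariant. -/
theorem amplify_variant (hD : WalkFamily D) (hu : u = a • w + y) (hw : ‖w‖ = 1)
    (hwy : inner ℂ w y = 0) (hu1 : ‖u‖ = 1) (hR : D t₀ w = -w) (hR' : ∀ t, D t y = y)
    (ha : 1 / 4 < ‖a‖ ^ 2) (ha' : ‖a‖ ^ 2 < 3 / 4) :
    ∃ U, Gen D (phaseGate u) 29 U ∧ ∃ ω : ℂ, U u = ω • w := by
  have hnorm := norm_sq_comb hw hwy a 1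
  rw [one_smul, ← hu, hu1, norm_one] at hnorm
  have hy2 : ‖y‖ ^ 2 = 1 - ‖a‖ ^ 2 := by linarith
  have hy0 : 0 < ‖y‖ := by
    rcases (norm_nonneg y).eq_or_lt with h | h
    · rw [← h] at hy2; linarith
    · exact h
  have hyc : (‖y‖ : ℂ) ≠ 0 := by exact_mod_cast hy0.ne'
  set z : E := (‖y‖ : ℂ)⁻¹ • y with hz
  have hyz : y = (‖y‖ : ℂ) • z := by rw [hz, smul_smul, mul_inv_cancel₀ hyc, one_smul]
  have hz1 : ‖z‖ = 1 := by
    rw [hz, norm_smul, norm_inv, Complex.norm_real, norm_norm, inv_mul_cancel₀ hy0.ne']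
  have hwz : inner ℂ w z = 0 := by rw [hz, inner_smul_right, hwy, mul_zero]
  have hzw : inner ℂ z w = 0 := by rw [← inner_conj_symm, hwz, map_zero]
  have hDz : ∀ t, D t z = z := fun t => by rw [hz, map_smul, hR']
  have hnb : ‖(‖y‖ : ℂ)‖ = ‖y‖ := by rw [Complex.norm_real, norm_norm]
  -- A detour: u is first carried to the invariant direction z. A phase shift about u then creates a
  -- w-amplitude of any size up to 2‖a‖‖y‖, which is at least 1/2, so it can be made exactly
  -- sin(π/6).
  obtain ⟨U, hU, ω, hω⟩ := amplify_invariant (t₀ := t₀) (a := (‖y‖ : ℂ)) (w := z) (y := a • w) hD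
    (by rw [← hyz, hu, add_comm]) hz1 (by rw [inner_smul_right, hzw, mul_zero]) hu1 hDz
    (by rw [map_smul, hR, smul_neg]) (by rw [hnb]; linarith) (by rw [hnb]; linarith)
  have hω1 : ‖ω‖ = 1 := by
    have := hU.norm_map hD hu1 u
    rwa [hω, norm_smul, hz1, hu1, mul_one] at this
  obtain ⟨θ, hθ⟩ := exists_norm_cis_sub_one_mul (c := ω * ‖y‖ * a) (r := 1 / 2) (by norm_num) (by
    rw [norm_mul, norm_mul, hω1, hnb, one_mul]
    have : (1 / 4) ^ 2 ≤ (‖y‖ * ‖a‖) ^ 2 := by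
      rw [mul_pow, hy2]; nlinarith
    have := abs_le_of_sq_le_sq' this (by positivity)
    linarith [this.2])
  set v := phaseGate u θ (U u) with hv
  have hUv : Gen D (phaseGate u) 9 (phaseGate u θ * U) := (Gen.of_phase θ).mul hU
  have hv1 : ‖v‖ = 1 := (hUv.norm_map hD hu1 u).trans hu1
  have hi : inner ℂ u (ω • z) = ω * ‖y‖ := by
    rw [inner_smul_right, hu, inner_add_left, inner_smul_left, hwz, mul_zero, zero_add]
    nth_rw 1 [hyz]
    rw [inner_smul_left, inner_self_eq_norm_sq_to_K, hz1]
    simp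
  have hve : v = ((cis θ - 1) * (ω * ‖y‖ * a)) • w +
      (ω + (cis θ - 1) * (ω * ‖y‖) * ‖y‖) • z := by
    rw [hv, hω, phaseGate_apply, hi]
    have hu' : u = a • w + (‖y‖ : ℂ) • z := by rw [← hyz]; exact hu
    rw [hu']
    module
  obtain ⟨ω', hω'⟩ := grover_exact (R := D t₀) (ρ := -1) (j := 1) hve hw
    (by rw [inner_smul_right, hwz, mul_zero]) hv1 (by rw [hR, neg_one_smul])
    (by rw [map_smul, hDz, neg_one_smul, neg_neg]) le_rfl (by
      rw [hθ, ← Real.sin_pi_div_six]; congr 1; norm_num)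
  refine ⟨(phaseGate v Real.pi * D t₀) * (phaseGate u θ * U), ?_, ω', ?_⟩
  · exact (((hUv.phaseGate_map hD hu1 Real.pi).mul (Gen.of_walk t₀)).mul hUv).mono (by norm_num)
  · rw [pow_one] at hω'
    exact hω'

end Invariant

/-! ### Adjacency search on complete bipartite graphs. -/

section TwoSided

variable {V : Type} [Fintype V] [DecidableEq V]

/-- `A` joins every vertex of `S` with every vertex outside `S`. -/
def IsTwoSided (A : Matrix V V ℂ) (S : Finset V) : Prop :=
  ∀ u v, A u v = if (u ∈ S ↔ v ∈ S) then 0 else 1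

variable {A : Matrix V V ℂ} {S : Finset V}

theorem IsTwoSided.compl (hA : IsTwoSided A S) : IsTwoSided A Sᶜ := fun u v => by
  rw [hA]
  simp only [Finset.mem_compl, not_iff_not]

omit [Fintype V] in
theorem IsTwoSided.isHermitian (hA : IsTwoSided A S) : A.IsHermitian := by
  ext u v
  rw [Matrix.conjTranspose_apply, hA, hA]
  by_cases h1 : u ∈ S <;> by_cases h2 : v ∈ S <;> simp [h1, h2]

theorem IsTwoSided.mulVec_apply (hA : IsTwoSided A S) (f : V → ℂ) (u : V) :
    (A *ᵥ f) u = if u ∈ S then ∑ v ∈ Sᶜ, f v else ∑ v ∈ S, f v := by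
  simp only [Matrix.mulVec, dotProduct, hA u, ite_mul, zero_mul, one_mul]
  rw [← Finset.sum_add_sum_compl S]
  split_ifs with h
  · rw [Finset.sum_eq_zero fun v hv => by simp [h, hv], zero_add]
    refine Finset.sum_congr rfl fun v hv => ?_
    rw [Finset.mem_compl] at hv
    simp [h, hv]
  · rw [add_comm, Finset.sum_eq_zero fun v hv => by rw [Finset.mem_compl] at hv; simp [h, hv],
      zero_add]
    exact Finset.sum_congr rfl fun v hv => by simp [h, hv]

omit [Fintype V] in
theorem IsTwoSided.submatrix_swap (hA : IsTwoSided A S) {m m' : V} (hm : m ∈ S) (hm' : m' ∈ S) :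
    (∀ v, Equiv.swap m m' v ∈ S ↔ v ∈ S) ∧
      A.submatrix (Equiv.swap m m') (Equiv.swap m m') = A := by
  have h : ∀ v, Equiv.swap m m' v ∈ S ↔ v ∈ S := by
    intro v
    rw [Equiv.swap_apply_def]
    split_ifs with h1 h2
    · simp [h1, hm, hm']
    · simp [h2, hm, hm']
    · rfl
  exact ⟨h, by ext u v; simp only [Matrix.submatrix_apply, hA _ _, h]⟩

omit [Fintype V] in
theorem sum_uniformState (S : Finset V) : ∑ v ∈ S, uniformState S v = (Real.sqrt S.card : ℂ) := by
  rw [Finset.sum_congr rfl fun v hv => show uniformState S v = _ by rw [uniformState, if_pos hv],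
    Finset.sum_const, nsmul_eq_mul]
  rcases S.card.eq_zero_or_pos with h | h
  · simp [h]
  · have h' : (0 : ℝ) < S.card := by exact_mod_cast h
    have h2 : (Real.sqrt S.card : ℂ) ≠ 0 := by exact_mod_cast (Real.sqrt_pos.2 h').ne'
    have h3 : (S.card : ℂ) = (Real.sqrt S.card : ℂ) * Real.sqrt S.card := by
      rw [← Complex.ofReal_mul, Real.mul_self_sqrt h'.le, Complex.ofReal_natCast]
    rw [h3]; push_cast; field_simp

theorem IsTwoSided.mulVec_uniformState (hA : IsTwoSided A S) (hS : S.Nonempty) (hS' : Sᶜ.Nonempty) :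
    A *ᵥ uniformState S =
      ((Real.sqrt S.card * Real.sqrt Sᶜ.card : ℝ) : ℂ) • uniformState Sᶜ := by
  have h1 : Real.sqrt Sᶜ.card ≠ 0 := (Real.sqrt_pos.2 (by exact_mod_cast hS'.card_pos)).ne'
  ext u
  rw [hA.mulVec_apply, Pi.smul_apply, smul_eq_mul]
  by_cases h : u ∈ S
  · rw [if_pos h, Finset.sum_eq_zero fun v hv => by
      rw [uniformState, if_neg (Finset.mem_compl.1 hv)]]
    simp [uniformState, h]
  · rw [if_neg h, sum_uniformState, uniformState, if_pos (Finset.mem_compl.2 h),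
      ← Complex.ofReal_mul]
    congr 1
    field_simp

variable {c : ℝ}

/-- The sums p and q of an eigenvector over the two sides satisfy cμp = |S|q and cμq = |Sᶜ|p. Unless
both vanish, μ² = 1; if both vanish, the matrix annihilates the vector and μ = 0. -/
theorem IsTwoSided.integerSpectrum (hA : IsTwoSided A S) (hc : 0 < c)
    (hc2 : c ^ 2 = S.card * Sᶜ.card) :
    IntegerSpectrum (((1 / c : ℝ) : ℂ) • A) {0, 1, -1} := by
  intro μ f hf hμ
  have hcc : (c : ℂ) ≠ 0 := by exact_mod_cast hc.ne'
  have hc2' : (c : ℂ) ^ 2 = S.card * Sᶜ.card := by exact_mod_cast hc2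
  have hA' : ∀ u, (if u ∈ S then ∑ v ∈ Sᶜ, f v else ∑ v ∈ S, f v) = c * μ * f u := by
    intro u
    have := congrFun hμ u
    rw [Matrix.smul_mulVec, Pi.smul_apply, Pi.smul_apply, hA.mulVec_apply, smul_eq_mul,
      smul_eq_mul] at this
    rw [mul_assoc, ← this]
    push_cast
    field_simp
  have h1 : c * μ * ∑ v ∈ S, f v = S.card * ∑ v ∈ Sᶜ, f v := by
    rw [Finset.mul_sum, Finset.sum_congr rfl fun v hv => by rw [← hA', if_pos hv],
      Finset.sum_const, nsmul_eq_mul]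
  have h2 : c * μ * ∑ v ∈ Sᶜ, f v = Sᶜ.card * ∑ v ∈ S, f v := by
    rw [Finset.mul_sum, Finset.sum_congr rfl fun v hv => by
      rw [← hA', if_neg (Finset.mem_compl.1 hv)], Finset.sum_const, nsmul_eq_mul]
  generalize ∑ v ∈ S, f v = p at *
  generalize ∑ v ∈ Sᶜ, f v = q at *
  have h3 : (μ ^ 2 - 1) * p = 0 := by
    have : (c : ℂ) ^ 2 * ((μ ^ 2 - 1) * p) = 0 := by
      linear_combination c * μ * h1 + S.card * h2 - p * hc2'
    exact (mul_eq_zero.1 this).resolve_left (pow_ne_zero 2 hcc)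
  have h4 : (μ ^ 2 - 1) * q = 0 := by
    have : (c : ℂ) ^ 2 * ((μ ^ 2 - 1) * q) = 0 := by
      linear_combination c * μ * h2 + Sᶜ.card * h1 - q * hc2'
    exact (mul_eq_zero.1 this).resolve_left (pow_ne_zero 2 hcc)
  by_cases h : μ ^ 2 - 1 = 0
  · have : (μ - 1) * (μ + 1) = 0 := by linear_combination h
    rcases mul_eq_zero.1 this with h' | h'
    · exact ⟨1, by simp, by push_cast; linear_combination h'⟩
    · exact ⟨-1, by simp, by push_cast; linear_combination h'⟩
  · have hp := (mul_eq_zero.1 h3).resolve_left h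
    have hq := (mul_eq_zero.1 h4).resolve_left h
    obtain ⟨u, hu⟩ := Function.ne_iff.1 hf
    have := hA' u
    rw [hp, hq, ite_self] at this
    have h5 : μ = 0 ∨ f u = 0 := by simpa [hcc] using this.symm
    exact ⟨0, by simp, by simpa using h5.resolve_right hu⟩

/-- Here |m⟩ = aw + y with w the uniform state of the side and |a| = |S|^{-1/2}. The rescaled walk
fixes y at all times and negates w at time π, so no recursion over frequencies is needed.
Transpositions within S transport the list to the other marked vertices. -/
theorem IsTwoSided.search (hA : IsTwoSided A S) (hS' : Sᶜ.Nonempty) {m : V} (hm : m ∈ S) :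
    ∃ l : List (Layer Unit), Admissible l ∧ (l.length : ℝ) ≤ 29 * Real.sqrt S.card ∧
      ∀ m' ∈ S, ‖(walkOp A (fun _ => m') l *ᵥ uniformState S) m'‖ ^ 2 = 1 := by
  have hS : S.Nonempty := ⟨m, hm⟩
  suffices h : ∃ l : List (Layer Unit), Admissible l ∧ (l.length : ℝ) ≤ 29 * Real.sqrt S.card ∧
      ‖(walkOp A (fun _ => m) l *ᵥ uniformState S) m‖ ^ 2 = 1 by
    obtain ⟨l, h1, h2, h3⟩ := h
    refine ⟨l, h1, h2, fun m' hm' => ?_⟩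
    obtain ⟨h4, h5⟩ := hA.submatrix_swap hm hm'
    have := search_transport h5 h4 m l
    rw [Equiv.swap_apply_left] at this
    rw [this, h3]
  have hca : (1 : ℝ) ≤ S.card := by exact_mod_cast hS.card_pos
  have hcb : (1 : ℝ) ≤ Sᶜ.card := by exact_mod_cast hS'.card_pos
  have hra : 1 ≤ Real.sqrt S.card := Real.one_le_sqrt.2 hca
  have hrb : 1 ≤ Real.sqrt Sᶜ.card := Real.one_le_sqrt.2 hcb
  have hra2 : Real.sqrt S.card ^ 2 = S.card := Real.sq_sqrt (by linarith)
  have hrb2 : Real.sqrt Sᶜ.card ^ 2 = Sᶜ.card := Real.sq_sqrt (by linarith)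
  set c : ℝ := Real.sqrt S.card * Real.sqrt Sᶜ.card with hc
  have hc1 : 1 ≤ c := one_le_mul_of_one_le_of_one_le hra hrb
  have hc0 : (c : ℂ) ≠ 0 := by exact_mod_cast (by linarith : c ≠ 0)
  set H : Matrix V V ℂ := ((1 / c : ℝ) : ℂ) • A with hHdef
  have hH : H.IsHermitian := by
    rw [Matrix.IsHermitian, hHdef, Matrix.conjTranspose_smul, hA.isHermitian.eq]
    simp
  have hΛ : IntegerSpectrum H {0, 1, -1} :=
    hA.integerSpectrum (by linarith) (by rw [hc, mul_pow, hra2, hrb2])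
  have hD := walkFamily_evolve hH
  set D := fun t => euclideanOp (evolve H t) with hDdef
  set w : EuclideanSpace ℂ V := WithLp.toLp 2 (uniformState S) with hw
  have hw1 : ‖w‖ = 1 := norm_uniformState hS
  have hwm : inner ℂ w (eket m) = ((1 / Real.sqrt S.card : ℝ) : ℂ) := by
    rw [← inner_conj_symm, inner_eket]
    have : w m = ((1 / Real.sqrt S.card : ℝ) : ℂ) := by simp [hw, uniformState, hm]
    rw [this, Complex.conj_ofReal]
  set a : ℂ := ((1 / Real.sqrt S.card : ℝ) : ℂ) with ha
  set y : EuclideanSpace ℂ V := eket m - a • w with hy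
  have hna : ‖a‖ = 1 / Real.sqrt S.card := by
    rw [ha, Complex.norm_real, Real.norm_of_nonneg (by positivity)]
  have hu : eket m = a • w + y := by rw [hy]; abel
  have hwy : inner ℂ w y = 0 := by
    rw [hy, inner_sub_right, inner_smul_right, inner_self_eq_norm_sq_to_K, hw1, hwm]; simp
  have hwS : H *ᵥ uniformState S = uniformState Sᶜ := by
    rw [hHdef, Matrix.smul_mulVec, hA.mulVec_uniformState hS hS', smul_smul, ← Complex.ofReal_mul,
      one_div_mul_cancel (by linarith), Complex.ofReal_one, one_smul]
  have hwS' : H *ᵥ uniformState Sᶜ = uniformState S := by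
    have := hA.compl.mulVec_uniformState hS' (by simpa using hS)
    rw [compl_compl] at this
    rw [hHdef, Matrix.smul_mulVec, this, smul_smul, ← Complex.ofReal_mul, mul_comm (Real.sqrt _),
      one_div_mul_cancel (by linarith), Complex.ofReal_one, one_smul]
  have hDw : D Real.pi w = -w := by
    have h1 : evolve H Real.pi *ᵥ (uniformState S + uniformState Sᶜ) =
        -(uniformState S + uniformState Sᶜ) := by
      rw [evolve_mulVec (l := 1) (by rw [Matrix.mulVec_add, hwS, hwS', add_comm]; simp), one_mul,
        cis_pi, neg_one_smul]
    have h2 : evolve H Real.pi *ᵥ (uniformState S - uniformState Sᶜ) =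
        -(uniformState S - uniformState Sᶜ) := by
      rw [evolve_mulVec (l := -1) (by rw [Matrix.mulVec_sub, hwS, hwS']; simp), neg_one_mul,
        ← conj_cis, cis_pi]
      simp
    rw [Matrix.mulVec_add] at h1
    rw [Matrix.mulVec_sub] at h2
    have h3 : evolve H Real.pi *ᵥ uniformState S = - uniformState S := by
      ext v
      have e1 := congrFun h1 v
      have e2 := congrFun h2 v
      simp only [Pi.add_apply, Pi.sub_apply, Pi.neg_apply] at e1 e2 ⊢
      linear_combination (e1 + e2) / 2
    exact congrArg (WithLp.toLp 2) h3
  have hHy : H *ᵥ y.ofLp = ((0 : ℝ) : ℂ) • y.ofLp := by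
    have e : A *ᵥ y.ofLp = 0 := by
      ext v
      have hye : ∀ x, y.ofLp x = ket m x - a * uniformState S x := fun x => rfl
      have hsum1 : ∑ x ∈ S, y.ofLp x = 0 := by
        simp only [hye]
        rw [Finset.sum_sub_distrib, ← Finset.mul_sum, sum_uniformState, ha, ← Complex.ofReal_mul,
          one_div_mul_cancel (by linarith)]
        simp [ket, Pi.single_apply, hm]
      have hsum2 : ∑ x ∈ Sᶜ, y.ofLp x = 0 := by
        refine Finset.sum_eq_zero fun x hx => ?_
        have hx' := Finset.mem_compl.1 hx
        have : x ≠ m := by rintro rfl; exact hx' hm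
        rw [hye, uniformState, if_neg hx', ket, Pi.single_eq_of_ne this]
        simp
      rw [hA.mulVec_apply, hsum1, hsum2, ite_self]
      rfl
    rw [hHdef, Matrix.smul_mulVec, e]
    simp
  have hDy : ∀ t, D t y = y := fun t => by
    change euclideanOp (evolve H t) y = y
    rw [euclideanOp_apply, evolve_mulVec hHy]
    simp [cis_zero]
  have hreach : ∃ n U, Gen D (phaseGate (eket m)) n U ∧ (n : ℝ) ≤ 29 * Real.sqrt S.card ∧
      ∃ ω : ℂ, U (eket m) = ω • w := by
    -- For |S| ≥ 4 the overlap is at most 1/2; for |S| = 1 the start is the target; |S| = 2, 3 give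
    -- the squared overlaps 1/2 and 1/3, in the middle window.
    rcases Nat.lt_or_ge S.card 4 with h4 | h4
    · rcases (Nat.one_le_iff_ne_zero.2 hS.card_pos.ne').eq_or_lt with h1 | h1
      · refine ⟨0, 1, .one, by simp, 1, ?_⟩
        rw [Module.End.one_apply, one_smul]
        obtain ⟨x, hx⟩ := Finset.card_eq_one.1 h1.symm
        have hmx : m = x := by simpa [hx] using hm
        subst hmx
        ext v
        simp [hw, eket, ket, uniformState, hx]
      · have hlo : (2 : ℝ) ≤ S.card := by exact_mod_cast h1
        have hhi : (S.card : ℝ) ≤ 3 := by exact_mod_cast Nat.lt_succ_iff.1 h4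
        have hna2 : ‖a‖ ^ 2 = 1 / S.card := by rw [hna, div_pow, hra2, one_pow]
        obtain ⟨U, hU, ω, hω⟩ := amplify_variant hD hu hw1 hwy (norm_eket m) hDw hDy
          (by rw [hna2, div_lt_div_iff₀ (by norm_num) (by linarith)]; linarith)
          (by rw [hna2, div_lt_div_iff₀ (by linarith) (by norm_num)]; linarith)
        exact ⟨29, U, hU, by push_cast; linarith, ω, hω⟩
    · have h2 : 2 ≤ Real.sqrt S.card := Real.le_sqrt_of_sq_le (by
        have : (4 : ℝ) ≤ S.card := by exact_mod_cast h4
        linarith)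
      obtain ⟨n, U, hU, hn, hω⟩ := amplify_small (ρ := -1) hD hu hw1 hwy (norm_eket m) (by simp)
        (by rw [hDw, neg_one_smul]) (by rw [hDy, neg_one_smul, neg_neg])
        (by rw [hna]; exact one_div_pos.2 (by linarith))
        (by rw [hna]; exact one_div_le_one_div_of_le (by norm_num) h2)
      refine ⟨n, U, hU, ?_, hω⟩
      rw [hna] at hn
      simp only [div_div_eq_mul_div, div_one] at hn
      linarith
  obtain ⟨n, U, hU, hn, ω, hω⟩ := hreach
  have hω1 : ‖ω‖ = 1 := unit_smul_of_gen hD hU hw1 hω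
  have hω0 : ω ≠ 0 := by rw [← norm_pos_iff, hω1]; norm_num
  obtain ⟨U', hU', _, h2, _⟩ := hU.exists_inv hD (norm_eket m)
  have hUw : U' w = ω⁻¹ • eket m := by
    have := congrArg U' hω
    rw [← Module.End.mul_apply, h2, Module.End.one_apply, map_smul] at this
    rw [this, smul_smul, inv_mul_cancel₀ hω0, one_smul]
  -- Time t' under A/c is time t'/c under A. Since c ≥ 1, it stays in [0, 2π) although A need not
  -- have integer eigenvalues.
  have hper : ∀ t, ∃ t' ∈ Set.Ico 0 (2 * Real.pi), evolve A t' = evolve H t := by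
    intro t
    obtain ⟨t', ⟨h3, h4⟩, h5⟩ := hΛ.periodic hH t
    refine ⟨1 / c * t', ⟨mul_nonneg (one_div_nonneg.2 (by linarith)) h3, ?_⟩, ?_⟩
    · refine lt_of_le_of_lt ?_ h4
      exact mul_le_of_le_one_left h3 (by rw [div_le_one (by linarith)]; exact hc1)
    · rw [← h5, hHdef, evolve_smul]
  obtain ⟨l, hl, hlen, hlU⟩ := Gen.exists_list hper (fun _ : Unit => m) () hU'
  refine ⟨l, hl, le_trans (by exact_mod_cast hlen) hn, ?_⟩
  rw [← hlU, euclideanOp_apply] at hUw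
  have h6 : walkOp A (fun _ => m) l *ᵥ uniformState S = ω⁻¹ • ket m := congrArg WithLp.ofLp hUw
  rw [h6]
  simp [ket, hω1]

end TwoSided

/-! ### Complete bipartite graphs: both sides together, and the Laplacian tasks. -/

section Bipartite

variable (a b : ℕ)

theorem bipartite_twoSided :
    IsTwoSided ((bipartiteGraph a b).adjMatrix ℂ) (bipartiteSides a b 0) := by
  intro u v
  rw [SimpleGraph.adjMatrix_apply]
  rcases u with u | u <;> rcases v with v | v <;> simp [bipartiteSides, bipartiteGraph]

theorem bipartiteSides_compl : (bipartiteSides a b 0)ᶜ = bipartiteSides a b 1 := by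
  ext v
  rcases v with v | v <;> simp [bipartiteSides]

theorem card_bipartiteSides_zero : (bipartiteSides a b 0).card = a := by simp [bipartiteSides]

theorem card_bipartiteSides_one : (bipartiteSides a b 1).card = b := by simp [bipartiteSides]

variable {a b}

theorem bipartite_search (ha : 1 ≤ a) (hb : 1 ≤ b) :
    DeterministicSearch ((bipartiteGraph a b).adjMatrix ℂ) (bipartiteSides a b)
      (sqrtBudget (Fin a ⊕ Fin b) (232 * Real.pi)) := by
  have hA := bipartite_twoSided a b
  have hA' := hA.compl
  rw [bipartiteSides_compl] at hA'
  have h0 : (Sum.inl ⟨0, ha⟩ : Fin a ⊕ Fin b) ∈ bipartiteSides a b 0 := by simp [bipartiteSides]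
  have h1 : (Sum.inr ⟨0, hb⟩ : Fin a ⊕ Fin b) ∈ bipartiteSides a b 1 := by simp [bipartiteSides]
  obtain ⟨l₀, h3, h4, h5⟩ := hA.search (by rw [bipartiteSides_compl]; exact ⟨_, h1⟩) h0
  obtain ⟨l₁, h6, h7, h8⟩ := hA'.search
    (by rw [← bipartiteSides_compl, compl_compl]; exact ⟨_, h0⟩) h1
  rw [card_bipartiteSides_zero] at h4
  rw [card_bipartiteSides_one] at h7
  have hN : (Fintype.card (Fin a ⊕ Fin b) : ℝ) = a + b := by simp
  have ha' : Real.sqrt a ≤ Real.sqrt (a + b) := Real.sqrt_le_sqrt (by simp)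
  have hb' : Real.sqrt b ≤ Real.sqrt (a + b) := Real.sqrt_le_sqrt (by simp)
  have hpi := Real.pi_gt_three
  have hs := Real.sqrt_nonneg ((a : ℝ) + b)
  rw [sqrtBudget, hN]
  -- The constant is 232π = 2 · 4π · 29: two walks, at most 4π of time per layer, 29√|S| layers
  -- each.
  refine ⟨![l₀, l₁], fun i => ?_, ?_, ?_, fun m => ?_⟩
  · fin_cases i
    · exact h3
    · exact h6
  · rw [Fin.sum_univ_two]
    push_cast
    nlinarith
  · rw [Fin.sum_univ_two]
    have e0 := totalTime_le_budget h3 h4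
    have e1 := totalTime_le_budget h6 h7
    simp only [Matrix.cons_val_zero, Matrix.cons_val_one]
    have e2 : 4 * Real.pi * (29 * Real.sqrt a) ≤ 4 * Real.pi * (29 * Real.sqrt (a + b)) := by gcongr
    have e3 : 4 * Real.pi * (29 * Real.sqrt b) ≤ 4 * Real.pi * (29 * Real.sqrt (a + b)) := by gcongr
    linarith
  · by_cases hm : m ∈ bipartiteSides a b 0
    · exact ⟨0, hm, h5 m hm⟩
    · have hm' : m ∈ bipartiteSides a b 1 := by
        rw [← bipartiteSides_compl, Finset.mem_compl]; exact hm
      exact ⟨1, hm', h8 m hm'⟩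

theorem bipartite_connected (ha : 1 ≤ a) (hb : 1 ≤ b) : (bipartiteGraph a b).Connected := by
  have h : ∀ x y, (bipartiteGraph a b).Adj (Sum.inl x) (Sum.inr y) := by simp [bipartiteGraph]
  have : Nonempty (Fin a ⊕ Fin b) := ⟨Sum.inl ⟨0, ha⟩⟩
  refine (SimpleGraph.connected_iff_exists_forall_reachable _).2 ⟨Sum.inl ⟨0, ha⟩, ?_⟩
  rintro (x | y)
  · exact (h _ ⟨0, hb⟩).reachable.trans (h x ⟨0, hb⟩).symm.reachable
  · exact (h _ y).reachable

/-- For μ different from a and b, an eigenvector is determined by its sums over the two sides. These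
cannot both vanish, and each is annihilated by μ(μ - (a+b)). -/
theorem bipartite_spectrum (a b : ℕ) :
    IntegerSpectrum ((bipartiteGraph a b).lapMatrix ℂ) {0, (a : ℤ), (b : ℤ), (a + b : ℤ)} := by
  intro μ f hf hμ
  have hl : ∀ x, (b - μ) * f (Sum.inl x) = ∑ y, f (Sum.inr y) := by
    intro x
    have := congrFun hμ (Sum.inl x)
    rw [lap_apply, Fintype.sum_sum_type] at this
    simp [bipartiteGraph] at this
    linear_combination this
  have hr : ∀ y, (a - μ) * f (Sum.inr y) = ∑ x, f (Sum.inl x) := by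
    intro y
    have := congrFun hμ (Sum.inr y)
    rw [lap_apply, Fintype.sum_sum_type] at this
    simp [bipartiteGraph] at this
    linear_combination this
  by_cases hμa : μ = a
  · exact ⟨a, by simp, by simpa using hμa⟩
  by_cases hμb : μ = b
  · exact ⟨b, by simp, by simpa using hμb⟩
  have hna : (a : ℂ) - μ ≠ 0 := fun h => hμa (by linear_combination -h)
  have hnb : (b : ℂ) - μ ≠ 0 := fun h => hμb (by linear_combination -h)
  have h1 : (b - μ) * ∑ x, f (Sum.inl x) = a * ∑ y, f (Sum.inr y) := by
    rw [Finset.mul_sum, Finset.sum_congr rfl fun x _ => hl x]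
    simp
  have h2 : (a - μ) * ∑ y, f (Sum.inr y) = b * ∑ x, f (Sum.inl x) := by
    rw [Finset.mul_sum, Finset.sum_congr rfl fun x _ => hr x]
    simp
  generalize ∑ x, f (Sum.inl x) = p at *
  generalize ∑ y, f (Sum.inr y) = q at *
  have h3 : μ * (μ - (a + b)) * p = 0 := by linear_combination (a - μ) * h1 + a * h2
  have h4 : μ * (μ - (a + b)) * q = 0 := by linear_combination (b - μ) * h2 + b * h1
  by_cases h : μ * (μ - (a + b)) = 0
  · rcases mul_eq_zero.1 h with h' | h'
    · exact ⟨0, by simp, by simpa using h'⟩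
    · exact ⟨a + b, by simp, by push_cast; linear_combination h'⟩
  · have hp := (mul_eq_zero.1 h3).resolve_left h
    have hq := (mul_eq_zero.1 h4).resolve_left h
    refine absurd (funext fun v => ?_) hf
    rcases v with x | y
    · have := hl x
      rw [hq] at this
      exact (mul_eq_zero.1 this).resolve_left hnb
    · have := hr y
      rw [hp] at this
      exact (mul_eq_zero.1 this).resolve_left hna

theorem bipartite_sampling_and_transfer (ha : 1 ≤ a) (hb : 1 ≤ b) :
    PerfectStateTransfer ((bipartiteGraph a b).lapMatrix ℂ)
        (sqrtBudget (Fin a ⊕ Fin b) (8 * Real.pi * coreConst 4)) ∧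
      ExactUniformSampling ((bipartiteGraph a b).lapMatrix ℂ)
        (sqrtBudget (Fin a ⊕ Fin b) (8 * Real.pi * coreConst 4)) :=
  sampling_and_transfer (bipartite_connected ha hb) Finset.card_le_four (bipartite_spectrum a b)

theorem sqrtBudget_mono {V : Type} [Fintype V] {C C' : ℝ} (h : C ≤ C') :
    sqrtBudget V C ≤ sqrtBudget V C' := by
  unfold sqrtBudget
  gcongr

theorem bipartite_tasks (ha : 1 ≤ a) (hb : 1 ≤ b) :
    DeterministicSearch ((bipartiteGraph a b).adjMatrix ℂ) (bipartiteSides a b)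
        (sqrtBudget (Fin a ⊕ Fin b) (232 * Real.pi + 8 * Real.pi * coreConst 4)) ∧
      PerfectStateTransfer ((bipartiteGraph a b).lapMatrix ℂ)
        (sqrtBudget (Fin a ⊕ Fin b) (232 * Real.pi + 8 * Real.pi * coreConst 4)) ∧
      ExactUniformSampling ((bipartiteGraph a b).lapMatrix ℂ)
        (sqrtBudget (Fin a ⊕ Fin b) (232 * Real.pi + 8 * Real.pi * coreConst 4)) := by
  have h := coreConst_nonneg 4
  have hpi := Real.pi_pos
  obtain ⟨h1, h2⟩ := bipartite_sampling_and_transfer ha hb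
  exact ⟨(bipartite_search ha hb).mono (sqrtBudget_mono (le_add_of_nonneg_right (by positivity))),
    h1.mono (sqrtBudget_mono (le_add_of_nonneg_left (by positivity))),
    h2.mono (sqrtBudget_mono (le_add_of_nonneg_left (by positivity)))⟩

end Bipartite

end AlternatingWalk

theorem theorem3 :
    -- Johnson graphs, `k` fixed
    (∀ k : ℕ, 1 ≤ k → ∃ C : ℝ, ∀ n : ℕ, k ≤ n →
      AlternatingWalk.SolvesAll (AlternatingWalk.johnsonGraph n k) C) ∧
    -- Hamming graphs, `d` fixed
    (∀ d : ℕ, 1 ≤ d → ∃ C : ℝ, ∀ q : ℕ, 1 ≤ q →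
      AlternatingWalk.SolvesAll (AlternatingWalk.hammingGraph d q) C) ∧
    -- connected Kneser graphs, `k` fixed
    (∀ k : ℕ, 1 ≤ k → ∃ C : ℝ, ∀ n : ℕ, 2 * k ≤ n →
      (AlternatingWalk.kneserGraph n k).Connected →
      AlternatingWalk.SolvesAll (AlternatingWalk.kneserGraph n k) C) ∧
    -- Grassmann graphs, `k` fixed
    (∀ k : ℕ, 1 ≤ k → ∃ C : ℝ, ∀ (F : Type) [Field F] [Fintype F] (n : ℕ), k ≤ n →
      AlternatingWalk.SolvesAll (AlternatingWalk.grassmannGraph F n k) C) ∧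
    -- rook graphs
    (∃ C : ℝ, ∀ m n : ℕ, 1 ≤ m → 1 ≤ n →
      AlternatingWalk.SolvesAll (AlternatingWalk.rookGraph m n) C) ∧
    -- complete-square graphs
    (∃ C : ℝ, ∀ n : ℕ, 1 ≤ n →
      AlternatingWalk.SolvesAll (AlternatingWalk.completeSquareGraph n) C) ∧
    -- complete bipartite graphs
    (∃ C : ℝ, ∀ a b : ℕ, 1 ≤ a → 1 ≤ b →
      AlternatingWalk.DeterministicSearch ((AlternatingWalk.bipartiteGraph a b).adjMatrix ℂ)
        (AlternatingWalk.bipartiteSides a b)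
        (AlternatingWalk.sqrtBudget (Fin a ⊕ Fin b) C) ∧
      AlternatingWalk.PerfectStateTransfer ((AlternatingWalk.bipartiteGraph a b).lapMatrix ℂ)
        (AlternatingWalk.sqrtBudget (Fin a ⊕ Fin b) C) ∧
      AlternatingWalk.ExactUniformSampling ((AlternatingWalk.bipartiteGraph a b).lapMatrix ℂ)
        (AlternatingWalk.sqrtBudget (Fin a ⊕ Fin b) C)) := by
  open AlternatingWalk in
  -- Each argument of `coreConst` bounds the number of Laplacian eigenvalues: 2^d for Hamming, 4 for
  -- rook, 3 · 2 = 6 for complete-square graphs.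
  refine ⟨fun k hk => ⟨_, fun n hn => johnson_solvesAll hk hn⟩, fun d _ => ⟨8 * Real.pi * coreConst (2 ^ d), fun q hq => ?_⟩,
    fun k hk => ⟨_, fun n _ hG => kneser_solvesAll hk hG⟩,
    fun k hk => ⟨_, fun F _ _ n hn => grassmann_solvesAll F hk hn⟩,
    ⟨8 * Real.pi * coreConst 4, fun m n hm hn => ?_⟩,
    ⟨8 * Real.pi * coreConst 6, fun n hn => ?_⟩, ⟨_, fun a b ha hb => bipartite_tasks ha hb⟩⟩
  · obtain ⟨Λ, h1, h2⟩ := hamming_spectrum d q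
    exact solvesAll_of_spectrum (hamming_connected hq) hamming_vertexTransitive h1 h2
  · obtain ⟨Λ, h1, h2⟩ := rook_spectrum m n
    exact solvesAll_of_spectrum (rook_connected hm hn) rook_vertexTransitive h1 h2
  · obtain ⟨Λ, h1, h2⟩ := completeSquare_spectrum n
    exact solvesAll_of_spectrum (completeSquare_connected hn) completeSquare_vertexTransitive h1 h2
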